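/- **Theorem (Soundness of staging).** The setting is as follows. *Theories.* A *model of two-level type theory* (2LTT) consists of: a category of contexts $\Gamma:\mathsf{Con}$ and substitutions $\mathsf{Sub}\,\Gamma\,\Delta$ with a chosen terminal object $\bullet$; for each stage $i\in\{0,1\}$ ($0$: object level, $1$: meta level) and size level $j\in\mathbb N$, sets of types $\mathsf{Ty}_{i,j}\,\Gamma$ and, for each $A\in\mathsf{Ty}_{i,j}\,\Gamma$, of terms $\mathsf{Tm}_{i,j}\,\Gamma\,A$, with functorial substitution and context comprehension $\Gamma\triangleright A$ (weakening $\mathsf p$, zero variable $\mathsf q$, a category with families); for each $i$, type formers stable under substitution: Coquand universes $\mathsf U_{i,j}:\mathsf{Ty}_{i,j+1}\,\Gamma$ with mutually inverse $\mathsf{El}:\mathsf{Tm}_{i,j+1}\,\Gamma\,\mathsf U_{i,j}\to\mathsf{Ty}_{i,j}\,\Gamma$ and $\mathsf{Code}$, $\Sigma$-types and $\Pi$-types (both with $\beta$ and $\eta$) within each level $j$, and natural numbers $\mathsf{Nat}_{i,j}:\mathsf{Ty}_{i,j}\,\Gamma$ with elimination from level $j$ into any level $k$ of the same stage; and, for each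 $j$, a lifting $\Uparrow:\mathsf{Ty}_{0,j}\,\Gamma\to\mathsf{Ty}_{1,j}\,\Gamma$ with mutually inverse quoting $\mathsf{Tm}_{0,j}\,\Gamma\,A\to\mathsf{Tm}_{1,j}\,\Gamma\,(\Uparrow A)$ and splicing, all natural in $\Gamma$. A *model of the object theory* has the same structure with a single stage and no lifting, with types $\mathsf{Ty}_{\mathbb O j}$ and terms $\mathsf{Tm}_{\mathbb O j}$. The *syntax* of either theory is its initial model; its types and terms are thus identified up to conversion. Write $\mathbb O$ for the syntax of the object theory, and $\mathsf{Con}_{\mathbb O}$ for its contexts. Since the stage-$0$ part of the syntax of 2LTT is a model of the object theory, there is a unique structure-preserving *embedding* $\ulcorner-\urcorner$ of $\mathbb O$ into the syntax of 2LTT. *Presheaf model.* Fix a hierarchy of universes of sets $\mathsf{Set}_0\in\mathsf{Set}_1\in\cdots$ (given by a strictly increasing sequence of inaccessible cardinals). The presheaf model $\hat{\mathbb O}$ of 2LTT has as contexts the presheaves on the category of contexts and substitutions of $\mathbb O$, and as substitutions the natural transformations. Its meta-level types of level $j$ over $\Gamma$ are the displayed presheaves over $\Gamma$ valued in $\mathsf{Set}_j$,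 and its meta-level terms are their sections, with the usual presheaf-theoretic type formers. Its object-level types and terms over $\Gamma$ are the natural transformations $A$ from $\Gamma$ to the presheaf $\mathsf{Ty}_{\mathbb O j}$ and the sections of the displayed presheaf $\mathsf{Tm}_{\mathbb O j}[A]$, with type formers inherited from $\mathbb O$. The extension of a presheaf by $A$ of either stage consists of pairs $(\gamma,\alpha)$. Lifting is $\Uparrow A=\mathsf{Tm}_{\mathbb O j}[A]$, with quoting and splicing the identity. Let $\mathbb E$ be the unique morphism of models from the syntax of 2LTT to $\hat{\mathbb O}$, and write $|{-}|$ for the action of presheaves, displayed presheaves and natural transformations on objects and elements. *Open staging.* For each $\Gamma\in\mathsf{Con}_{\mathbb O}$, the generic environment $\Gamma^P\in|\mathbb E\ulcorner\Gamma\urcorner|\,\Gamma$ is defined by recursion on $\Gamma$: $\bullet^P$ is the unique element, and $(\Gamma\triangleright A)^P=(\Gamma^P[\mathsf p],\,\mathsf q)$ (this is well-typed since $|\mathbb E\ulcorner A\urcorner|\,\Gamma^P=A$). For $A\in\mathsf{Ty}_{0,j}\,\ulcorner\Gamma\urcorner$ and $t\in\mathsf{Tm}_{0,j}\,\ulcorner\Gamma\urcorner\,A$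 let $$\mathsf{Stage}\,A:=|\mathbb E\,A|\,\Gamma^P\in\mathsf{Ty}_{\mathbb O j}\,\Gamma,\qquad \mathsf{Stage}\,t:=|\mathbb E\,t|\,\Gamma^P .$$ *Claim.* For all $j\in\mathbb N$, $\Gamma\in\mathsf{Con}_{\mathbb O}$, $A\in\mathsf{Ty}_{0,j}\,\ulcorner\Gamma\urcorner$ and $t\in\mathsf{Tm}_{0,j}\,\ulcorner\Gamma\urcorner\,A$, $$\ulcorner\mathsf{Stage}\,A\urcorner=A,\qquad \mathsf{Stage}\,t\in\mathsf{Tm}_{\mathbb O j}\,\Gamma\,(\mathsf{Stage}\,A),\qquad \ulcorner\mathsf{Stage}\,t\urcorner=t .$$ -/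

import Mathlib

universe u v u₁ v₁ u₂ v₂ u₃ v₃

namespace TwoLevel

/-! ### Models -/

/-- The base of a model: a category with a chosen terminal object. Objects are contexts,
morphisms are (parallel) substitutions, the terminal object is the empty context. -/
structure Base where
  Con : Type u
  Sub : Con → Con → Type v
  id : ∀ Γ, Sub Γ Γ
  comp : ∀ {Γ Δ Θ}, Sub Δ Θ → Sub Γ Δ → Sub Γ Θ
  id_comp : ∀ {Γ Δ} (σ : Sub Γ Δ), comp (id Δ) σ = σ
  comp_id : ∀ {Γ Δ} (σ : Sub Γ Δ), comp σ (id Γ) = σ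
  assoc : ∀ {Γ Δ Θ Ξ} (σ : Sub Θ Ξ) (δ : Sub Δ Θ) (ν : Sub Γ Δ),
    comp (comp σ δ) ν = comp σ (comp δ ν)
  emp : Con
  eps : ∀ Γ, Sub Γ emp
  eps_uniq : ∀ {Γ} (σ : Sub Γ emp), σ = eps Γ

/-- A family structure with comprehension over a base (a category with families), with types and
terms indexed by a size level `j : ℕ`. The family of sets of terms `Tm Γ A`, for `A : Ty Γ`, is
given by its total set `Tm j Γ` together with the map `tyOf` sending each term to its type; the
set of terms of type `A` is the fibre of `tyOf` over `A`. Context comprehension is given by the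
weakening `p`, the zero variable `q`, extension of substitutions `pair`, and the equations which
say that `τ ↦ (p ∘ τ, q[τ])` and `pair` are inverse to each other. -/
structure CwF (C : Base.{u, v}) where
  Ty : ℕ → C.Con → Type v
  Tm : ℕ → C.Con → Type v
  tyOf : ∀ {j Γ}, Tm j Γ → Ty j Γ
  tySub : ∀ {j Γ Δ}, Ty j Δ → C.Sub Γ Δ → Ty j Γ
  tmSub : ∀ {j Γ Δ}, Tm j Δ → C.Sub Γ Δ → Tm j Γ
  tyOf_tmSub : ∀ {j Γ Δ} (t : Tm j Δ) (σ : C.Sub Γ Δ), tyOf (tmSub t σ) = tySub (tyOf t) σ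
  tySub_id : ∀ {j Γ} (A : Ty j Γ), tySub A (C.id Γ) = A
  tySub_comp : ∀ {j Γ Δ Θ} (A : Ty j Θ) (σ : C.Sub Δ Θ) (δ : C.Sub Γ Δ),
    tySub A (C.comp σ δ) = tySub (tySub A σ) δ
  tmSub_id : ∀ {j Γ} (t : Tm j Γ), tmSub t (C.id Γ) = t
  tmSub_comp : ∀ {j Γ Δ Θ} (t : Tm j Θ) (σ : C.Sub Δ Θ) (δ : C.Sub Γ Δ),
    tmSub t (C.comp σ δ) = tmSub (tmSub t σ) δ
  ext : ∀ {j} (Γ : C.Con), Ty j Γ → C.Con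
  p : ∀ {j Γ} (A : Ty j Γ), C.Sub (ext Γ A) Γ
  q : ∀ {j Γ} (A : Ty j Γ), Tm j (ext Γ A)
  tyOf_q : ∀ {j Γ} (A : Ty j Γ), tyOf (q A) = tySub A (p A)
  pair : ∀ {j Γ Δ} (σ : C.Sub Γ Δ) (A : Ty j Δ) (t : Tm j Γ), tyOf t = tySub A σ →
    C.Sub Γ (ext Δ A)
  p_pair : ∀ {j Γ Δ} (σ : C.Sub Γ Δ) (A : Ty j Δ) (t : Tm j Γ) (h : tyOf t = tySub A σ),
    C.comp (p A) (pair σ A t h) = σ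
  q_pair : ∀ {j Γ Δ} (σ : C.Sub Γ Δ) (A : Ty j Δ) (t : Tm j Γ) (h : tyOf t = tySub A σ),
    tmSub (q A) (pair σ A t h) = t
  pair_eta : ∀ {j Γ Δ} (A : Ty j Δ) (τ : C.Sub Γ (ext Δ A)),
    pair (C.comp (p A) τ) A (tmSub (q A) τ)
      (by rw [tyOf_tmSub, tyOf_q, tySub_comp]) = τ

namespace CwF

variable {C : Base.{u, v}} (F : CwF C)

/-- Lifting of `σ` under a binder: `(σ ∘ p, q) : Sub (Γ ▹ A') (Δ ▹ A)`, where `A' = A[σ]`. -/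
def upTo {j : ℕ} {Γ Δ : C.Con} (σ : C.Sub Γ Δ) (A : F.Ty j Δ) (A' : F.Ty j Γ)
    (h : A' = F.tySub A σ) : C.Sub (F.ext Γ A') (F.ext Δ A) :=
  F.pair (C.comp σ (F.p A')) A (F.q A') (by rw [F.tyOf_q, h, F.tySub_comp])

/-- Lifting of `σ` under a binder: `(σ ∘ p, q) : Sub (Γ ▹ A[σ]) (Δ ▹ A)`. -/
def up {j : ℕ} {Γ Δ : C.Con} (σ : C.Sub Γ Δ) (A : F.Ty j Δ) :
    C.Sub (F.ext Γ (F.tySub A σ)) (F.ext Δ A) :=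
  F.upTo σ A (F.tySub A σ) rfl

/-- Single substitution `(id, t) : Sub Γ (Γ ▹ A)`. -/
def inst {j : ℕ} {Γ : C.Con} (A : F.Ty j Γ) (t : F.Tm j Γ) (h : F.tyOf t = A) :
    C.Sub Γ (F.ext Γ A) :=
  F.pair (C.id Γ) A t (by rw [h, F.tySub_id])

theorem pair_congr {j : ℕ} {Γ Δ : C.Con} {σ σ' : C.Sub Γ Δ} {A : F.Ty j Δ} {t t' : F.Tm j Γ}
    (h : F.tyOf t = F.tySub A σ) (h' : F.tyOf t' = F.tySub A σ') (e : σ = σ') (e' : t = t') :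
    F.pair σ A t h = F.pair σ' A t' h' := by
  subst e e'; rfl

theorem pair_comp {j : ℕ} {Γ Δ Θ : C.Con} (σ : C.Sub Δ Θ) (A : F.Ty j Θ) (t : F.Tm j Δ)
    (h : F.tyOf t = F.tySub A σ) (δ : C.Sub Γ Δ) :
    C.comp (F.pair σ A t h) δ = F.pair (C.comp σ δ) A (F.tmSub t δ)
      (by rw [F.tyOf_tmSub, h, F.tySub_comp]) := by
  rw [← F.pair_eta A (C.comp (F.pair σ A t h) δ)]
  apply pair_congr
  · rw [← C.assoc, F.p_pair]
  · rw [F.tmSub_comp, F.q_pair]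

theorem upTo_comp_inst {j : ℕ} {Γ Δ : C.Con} (σ : C.Sub Γ Δ) (A : F.Ty j Δ) (A' : F.Ty j Γ)
    (h : A' = F.tySub A σ) (t : F.Tm j Δ) (ht : F.tyOf t = A) (t' : F.Tm j Γ)
    (ht' : F.tyOf t' = A') (e : t' = F.tmSub t σ) :
    C.comp (F.upTo σ A A' h) (F.inst A' t' ht') = C.comp (F.inst A t ht) σ := by
  unfold upTo inst
  rw [pair_comp, pair_comp]
  apply pair_congr
  · rw [C.assoc, F.p_pair, C.comp_id, C.id_comp]
  · rw [F.q_pair, e]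

theorem tySub_inst {j k : ℕ} {Γ Δ : C.Con} (σ : C.Sub Γ Δ) (A : F.Ty j Δ) (A' : F.Ty j Γ)
    (h : A' = F.tySub A σ) (B : F.Ty k (F.ext Δ A)) (t : F.Tm j Δ) (ht : F.tyOf t = A)
    (t' : F.Tm j Γ) (ht' : F.tyOf t' = A') (e : t' = F.tmSub t σ) :
    F.tySub (F.tySub B (F.inst A t ht)) σ =
      F.tySub (F.tySub B (F.upTo σ A A' h)) (F.inst A' t' ht') := by
  rw [← F.tySub_comp, ← F.tySub_comp, F.upTo_comp_inst σ A A' h t ht t' ht' e]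

end CwF

/-- Coquand-style universes: `El` and `Code` are inverse to each other. -/
structure UStr {C : Base.{u, v}} (F : CwF C) where
  U : ∀ (j : ℕ) (Γ : C.Con), F.Ty (j + 1) Γ
  U_sub : ∀ (j : ℕ) {Γ Δ : C.Con} (σ : C.Sub Γ Δ), F.tySub (U j Δ) σ = U j Γ
  El : ∀ {j : ℕ} {Γ : C.Con} (a : F.Tm (j + 1) Γ), F.tyOf a = U j Γ → F.Ty j Γ
  code : ∀ {j : ℕ} {Γ : C.Con}, F.Ty j Γ → F.Tm (j + 1) Γ
  tyOf_code : ∀ {j : ℕ} {Γ : C.Con} (A : F.Ty j Γ), F.tyOf (code A) = U j Γ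
  El_code : ∀ {j : ℕ} {Γ : C.Con} (A : F.Ty j Γ), El (code A) (tyOf_code A) = A
  code_El : ∀ {j : ℕ} {Γ : C.Con} (a : F.Tm (j + 1) Γ) (h : F.tyOf a = U j Γ),
    code (El a h) = a
  code_sub : ∀ {j : ℕ} {Γ Δ : C.Con} (A : F.Ty j Δ) (σ : C.Sub Γ Δ),
    F.tmSub (code A) σ = code (F.tySub A σ)

/-- `Σ`-types: pairing and projections form a natural isomorphism. (Naturality of the projections
follows from naturality of pairing.) -/
structure SgStr {C : Base.{u, v}} (F : CwF C) where
  Sg : ∀ {j : ℕ} {Γ : C.Con} (A : F.Ty j Γ), F.Ty j (F.ext Γ A) → F.Ty j Γ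
  Sg_sub : ∀ {j : ℕ} {Γ Δ : C.Con} (A : F.Ty j Δ) (B : F.Ty j (F.ext Δ A)) (σ : C.Sub Γ Δ),
    F.tySub (Sg A B) σ = Sg (F.tySub A σ) (F.tySub B (F.up σ A))
  tup : ∀ {j : ℕ} {Γ : C.Con} (A : F.Ty j Γ) (B : F.Ty j (F.ext Γ A)) (t w : F.Tm j Γ)
    (ht : F.tyOf t = A), F.tyOf w = F.tySub B (F.inst A t ht) → F.Tm j Γ
  fst : ∀ {j : ℕ} {Γ : C.Con} (A : F.Ty j Γ) (B : F.Ty j (F.ext Γ A)) (t : F.Tm j Γ),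
    F.tyOf t = Sg A B → F.Tm j Γ
  snd : ∀ {j : ℕ} {Γ : C.Con} (A : F.Ty j Γ) (B : F.Ty j (F.ext Γ A)) (t : F.Tm j Γ),
    F.tyOf t = Sg A B → F.Tm j Γ
  tyOf_tup : ∀ {j : ℕ} {Γ : C.Con} (A : F.Ty j Γ) (B : F.Ty j (F.ext Γ A)) (t w : F.Tm j Γ)
    (ht : F.tyOf t = A) (hw : F.tyOf w = F.tySub B (F.inst A t ht)),
    F.tyOf (tup A B t w ht hw) = Sg A B
  tyOf_fst : ∀ {j : ℕ} {Γ : C.Con} (A : F.Ty j Γ) (B : F.Ty j (F.ext Γ A)) (t : F.Tm j Γ)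
    (h : F.tyOf t = Sg A B), F.tyOf (fst A B t h) = A
  tyOf_snd : ∀ {j : ℕ} {Γ : C.Con} (A : F.Ty j Γ) (B : F.Ty j (F.ext Γ A)) (t : F.Tm j Γ)
    (h : F.tyOf t = Sg A B),
    F.tyOf (snd A B t h) = F.tySub B (F.inst A (fst A B t h) (tyOf_fst A B t h))
  fst_tup : ∀ {j : ℕ} {Γ : C.Con} (A : F.Ty j Γ) (B : F.Ty j (F.ext Γ A)) (t w : F.Tm j Γ)
    (ht : F.tyOf t = A) (hw : F.tyOf w = F.tySub B (F.inst A t ht)),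
    fst A B (tup A B t w ht hw) (tyOf_tup A B t w ht hw) = t
  snd_tup : ∀ {j : ℕ} {Γ : C.Con} (A : F.Ty j Γ) (B : F.Ty j (F.ext Γ A)) (t w : F.Tm j Γ)
    (ht : F.tyOf t = A) (hw : F.tyOf w = F.tySub B (F.inst A t ht)),
    snd A B (tup A B t w ht hw) (tyOf_tup A B t w ht hw) = w
  tup_eta : ∀ {j : ℕ} {Γ : C.Con} (A : F.Ty j Γ) (B : F.Ty j (F.ext Γ A)) (t : F.Tm j Γ)
    (h : F.tyOf t = Sg A B),
    tup A B (fst A B t h) (snd A B t h) (tyOf_fst A B t h) (tyOf_snd A B t h) = t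
  tup_sub : ∀ {j : ℕ} {Γ Δ : C.Con} (A : F.Ty j Δ) (B : F.Ty j (F.ext Δ A)) (t w : F.Tm j Δ)
    (ht : F.tyOf t = A) (hw : F.tyOf w = F.tySub B (F.inst A t ht)) (σ : C.Sub Γ Δ),
    F.tmSub (tup A B t w ht hw) σ =
      tup (F.tySub A σ) (F.tySub B (F.up σ A)) (F.tmSub t σ) (F.tmSub w σ)
        (by rw [F.tyOf_tmSub, ht])
        (by rw [F.tyOf_tmSub, hw]; exact F.tySub_inst σ A _ rfl B t ht _ _ rfl)

/-- Function types: `lam` and `app` form a natural isomorphism between terms `t` over `Γ ▹ A` with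
type `B` and terms over `Γ` with type `Π A B`. (Naturality of `app` follows from that of `lam`.) -/
structure PiStr {C : Base.{u, v}} (F : CwF C) where
  Pi : ∀ {j : ℕ} {Γ : C.Con} (A : F.Ty j Γ), F.Ty j (F.ext Γ A) → F.Ty j Γ
  Pi_sub : ∀ {j : ℕ} {Γ Δ : C.Con} (A : F.Ty j Δ) (B : F.Ty j (F.ext Δ A)) (σ : C.Sub Γ Δ),
    F.tySub (Pi A B) σ = Pi (F.tySub A σ) (F.tySub B (F.up σ A))
  lam : ∀ {j : ℕ} {Γ : C.Con} (A : F.Ty j Γ), F.Tm j (F.ext Γ A) → F.Tm j Γ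
  app : ∀ {j : ℕ} {Γ : C.Con} (A : F.Ty j Γ) (B : F.Ty j (F.ext Γ A)) (t : F.Tm j Γ),
    F.tyOf t = Pi A B → F.Tm j (F.ext Γ A)
  tyOf_lam : ∀ {j : ℕ} {Γ : C.Con} (A : F.Ty j Γ) (t : F.Tm j (F.ext Γ A)),
    F.tyOf (lam A t) = Pi A (F.tyOf t)
  tyOf_app : ∀ {j : ℕ} {Γ : C.Con} (A : F.Ty j Γ) (B : F.Ty j (F.ext Γ A)) (t : F.Tm j Γ)
    (h : F.tyOf t = Pi A B), F.tyOf (app A B t h) = B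
  app_lam : ∀ {j : ℕ} {Γ : C.Con} (A : F.Ty j Γ) (t : F.Tm j (F.ext Γ A)),
    app A (F.tyOf t) (lam A t) (tyOf_lam A t) = t
  lam_app : ∀ {j : ℕ} {Γ : C.Con} (A : F.Ty j Γ) (B : F.Ty j (F.ext Γ A)) (t : F.Tm j Γ)
    (h : F.tyOf t = Pi A B), lam A (app A B t h) = t
  lam_sub : ∀ {j : ℕ} {Γ Δ : C.Con} (A : F.Ty j Δ) (t : F.Tm j (F.ext Δ A)) (σ : C.Sub Γ Δ),
    F.tmSub (lam A t) σ = lam (F.tySub A σ) (F.tmSub t (F.up σ A))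

/-- Formation and introduction rules of natural numbers. -/
structure NatIntro {C : Base.{u, v}} (F : CwF C) where
  Nat : ∀ (j : ℕ) (Γ : C.Con), F.Ty j Γ
  Nat_sub : ∀ (j : ℕ) {Γ Δ : C.Con} (σ : C.Sub Γ Δ), F.tySub (Nat j Δ) σ = Nat j Γ
  zero : ∀ (j : ℕ) (Γ : C.Con), F.Tm j Γ
  tyOf_zero : ∀ (j : ℕ) (Γ : C.Con), F.tyOf (zero j Γ) = Nat j Γ
  zero_sub : ∀ (j : ℕ) {Γ Δ : C.Con} (σ : C.Sub Γ Δ), F.tmSub (zero j Δ) σ = zero j Γ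
  suc : ∀ {j : ℕ} {Γ : C.Con} (t : F.Tm j Γ), F.tyOf t = Nat j Γ → F.Tm j Γ
  tyOf_suc : ∀ {j : ℕ} {Γ : C.Con} (t : F.Tm j Γ) (h : F.tyOf t = Nat j Γ),
    F.tyOf (suc t h) = Nat j Γ
  suc_sub : ∀ {j : ℕ} {Γ Δ : C.Con} (t : F.Tm j Δ) (h : F.tyOf t = Nat j Δ) (σ : C.Sub Γ Δ),
    F.tmSub (suc t h) σ = suc (F.tmSub t σ) (by rw [F.tyOf_tmSub, h, Nat_sub])

namespace NatIntro

variable {C : Base.{u, v}} {F : CwF C} (N : NatIntro F)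

/-- `n ↦ suc n`, as a substitution from `Γ ▹ (n : Nat) ▹ (pn : P)` to `Γ ▹ (n : Nat)`. -/
def sucSub {j k : ℕ} {Γ : C.Con} (P : F.Ty k (F.ext Γ (N.Nat j Γ))) :
    C.Sub (F.ext (F.ext Γ (N.Nat j Γ)) P) (F.ext Γ (N.Nat j Γ)) :=
  F.pair (C.comp (F.p _) (F.p P)) (N.Nat j Γ)
    (N.suc (F.tmSub (F.q _) (F.p P)) (by rw [F.tyOf_tmSub, F.tyOf_q, N.Nat_sub, N.Nat_sub]))
    (by rw [N.tyOf_suc, N.Nat_sub])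

/-- Lifting of `σ` under a binder of type `Nat`. -/
def upNat (j : ℕ) {Γ Δ : C.Con} (σ : C.Sub Γ Δ) :
    C.Sub (F.ext Γ (N.Nat j Γ)) (F.ext Δ (N.Nat j Δ)) :=
  F.upTo σ (N.Nat j Δ) (N.Nat j Γ) (N.Nat_sub j σ).symm

theorem sucSub_comp {j k : ℕ} {Γ Δ : C.Con} (P : F.Ty k (F.ext Δ (N.Nat j Δ)))
    (σ : C.Sub Γ Δ) :
    C.comp (N.sucSub P) (F.up (N.upNat j σ) P) =
      C.comp (N.upNat j σ) (N.sucSub (F.tySub P (N.upNat j σ))) := by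
  have hp : C.comp (F.p (N.Nat j Δ)) (C.comp (F.p P) (F.up (N.upNat j σ) P)) =
      C.comp σ (C.comp (F.p (N.Nat j Γ)) (F.p (F.tySub P (N.upNat j σ)))) := by
    unfold CwF.up CwF.upTo
    rw [F.p_pair, ← C.assoc]
    unfold upNat CwF.upTo
    rw [F.p_pair, C.assoc]
  have hq : F.tmSub (F.q (N.Nat j Δ)) (C.comp (F.p P) (F.up (N.upNat j σ) P)) =
      F.tmSub (F.q (N.Nat j Γ)) (F.p (F.tySub P (N.upNat j σ))) := by
    unfold CwF.up CwF.upTo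
    rw [F.p_pair, F.tmSub_comp]
    unfold upNat CwF.upTo
    rw [F.q_pair]
  conv_rhs => unfold upNat CwF.upTo sucSub
  conv_lhs => unfold sucSub
  rw [F.pair_comp, F.pair_comp]
  apply F.pair_congr
  · rw [C.assoc, hp, C.assoc, F.p_pair]
    rfl
  · rw [N.suc_sub, F.q_pair]
    congr 1
    rw [← F.tmSub_comp, hq]
    rfl

end NatIntro

/-- Natural numbers, with elimination from level `j` to any level `k`. -/
structure NatStr {C : Base.{u, v}} (F : CwF C) extends NatIntro F where
  elim : ∀ {j k : ℕ} {Γ : C.Con} (P : F.Ty k (F.ext Γ (Nat j Γ))) (z : F.Tm k Γ)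
    (s : F.Tm k (F.ext (F.ext Γ (Nat j Γ)) P)) (t : F.Tm j Γ),
    F.tyOf z = F.tySub P (F.inst (Nat j Γ) (zero j Γ) (tyOf_zero j Γ)) →
    F.tyOf s = F.tySub P (toNatIntro.sucSub P) → F.tyOf t = Nat j Γ → F.Tm k Γ
  tyOf_elim : ∀ {j k : ℕ} {Γ : C.Con} (P : F.Ty k (F.ext Γ (Nat j Γ))) (z : F.Tm k Γ)
    (s : F.Tm k (F.ext (F.ext Γ (Nat j Γ)) P)) (t : F.Tm j Γ)
    (hz : F.tyOf z = F.tySub P (F.inst (Nat j Γ) (zero j Γ) (tyOf_zero j Γ)))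
    (hs : F.tyOf s = F.tySub P (toNatIntro.sucSub P)) (ht : F.tyOf t = Nat j Γ),
    F.tyOf (elim P z s t hz hs ht) = F.tySub P (F.inst (Nat j Γ) t ht)
  elim_zero : ∀ {j k : ℕ} {Γ : C.Con} (P : F.Ty k (F.ext Γ (Nat j Γ))) (z : F.Tm k Γ)
    (s : F.Tm k (F.ext (F.ext Γ (Nat j Γ)) P))
    (hz : F.tyOf z = F.tySub P (F.inst (Nat j Γ) (zero j Γ) (tyOf_zero j Γ)))
    (hs : F.tyOf s = F.tySub P (toNatIntro.sucSub P)),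
    elim P z s (zero j Γ) hz hs (tyOf_zero j Γ) = z
  elim_suc : ∀ {j k : ℕ} {Γ : C.Con} (P : F.Ty k (F.ext Γ (Nat j Γ))) (z : F.Tm k Γ)
    (s : F.Tm k (F.ext (F.ext Γ (Nat j Γ)) P)) (t : F.Tm j Γ)
    (hz : F.tyOf z = F.tySub P (F.inst (Nat j Γ) (zero j Γ) (tyOf_zero j Γ)))
    (hs : F.tyOf s = F.tySub P (toNatIntro.sucSub P)) (ht : F.tyOf t = Nat j Γ),
    elim P z s (suc t ht) hz hs (tyOf_suc t ht) =
      F.tmSub s (F.pair (F.inst (Nat j Γ) t ht) P (elim P z s t hz hs ht)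
        (tyOf_elim P z s t hz hs ht))
  elim_sub : ∀ {j k : ℕ} {Γ Δ : C.Con} (P : F.Ty k (F.ext Δ (Nat j Δ))) (z : F.Tm k Δ)
    (s : F.Tm k (F.ext (F.ext Δ (Nat j Δ)) P)) (t : F.Tm j Δ)
    (hz : F.tyOf z = F.tySub P (F.inst (Nat j Δ) (zero j Δ) (tyOf_zero j Δ)))
    (hs : F.tyOf s = F.tySub P (toNatIntro.sucSub P)) (ht : F.tyOf t = Nat j Δ)
    (σ : C.Sub Γ Δ),
    F.tmSub (elim P z s t hz hs ht) σ =
      elim (F.tySub P (toNatIntro.upNat j σ)) (F.tmSub z σ)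
        (F.tmSub s (F.up (toNatIntro.upNat j σ) P)) (F.tmSub t σ)
        (by rw [F.tyOf_tmSub, hz]
            exact F.tySub_inst σ _ _ (Nat_sub j σ).symm P _ _ _ _ (zero_sub j σ).symm)
        (by rw [F.tyOf_tmSub, hs, ← F.tySub_comp, ← F.tySub_comp, toNatIntro.sucSub_comp])
        (by rw [F.tyOf_tmSub, ht, Nat_sub])

/-- A family structure closed under universes, `Σ`, `Π` and natural numbers. -/
structure Fam (C : Base.{u, v}) extends CwF C where
  univ : UStr toCwF
  sg : SgStr toCwF
  pi : PiStr toCwF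
  nat : NatStr toCwF

/-- A lifting structure from `F` to `G`: a natural transformation `up` on types and a natural
isomorphism `quote` from terms of type `A` to terms of type `up A`, with inverse `splice`. -/
structure Lifting {C : Base.{u, v}} (F G : CwF C) where
  lift : ∀ {j : ℕ} {Γ : C.Con}, F.Ty j Γ → G.Ty j Γ
  lift_sub : ∀ {j : ℕ} {Γ Δ : C.Con} (A : F.Ty j Δ) (σ : C.Sub Γ Δ),
    G.tySub (lift A) σ = lift (F.tySub A σ)
  quote : ∀ {j : ℕ} {Γ : C.Con}, F.Tm j Γ → G.Tm j Γ
  tyOf_quote : ∀ {j : ℕ} {Γ : C.Con} (t : F.Tm j Γ), G.tyOf (quote t) = lift (F.tyOf t)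
  splice : ∀ {j : ℕ} {Γ : C.Con} (A : F.Ty j Γ) (t : G.Tm j Γ), G.tyOf t = lift A → F.Tm j Γ
  tyOf_splice : ∀ {j : ℕ} {Γ : C.Con} (A : F.Ty j Γ) (t : G.Tm j Γ) (h : G.tyOf t = lift A),
    F.tyOf (splice A t h) = A
  splice_quote : ∀ {j : ℕ} {Γ : C.Con} (t : F.Tm j Γ),
    splice (F.tyOf t) (quote t) (tyOf_quote t) = t
  quote_splice : ∀ {j : ℕ} {Γ : C.Con} (A : F.Ty j Γ) (t : G.Tm j Γ) (h : G.tyOf t = lift A),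
    quote (splice A t h) = t
  quote_sub : ∀ {j : ℕ} {Γ Δ : C.Con} (t : F.Tm j Δ) (σ : C.Sub Γ Δ),
    G.tmSub (quote t) σ = quote (F.tmSub t σ)

/-- A signature of stages and liftings between stages. -/
structure Stages where
  Stage : Type
  Lift : Type
  src : Lift → Stage
  tgt : Lift → Stage

/-- A model over a signature of stages: a base category with terminal object, for each stage a
family structure closed under all type formers, and for each lifting a lifting structure. -/
structure Model (S : Stages) where
  base : Base.{u, v}
  fam : S.Stage → Fam base
  lifting : ∀ l : S.Lift, Lifting (fam (S.src l)).toCwF (fam (S.tgt l)).toCwF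

/-- The two stages of two-level type theory. -/
inductive Level where
  | obj
  | mta

/-- Two stages and one lifting, from the object level to the meta level. -/
def twoStages : Stages := ⟨Level, Unit, fun _ => .obj, fun _ => .mta⟩

/-- A single stage and no lifting. -/
def oneStage : Stages := ⟨Unit, Empty, Empty.elim, Empty.elim⟩

/-- Models of two-level type theory. -/
abbrev TwoModel := Model.{u, v} twoStages

/-- Models of the object theory. -/
abbrev ObjModel := Model.{u, v} oneStage

/-- The family structure of a model of the object theory. -/
abbrev Model.objFam (M : ObjModel.{u, v}) : Fam M.base := M.fam ()

/-! ### Morphisms of models -/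

/-- Functors preserving the terminal object strictly. -/
structure BaseHom (C : Base.{u, v}) (D : Base.{u₁, v₁}) where
  con : C.Con → D.Con
  sub : ∀ {Γ Δ : C.Con}, C.Sub Γ Δ → D.Sub (con Γ) (con Δ)
  sub_id : ∀ Γ, sub (C.id Γ) = D.id (con Γ)
  sub_comp : ∀ {Γ Δ Θ : C.Con} (σ : C.Sub Δ Θ) (δ : C.Sub Γ Δ),
    sub (C.comp σ δ) = D.comp (sub σ) (sub δ)
  con_emp : con C.emp = D.emp

/-- Strict morphisms of family structures over a functor. Types and terms over extended contexts
are transported along `con_ext`; such transports are expressed through heterogeneous equality.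
The operations that are determined by inverse operations (`pair`, `El`, `fst`, `snd`, `app`) are
then preserved as well. -/
structure FamHom {C : Base.{u, v}} {D : Base.{u₁, v₁}} (H : BaseHom C D) (F : Fam C)
    (G : Fam D) where
  ty : ∀ {j : ℕ} {Γ : C.Con}, F.Ty j Γ → G.Ty j (H.con Γ)
  tm : ∀ {j : ℕ} {Γ : C.Con}, F.Tm j Γ → G.Tm j (H.con Γ)
  tyOf_tm : ∀ {j : ℕ} {Γ : C.Con} (t : F.Tm j Γ), G.tyOf (tm t) = ty (F.tyOf t)
  ty_sub : ∀ {j : ℕ} {Γ Δ : C.Con} (A : F.Ty j Δ) (σ : C.Sub Γ Δ),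
    ty (F.tySub A σ) = G.tySub (ty A) (H.sub σ)
  tm_sub : ∀ {j : ℕ} {Γ Δ : C.Con} (t : F.Tm j Δ) (σ : C.Sub Γ Δ),
    tm (F.tmSub t σ) = G.tmSub (tm t) (H.sub σ)
  con_ext : ∀ {j : ℕ} {Γ : C.Con} (A : F.Ty j Γ), H.con (F.ext Γ A) = G.ext (H.con Γ) (ty A)
  sub_p : ∀ {j : ℕ} {Γ : C.Con} (A : F.Ty j Γ), HEq (H.sub (F.p A)) (G.p (ty A))
  tm_q : ∀ {j : ℕ} {Γ : C.Con} (A : F.Ty j Γ), HEq (tm (F.q A)) (G.q (ty A))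
  ty_U : ∀ (j : ℕ) (Γ : C.Con), ty (F.univ.U j Γ) = G.univ.U j (H.con Γ)
  tm_code : ∀ {j : ℕ} {Γ : C.Con} (A : F.Ty j Γ), tm (F.univ.code A) = G.univ.code (ty A)
  ty_Sg : ∀ {j : ℕ} {Γ : C.Con} (A : F.Ty j Γ) (B : F.Ty j (F.ext Γ A))
    (B' : G.Ty j (G.ext (H.con Γ) (ty A))), HEq (ty B) B' → ty (F.sg.Sg A B) = G.sg.Sg (ty A) B'
  tm_tup : ∀ {j : ℕ} {Γ : C.Con} (A : F.Ty j Γ) (B : F.Ty j (F.ext Γ A)) (t w : F.Tm j Γ)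
    (ht : F.tyOf t = A) (hw : F.tyOf w = F.tySub B (F.inst A t ht))
    (B' : G.Ty j (G.ext (H.con Γ) (ty A))) (ht' : G.tyOf (tm t) = ty A)
    (hw' : G.tyOf (tm w) = G.tySub B' (G.inst (ty A) (tm t) ht')), HEq (ty B) B' →
    tm (F.sg.tup A B t w ht hw) = G.sg.tup (ty A) B' (tm t) (tm w) ht' hw'
  ty_Pi : ∀ {j : ℕ} {Γ : C.Con} (A : F.Ty j Γ) (B : F.Ty j (F.ext Γ A))
    (B' : G.Ty j (G.ext (H.con Γ) (ty A))), HEq (ty B) B' → ty (F.pi.Pi A B) = G.pi.Pi (ty A) B'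
  tm_lam : ∀ {j : ℕ} {Γ : C.Con} (A : F.Ty j Γ) (t : F.Tm j (F.ext Γ A))
    (t' : G.Tm j (G.ext (H.con Γ) (ty A))), HEq (tm t) t' → tm (F.pi.lam A t) = G.pi.lam (ty A) t'
  ty_Nat : ∀ (j : ℕ) (Γ : C.Con), ty (F.nat.Nat j Γ) = G.nat.Nat j (H.con Γ)
  tm_zero : ∀ (j : ℕ) (Γ : C.Con), tm (F.nat.zero j Γ) = G.nat.zero j (H.con Γ)
  tm_suc : ∀ {j : ℕ} {Γ : C.Con} (t : F.Tm j Γ) (h : F.tyOf t = F.nat.Nat j Γ),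
    tm (F.nat.suc t h) = G.nat.suc (tm t) (by rw [tyOf_tm, h, ty_Nat])
  tm_elim : ∀ {j k : ℕ} {Γ : C.Con} (P : F.Ty k (F.ext Γ (F.nat.Nat j Γ))) (z : F.Tm k Γ)
    (s : F.Tm k (F.ext (F.ext Γ (F.nat.Nat j Γ)) P)) (t : F.Tm j Γ)
    (hz : F.tyOf z = F.tySub P (F.inst (F.nat.Nat j Γ) (F.nat.zero j Γ) (F.nat.tyOf_zero j Γ)))
    (hs : F.tyOf s = F.tySub P (F.nat.sucSub P)) (ht : F.tyOf t = F.nat.Nat j Γ)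
    (P' : G.Ty k (G.ext (H.con Γ) (G.nat.Nat j (H.con Γ))))
    (s' : G.Tm k (G.ext (G.ext (H.con Γ) (G.nat.Nat j (H.con Γ))) P'))
    (hz' : G.tyOf (tm z) = G.tySub P' (G.inst (G.nat.Nat j (H.con Γ)) (G.nat.zero j (H.con Γ))
      (G.nat.tyOf_zero j (H.con Γ))))
    (hs' : G.tyOf s' = G.tySub P' (G.nat.sucSub P'))
    (ht' : G.tyOf (tm t) = G.nat.Nat j (H.con Γ)),
    HEq (ty P) P' → HEq (tm s) s' →
    tm (F.nat.elim P z s t hz hs ht) = G.nat.elim P' (tm z) s' (tm t) hz' hs' ht'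

/-- Strict morphisms of models. (Splicing is the inverse of quoting, so it is preserved too.) -/
structure Hom {S : Stages} (M : Model.{u, v} S) (N : Model.{u₁, v₁} S) where
  base : BaseHom M.base N.base
  fam : ∀ i, FamHom base (M.fam i) (N.fam i)
  ty_lift : ∀ (l : S.Lift) {j : ℕ} {Γ : M.base.Con} (A : (M.fam (S.src l)).Ty j Γ),
    (fam (S.tgt l)).ty ((M.lifting l).lift A) = (N.lifting l).lift ((fam (S.src l)).ty A)
  tm_quote : ∀ (l : S.Lift) {j : ℕ} {Γ : M.base.Con} (t : (M.fam (S.src l)).Tm j Γ),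
    (fam (S.tgt l)).tm ((M.lifting l).quote t) = (N.lifting l).quote ((fam (S.src l)).tm t)

/-! ### The hierarchy of universes of sets -/

/-- A strictly increasing sequence of inaccessible cardinals: it provides a hierarchy of universes
of sets `Set_0 ∈ Set_1 ∈ ⋯`, where `Set_j` consists of the sets of cardinality below `κ j`, up to
bijection. -/
structure SetHierarchy where
  κ : ℕ → Cardinal.{0}
  strictMono : StrictMono κ
  inaccessible : ∀ j, (κ j).IsInaccessible

namespace SetHierarchy

open Cardinal

variable (K : SetHierarchy)

/-- The set of codes of the universe `Set_j`: the ordinals below `κ j`. -/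
def V (j : ℕ) : Type := (K.κ j).ord.ToType

/-- The set with code `c`: the ordinal `c`, viewed as a set. -/
def El {j : ℕ} (c : K.V j) : Type := (Ordinal.ToType.toOrd c).1.ToType

/-- A code in `Set_j` of a set of cardinality below `κ j`: its cardinality. -/
noncomputable def code (j : ℕ) (X : Type) (h : #X < K.κ j) : K.V j :=
  Ordinal.ToType.mk ⟨(#X).ord, ord_lt_ord.2 h⟩

theorem mk_El_lt {j : ℕ} (c : K.V j) : #(K.El c) < K.κ j := by
  have h := (Ordinal.ToType.toOrd c).2
  simp only [El, mk_toType]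
  exact lt_ord.1 h

/-- The set coded by the code of `X` is `X`, up to bijection. -/
noncomputable def decode {j : ℕ} {X : Type} (h : #X < K.κ j) : K.El (K.code j X h) ≃ X :=
  Classical.choice (Cardinal.eq.1 (by simp [El, code, mk_toType]))

theorem mk_V (j : ℕ) : #(K.V j) = K.κ j := by simp [V]

theorem mk_V_lt (j : ℕ) : #(K.V j) < K.κ (j + 1) := by
  rw [mk_V]; exact K.strictMono (Nat.lt_succ_self j)

theorem lt_of_countable (j : ℕ) (X : Type) [Countable X] : #X < K.κ j :=
  (mk_le_aleph0 (α := X)).trans_lt (K.inaccessible j).aleph0_lt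

theorem lt_succ {j : ℕ} {X : Type} (h : #X < K.κ j) : #X < K.κ (j + 1) :=
  h.trans (K.strictMono (Nat.lt_succ_self j))

theorem lt_of_injective {j : ℕ} {X Y : Type} (h : #Y < K.κ j) (f : X → Y)
    (hf : Function.Injective f) : #X < K.κ j :=
  (mk_le_of_injective hf).trans_lt h

theorem sigma_lt {j : ℕ} {X : Type} {Y : X → Type} (hX : #X < K.κ j)
    (hY : ∀ x, #(Y x) < K.κ j) : #(Σ x, Y x) < K.κ j := by
  rw [mk_sigma]
  exact sum_lt_of_isRegular (K.inaccessible j).isRegular hX hY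

theorem pi_lt {j : ℕ} {X : Type} {Y : X → Type} (hX : #X < K.κ j)
    (hY : ∀ x, #(Y x) < K.κ j) : #(∀ x, Y x) < K.κ j := by
  have h : #(Set (Σ x, Y x)) < K.κ j := by
    rw [mk_set]
    exact (K.inaccessible j).isStrongPrelimit (K.sigma_lt hX hY)
  refine K.lt_of_injective h (fun f => Set.range fun x => (⟨x, f x⟩ : Σ x, Y x)) ?_
  intro f g hfg
  funext x
  have hx : (⟨x, f x⟩ : Σ x, Y x) ∈ Set.range fun x => (⟨x, g x⟩ : Σ x, Y x) := by
    have e : (Set.range fun x => (⟨x, f x⟩ : Σ x, Y x)) = Set.range fun x => ⟨x, g x⟩ := hfg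
    rw [← e]; exact ⟨x, rfl⟩
  obtain ⟨y, hy⟩ := hx
  obtain rfl : y = x := congrArg Sigma.fst hy
  exact (eq_of_heq (Sigma.mk.inj hy).2).symm

attribute [irreducible] V El code decode

end SetHierarchy

/-! ### The presheaf model: contexts -/

/-- Presheaves (of small sets) over the category of contexts of a base. -/
structure Psh (C : Base.{0, 0}) where
  obj : C.Con → Type
  res : ∀ {a b : C.Con}, obj b → C.Sub a b → obj a
  res_id : ∀ {a : C.Con} (γ : obj a), res γ (C.id a) = γ
  res_comp : ∀ {a b c : C.Con} (γ : obj c) (f : C.Sub b c) (g : C.Sub a b),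
    res γ (C.comp f g) = res (res γ f) g

/-- Natural transformations. -/
@[ext]
structure PSub {C : Base.{0, 0}} (X Y : Psh C) where
  app : ∀ {a : C.Con}, X.obj a → Y.obj a
  nat : ∀ {a b : C.Con} (γ : X.obj b) (f : C.Sub a b), app (X.res γ f) = Y.res (app γ) f

namespace PSub

variable {C : Base.{0, 0}}

theorem ext_app {X Y : Psh C} {σ τ : PSub X Y}
    (h : ∀ (a : C.Con) (γ : X.obj a), σ.app γ = τ.app γ) : σ = τ := by
  apply PSub.ext
  funext a γ
  exact h a γ

/-- The identity natural transformation. -/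
def id (X : Psh C) : PSub X X := ⟨fun γ => γ, fun _ _ => rfl⟩

/-- Composition of natural transformations. -/
def comp {X Y Z : Psh C} (σ : PSub Y Z) (δ : PSub X Y) : PSub X Z :=
  ⟨fun γ => σ.app (δ.app γ), fun γ f => by rw [δ.nat, σ.nat]⟩

end PSub

/-- The category of presheaves over a base, with the constantly one-element presheaf. -/
abbrev pshBase (C : Base.{0, 0}) : Base.{1, 0} where
  Con := Psh C
  Sub := PSub
  id := PSub.id
  comp := PSub.comp
  id_comp _ := rfl
  comp_id _ := rfl
  assoc _ _ _ := rfl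
  emp := ⟨fun _ => Unit, fun _ _ => (), fun _ => rfl, fun _ _ _ => rfl⟩
  eps _ := ⟨fun _ => (), fun _ _ => rfl⟩
  eps_uniq _ := rfl

/-! ### The presheaf model: object-level family structure -/

section ObjectLevel

variable {C : Base.{0, 0}} (F : Fam C)

/-- The presheaf of types of a family structure. -/
abbrev tyPsh (j : ℕ) : Psh C := ⟨F.Ty j, F.tySub, F.tySub_id, F.tySub_comp⟩

/-- The presheaf of terms of a family structure. -/
abbrev tmPsh (j : ℕ) : Psh C := ⟨F.Tm j, F.tmSub, F.tmSub_id, F.tmSub_comp⟩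

variable {F}

/-- Extension of a presheaf `X` by an object-level type `A`: pairs of an element `γ` of `X` and a
syntactic term of type `A γ`. -/
abbrev oExt {j : ℕ} (X : Psh C) (A : PSub X (tyPsh F j)) : Psh C where
  obj a := { x : X.obj a × F.Tm j a // F.tyOf x.2 = A.app x.1 }
  res x f := ⟨(X.res x.1.1 f, F.tmSub x.1.2 f), by
    rw [F.tyOf_tmSub, x.2, A.nat]⟩
  res_id x := Subtype.ext (Prod.ext (X.res_id _) (F.tmSub_id _))
  res_comp x f g := Subtype.ext (Prod.ext (X.res_comp _ f g) (F.tmSub_comp _ f g))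

/-- The family structure of object-level types and terms in presheaves: a type over `X` is a
natural transformation from `X` to the presheaf of syntactic types, and a term is a natural
transformation from `X` to the presheaf of syntactic terms. -/
abbrev objCwF (F : Fam C) : CwF (pshBase C) where
  Ty j X := PSub X (tyPsh F j)
  Tm j X := PSub X (tmPsh F j)
  tyOf t := ⟨fun γ => F.tyOf (t.app γ), fun γ f => by rw [t.nat]; exact F.tyOf_tmSub _ _⟩
  tySub A σ := A.comp σ
  tmSub t σ := t.comp σ
  tyOf_tmSub _ _ := rfl
  tySub_id _ := rfl
  tySub_comp _ _ _ := rfl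
  tmSub_id _ := rfl
  tmSub_comp _ _ _ := rfl
  ext X A := oExt X A
  p A := ⟨fun x => x.1.1, fun _ _ => rfl⟩
  q A := ⟨fun x => x.1.2, fun _ _ => rfl⟩
  tyOf_q A := PSub.ext_app fun _ x => x.2
  pair σ A t h := ⟨fun γ => ⟨(σ.app γ, t.app γ), congrArg (fun B => PSub.app B γ) h⟩,
    fun γ f => Subtype.ext (Prod.ext (σ.nat γ f) (t.nat γ f))⟩
  p_pair _ _ _ _ := rfl
  q_pair _ _ _ _ := rfl
  pair_eta _ _ := rfl

/-- The generic element of an extended presheaf `X ▹ A` over `a ▹ A γ`, namely `(γ[p], q)`. -/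
def new {j : ℕ} {X : Psh C} (A : PSub X (tyPsh F j)) {a : C.Con} (γ : X.obj a) :
    (oExt X A).obj (F.ext a (A.app γ)) :=
  ⟨(X.res γ (F.p _), F.q _), by rw [F.tyOf_q, A.nat]⟩

theorem res_new_pair {j : ℕ} {X : Psh C} (A : PSub X (tyPsh F j)) {a b : C.Con} (γ : X.obj b)
    (f : C.Sub a b) (t : F.Tm j a) (h : F.tyOf t = F.tySub (A.app γ) f) :
    (oExt X A).res (new A γ) (F.pair f (A.app γ) t h) =
      ⟨(X.res γ f, t), by rw [h, A.nat]⟩ := by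
  apply Subtype.ext
  apply Prod.ext
  · change X.res (X.res γ _) _ = X.res γ f
    rw [← X.res_comp, F.p_pair]
  · exact F.q_pair _ _ _ _

theorem res_new_inst {j : ℕ} {X : Psh C} (A : PSub X (tyPsh F j)) {a : C.Con} (γ : X.obj a)
    (t : F.Tm j a) (h : F.tyOf t = A.app γ) :
    (oExt X A).res (new A γ) (F.inst (A.app γ) t h) = ⟨(γ, t), h⟩ := by
  unfold CwF.inst
  rw [res_new_pair]
  exact Subtype.ext (Prod.ext (X.res_id γ) rfl)

theorem nat_ty {j : ℕ} {X : Psh C} (A : PSub X (tyPsh F j)) {a b : C.Con} (γ : X.obj b)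
    (f : C.Sub a b) : A.app (X.res γ f) = F.tySub (A.app γ) f := A.nat γ f

theorem nat_tm {j : ℕ} {X : Psh C} (t : PSub X (tmPsh F j)) {a b : C.Con} (γ : X.obj b)
    (f : C.Sub a b) : t.app (X.res γ f) = F.tmSub (t.app γ) f := t.nat γ f

theorem res_new_upTo {j : ℕ} {X : Psh C} (A : PSub X (tyPsh F j)) {a b : C.Con} (γ : X.obj b)
    (f : C.Sub a b) :
    (oExt X A).res (new A γ) (F.upTo f (A.app γ) (A.app (X.res γ f)) (nat_ty A γ f)) =
      new A (X.res γ f) := by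
  unfold CwF.upTo
  rw [res_new_pair]
  exact Subtype.ext (Prod.ext (X.res_comp _ _ _) rfl)

end ObjectLevel

namespace Fam

variable {C : Base.{u, v}} (F : Fam C) {j k : ℕ} {Γ Δ : C.Con} (σ : C.Sub Γ Δ)

theorem El_eq (a : F.Tm (j + 1) Γ) (h : F.tyOf a = F.univ.U j Γ) (A : F.Ty j Γ)
    (e : a = F.univ.code A) : F.univ.El a h = A := by
  subst e; exact F.univ.El_code A

theorem El_sub' (a : F.Tm (j + 1) Δ) (h : F.tyOf a = F.univ.U j Δ) (a' : F.Tm (j + 1) Γ)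
    (h' : F.tyOf a' = F.univ.U j Γ) (e : a' = F.tmSub a σ) :
    F.univ.El a' h' = F.tySub (F.univ.El a h) σ := by
  apply El_eq
  rw [← F.univ.code_sub, F.univ.code_El, e]

theorem Sg_sub' (A : F.Ty j Δ) (A' : F.Ty j Γ) (h : A' = F.tySub A σ)
    (B : F.Ty j (F.ext Δ A)) :
    F.tySub (F.sg.Sg A B) σ = F.sg.Sg A' (F.tySub B (F.upTo σ A A' h)) := by
  subst h; exact F.sg.Sg_sub A B σ

theorem Pi_sub' (A : F.Ty j Δ) (A' : F.Ty j Γ) (h : A' = F.tySub A σ)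
    (B : F.Ty j (F.ext Δ A)) :
    F.tySub (F.pi.Pi A B) σ = F.pi.Pi A' (F.tySub B (F.upTo σ A A' h)) := by
  subst h; exact F.pi.Pi_sub A B σ

theorem lam_sub' (A : F.Ty j Δ) (A' : F.Ty j Γ) (h : A' = F.tySub A σ)
    (t : F.Tm j (F.ext Δ A)) :
    F.tmSub (F.pi.lam A t) σ = F.pi.lam A' (F.tmSub t (F.upTo σ A A' h)) := by
  subst h; exact F.pi.lam_sub A t σ

theorem app_eq (A : F.Ty j Γ) (B : F.Ty j (F.ext Γ A)) (t : F.Tm j Γ)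
    (h : F.tyOf t = F.pi.Pi A B) (s : F.Tm j (F.ext Γ A)) (hs : F.tyOf s = B)
    (e : t = F.pi.lam A s) : F.pi.app A B t h = s := by
  subst hs e; exact F.pi.app_lam A s

theorem app_sub' (A : F.Ty j Δ) (A' : F.Ty j Γ) (h : A' = F.tySub A σ)
    (B : F.Ty j (F.ext Δ A)) (t : F.Tm j Δ) (ht : F.tyOf t = F.pi.Pi A B)
    (B' : F.Ty j (F.ext Γ A')) (hB : B' = F.tySub B (F.upTo σ A A' h))
    (t' : F.Tm j Γ) (ht' : F.tyOf t' = F.pi.Pi A' B') (e : t' = F.tmSub t σ) :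
    F.pi.app A' B' t' ht' = F.tmSub (F.pi.app A B t ht) (F.upTo σ A A' h) := by
  apply app_eq
  · rw [F.tyOf_tmSub, F.pi.tyOf_app, hB]
  · rw [← lam_sub', F.pi.lam_app, e]

theorem fst_eq (A : F.Ty j Γ) (B : F.Ty j (F.ext Γ A)) (t : F.Tm j Γ)
    (h : F.tyOf t = F.sg.Sg A B) (x y : F.Tm j Γ) (hx hy) (e : t = F.sg.tup A B x y hx hy) :
    F.sg.fst A B t h = x := by
  subst e; exact F.sg.fst_tup A B x y hx hy

theorem snd_eq (A : F.Ty j Γ) (B : F.Ty j (F.ext Γ A)) (t : F.Tm j Γ)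
    (h : F.tyOf t = F.sg.Sg A B) (x y : F.Tm j Γ) (hx hy) (e : t = F.sg.tup A B x y hx hy) :
    F.sg.snd A B t h = y := by
  subst e; exact F.sg.snd_tup A B x y hx hy

theorem tup_sub' (A : F.Ty j Δ) (A' : F.Ty j Γ) (h : A' = F.tySub A σ)
    (B : F.Ty j (F.ext Δ A)) (x y : F.Tm j Δ) (hx : F.tyOf x = A)
    (hy : F.tyOf y = F.tySub B (F.inst A x hx))
    (B' : F.Ty j (F.ext Γ A')) (hB : B' = F.tySub B (F.upTo σ A A' h))
    (x' y' : F.Tm j Γ) (hx' hy') (ex : x' = F.tmSub x σ) (ey : y' = F.tmSub y σ) :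
    F.tmSub (F.sg.tup A B x y hx hy) σ = F.sg.tup A' B' x' y' hx' hy' := by
  subst h hB ex ey; exact F.sg.tup_sub A B x y hx hy σ

theorem fst_sub' (A : F.Ty j Δ) (A' : F.Ty j Γ) (h : A' = F.tySub A σ)
    (B : F.Ty j (F.ext Δ A)) (t : F.Tm j Δ) (ht : F.tyOf t = F.sg.Sg A B)
    (B' : F.Ty j (F.ext Γ A')) (hB : B' = F.tySub B (F.upTo σ A A' h))
    (t' : F.Tm j Γ) (ht' : F.tyOf t' = F.sg.Sg A' B') (e : t' = F.tmSub t σ) :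
    F.sg.fst A' B' t' ht' = F.tmSub (F.sg.fst A B t ht) σ := by
  subst h hB e
  exact F.fst_eq _ _ _ _ _ _ _ _ ((congrArg (fun x => F.tmSub x σ)
    (F.sg.tup_eta A B t ht).symm).trans (F.sg.tup_sub _ _ _ _ _ _ σ))

theorem snd_sub' (A : F.Ty j Δ) (A' : F.Ty j Γ) (h : A' = F.tySub A σ)
    (B : F.Ty j (F.ext Δ A)) (t : F.Tm j Δ) (ht : F.tyOf t = F.sg.Sg A B)
    (B' : F.Ty j (F.ext Γ A')) (hB : B' = F.tySub B (F.upTo σ A A' h))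
    (t' : F.Tm j Γ) (ht' : F.tyOf t' = F.sg.Sg A' B') (e : t' = F.tmSub t σ) :
    F.sg.snd A' B' t' ht' = F.tmSub (F.sg.snd A B t ht) σ := by
  subst h hB e
  exact F.snd_eq _ _ _ _ _ _ _ _ ((congrArg (fun x => F.tmSub x σ)
    (F.sg.tup_eta A B t ht).symm).trans (F.sg.tup_sub _ _ _ _ _ _ σ))

theorem suc_sub' (t : F.Tm j Δ) (h : F.tyOf t = F.nat.Nat j Δ) (t' : F.Tm j Γ)
    (h' : F.tyOf t' = F.nat.Nat j Γ) (e : t' = F.tmSub t σ) :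
    F.nat.suc t' h' = F.tmSub (F.nat.suc t h) σ := by
  subst e; exact (F.nat.suc_sub t h σ).symm

theorem elim_sub' (P : F.Ty k (F.ext Δ (F.nat.Nat j Δ))) (z : F.Tm k Δ)
    (s : F.Tm k (F.ext (F.ext Δ (F.nat.Nat j Δ)) P)) (t : F.Tm j Δ) (hz hs ht)
    (P' : F.Ty k (F.ext Γ (F.nat.Nat j Γ))) (hP : P' = F.tySub P (F.nat.upNat j σ))
    (z' : F.Tm k Γ) (s' : F.Tm k (F.ext (F.ext Γ (F.nat.Nat j Γ)) P')) (t' : F.Tm j Γ)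
    (hz' hs' ht') (ez : z' = F.tmSub z σ)
    (es : s' = F.tmSub s (F.upTo (F.nat.upNat j σ) P P' hP)) (et : t' = F.tmSub t σ) :
    F.nat.elim P' z' s' t' hz' hs' ht' = F.tmSub (F.nat.elim P z s t hz hs ht) σ := by
  subst hP ez es et
  exact (F.nat.elim_sub P z s t hz hs ht σ).symm

theorem upTo_p_inst (A : F.Ty j Γ) (A' : F.Ty j (F.ext Γ A)) (h : A' = F.tySub A (F.p A))
    (hq : F.tyOf (F.q A) = A') :
    C.comp (F.upTo (F.p A) A A' h) (F.inst A' (F.q A) hq) = C.id _ := by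
  rw [← F.pair_eta A (C.id _)]
  unfold CwF.upTo CwF.inst
  rw [F.pair_comp]
  apply F.pair_congr
  · rw [C.assoc, F.p_pair]
  · rw [F.q_pair, F.tmSub_id]

end Fam

section ObjectFormers

variable {C : Base.{0, 0}} {F : Fam C}

theorem up_new {j : ℕ} {X Y : Psh C} (σ : PSub X Y) (A : PSub Y (tyPsh F j)) {a : C.Con}
    (γ : X.obj a) : ((objCwF F).up σ A).app (new (A.comp σ) γ) = new A (σ.app γ) :=
  Subtype.ext (Prod.ext (σ.nat γ _) rfl)

theorem tyOf_app_eq {j : ℕ} {X : Psh C} {t : PSub X (tmPsh F j)} {A : PSub X (tyPsh F j)}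
    (h : (objCwF F).tyOf t = A) {a : C.Con} (γ : X.obj a) : F.tyOf (t.app γ) = A.app γ :=
  congrArg (fun B => PSub.app B γ) h

/-- Universes in the object-level family structure, inherited from `F`. -/
abbrev objU (F : Fam C) : UStr (objCwF F) where
  U j X := ⟨fun {a} _ => F.univ.U j a, fun _ f => (F.univ.U_sub j f).symm⟩
  U_sub _ _ _ _ := rfl
  El t h := ⟨fun γ => F.univ.El (t.app γ) (tyOf_app_eq h γ), fun γ f =>
    F.El_sub' f _ _ _ _ (nat_tm t γ f)⟩
  code A := ⟨fun γ => F.univ.code (A.app γ), fun γ f => by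
    rw [nat_ty]; exact (F.univ.code_sub _ _).symm⟩
  tyOf_code A := PSub.ext_app fun _ γ => F.univ.tyOf_code _
  El_code A := PSub.ext_app fun _ γ => F.univ.El_code _
  code_El t h := PSub.ext_app fun _ γ => F.univ.code_El _ _
  code_sub _ _ := rfl

theorem oPi_nat {j : ℕ} {X : Psh C} (A : PSub X (tyPsh F j)) (B : PSub (oExt X A) (tyPsh F j))
    {a b : C.Con} (γ : X.obj b) (f : C.Sub a b) :
    F.pi.Pi (A.app (X.res γ f)) (B.app (new A (X.res γ f))) =
      F.tySub (F.pi.Pi (A.app γ) (B.app (new A γ))) f := by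
  rw [F.Pi_sub' f _ _ (nat_ty A γ f), ← nat_ty B, res_new_upTo]

theorem oSg_nat {j : ℕ} {X : Psh C} (A : PSub X (tyPsh F j)) (B : PSub (oExt X A) (tyPsh F j))
    {a b : C.Con} (γ : X.obj b) (f : C.Sub a b) :
    F.sg.Sg (A.app (X.res γ f)) (B.app (new A (X.res γ f))) =
      F.tySub (F.sg.Sg (A.app γ) (B.app (new A γ))) f := by
  rw [F.Sg_sub' f _ _ (nat_ty A γ f), ← nat_ty B, res_new_upTo]

theorem app_new_inst {j k : ℕ} {X : Psh C} {A : PSub X (tyPsh F j)}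
    (B : PSub (oExt X A) (tyPsh F k)) {a : C.Con} (γ : X.obj a) (t : F.Tm j a)
    (h : F.tyOf t = A.app γ) :
    F.tySub (B.app (new A γ)) (F.inst (A.app γ) t h) = B.app ⟨(γ, t), h⟩ := by
  rw [← nat_ty B, res_new_inst]

theorem oApp_nat {j : ℕ} {X : Psh C} (A : PSub X (tyPsh F j)) (B : PSub (oExt X A) (tyPsh F j))
    (t : PSub X (tmPsh F j))
    (h : ∀ {a : C.Con} (γ : X.obj a), F.tyOf (t.app γ) = F.pi.Pi (A.app γ) (B.app (new A γ)))
    {a b : C.Con} (γ : X.obj b) (f : C.Sub a b) :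
    F.pi.app (A.app (X.res γ f)) (B.app (new A (X.res γ f))) (t.app (X.res γ f)) (h _) =
      F.tmSub (F.pi.app (A.app γ) (B.app (new A γ)) (t.app γ) (h _))
        (F.upTo f (A.app γ) (A.app (X.res γ f)) (nat_ty A γ f)) := by
  apply F.app_sub'
  · rw [← nat_ty B, res_new_upTo]
  · exact nat_tm t γ f

/-- Function types in the object-level family structure, inherited from `F`. -/
abbrev objPi (F : Fam C) : PiStr (objCwF F) where
  Pi A B := ⟨fun γ => F.pi.Pi (A.app γ) (B.app (new A γ)), oPi_nat A B⟩
  Pi_sub A B σ := PSub.ext_app fun a γ => by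
    change F.pi.Pi _ (B.app (new A (σ.app γ))) = F.pi.Pi _ (B.app _)
    rw [up_new]; rfl
  lam A t := ⟨fun γ => F.pi.lam (A.app γ) (t.app (new A γ)), fun γ f => by
    change _ = F.tmSub _ f
    rw [F.lam_sub' f _ _ (nat_ty A γ f), ← nat_tm t, res_new_upTo]⟩
  app A B t h := ⟨fun x => F.tmSub (F.pi.app (A.app x.1.1) (B.app (new A x.1.1)) (t.app x.1.1)
      (tyOf_app_eq h x.1.1)) (F.inst (A.app x.1.1) x.1.2 x.2), fun x f => by
    change F.tmSub (F.pi.app (A.app (Psh.res _ x.1.1 f)) _ (t.app (Psh.res _ x.1.1 f)) _) _ =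
      F.tmSub (F.tmSub _ _) f
    rw [oApp_nat A B t (tyOf_app_eq h), ← F.tmSub_comp, ← F.tmSub_comp]
    congr 1
    exact F.upTo_comp_inst f _ _ _ _ _ _ _ rfl⟩
  tyOf_lam A t := PSub.ext_app fun _ γ => F.pi.tyOf_lam _ _
  tyOf_app A B t h := PSub.ext_app fun _ x => by
    change F.tyOf (F.tmSub _ _) = _
    rw [F.tyOf_tmSub, F.pi.tyOf_app, app_new_inst]
  app_lam A t := PSub.ext_app fun _ x => by
    change F.tmSub (F.pi.app _ _ (F.pi.lam _ _) _) _ = _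
    rw [F.app_eq _ _ _ _ (t.app (new A x.1.1)) rfl rfl, ← nat_tm t, res_new_inst]
  lam_app A B t h := PSub.ext_app fun a γ => by
    have e := oApp_nat A B t (tyOf_app_eq h) γ (F.p (A.app γ))
    refine Eq.trans (congrArg (F.pi.lam _) (Eq.trans (congrArg (fun s => F.tmSub s _) e) ?_))
      (F.pi.lam_app _ _ _ (tyOf_app_eq h γ))
    exact (F.tmSub_comp _ _ _).symm.trans
      ((congrArg (F.tmSub _) (F.upTo_p_inst _ _ _ _)).trans (F.tmSub_id _))
  lam_sub A t σ := PSub.ext_app fun a γ => by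
    change F.pi.lam _ (t.app (new A (σ.app γ))) = F.pi.lam _ (t.app _)
    rw [up_new]; rfl

/-- `Σ`-types in the object-level family structure, inherited from `F`. -/
abbrev objSg (F : Fam C) : SgStr (objCwF F) where
  Sg A B := ⟨fun γ => F.sg.Sg (A.app γ) (B.app (new A γ)), oSg_nat A B⟩
  Sg_sub A B σ := PSub.ext_app fun a γ => by
    change F.sg.Sg _ (B.app (new A (σ.app γ))) = F.sg.Sg _ (B.app _)
    rw [up_new]; rfl
  tup A B t w ht hw := ⟨fun γ => F.sg.tup (A.app γ) (B.app (new A γ)) (t.app γ) (w.app γ)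
      (tyOf_app_eq ht γ) (by
        rw [app_new_inst]; exact congrArg (fun B => PSub.app B γ) hw), fun γ f => by
    change _ = F.tmSub _ f
    symm
    apply F.tup_sub' f _ _ (nat_ty A γ f)
    · rw [← nat_ty B, res_new_upTo]
    · exact nat_tm t γ f
    · exact nat_tm w γ f⟩
  fst A B t h := ⟨fun γ => F.sg.fst (A.app γ) (B.app (new A γ)) (t.app γ) (tyOf_app_eq h γ),
    fun γ f => F.fst_sub' f _ _ (nat_ty A γ f) _ _ _ _
      (by rw [← nat_ty B, res_new_upTo]) _ _ (nat_tm t γ f)⟩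
  snd A B t h := ⟨fun γ => F.sg.snd (A.app γ) (B.app (new A γ)) (t.app γ) (tyOf_app_eq h γ),
    fun γ f => F.snd_sub' f _ _ (nat_ty A γ f) _ _ _ _
      (by rw [← nat_ty B, res_new_upTo]) _ _ (nat_tm t γ f)⟩
  tyOf_tup A B t w ht hw := PSub.ext_app fun _ γ => F.sg.tyOf_tup _ _ _ _ _ _
  tyOf_fst A B t h := PSub.ext_app fun _ γ => F.sg.tyOf_fst _ _ _ _
  tyOf_snd A B t h := PSub.ext_app fun _ γ => by
    change F.tyOf (F.sg.snd _ _ _ _) = _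
    rw [F.sg.tyOf_snd, app_new_inst]
    rfl
  fst_tup A B t w ht hw := PSub.ext_app fun _ γ => F.sg.fst_tup _ _ _ _ _ _
  snd_tup A B t w ht hw := PSub.ext_app fun _ γ => F.sg.snd_tup _ _ _ _ _ _
  tup_eta A B t h := PSub.ext_app fun _ γ => F.sg.tup_eta _ _ _ _
  tup_sub A B t w ht hw σ := PSub.ext_app fun a γ => by
    have e : ∀ B' (_ : B.app (new A (σ.app γ)) = B') h₁ h₂,
        F.sg.tup (A.app (σ.app γ)) (B.app (new A (σ.app γ))) (t.app (σ.app γ))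
          (w.app (σ.app γ)) h₁ h₂ =
        F.sg.tup (A.app (σ.app γ)) B' (t.app (σ.app γ)) (w.app (σ.app γ)) h₁
          (by rw [h₂]; subst_vars; rfl) := by
      intro B' hB h₁ h₂; subst hB; rfl
    exact e _ (congrArg B.app (up_new σ A γ).symm) _ _

/-- Natural numbers in the object-level family structure, inherited from `F`. -/
abbrev objNatIntro (F : Fam C) : NatIntro (objCwF F) where
  Nat j X := ⟨fun {a} _ => F.nat.Nat j a, fun _ f => (F.nat.Nat_sub j f).symm⟩
  Nat_sub _ _ _ _ := rfl
  zero j X := ⟨fun {a} _ => F.nat.zero j a, fun _ f => (F.nat.zero_sub j f).symm⟩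
  tyOf_zero j X := PSub.ext_app fun a _ => F.nat.tyOf_zero j a
  zero_sub _ _ _ _ := rfl
  suc t h := ⟨fun γ => F.nat.suc (t.app γ) (tyOf_app_eq h γ), fun γ f =>
    F.suc_sub' f _ _ _ _ (nat_tm t γ f)⟩
  tyOf_suc t h := PSub.ext_app fun _ γ => F.nat.tyOf_suc _ _
  suc_sub _ _ _ := rfl

theorem res_new_sucSub {j k : ℕ} {X : Psh C}
    (P : PSub (oExt X ((objNatIntro F).Nat j X)) (tyPsh F k)) {a : C.Con} (γ : X.obj a) :
    (oExt X ((objNatIntro F).Nat j X)).res (new ((objNatIntro F).Nat j X) γ)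
        (F.nat.sucSub (P.app (new ((objNatIntro F).Nat j X) γ))) =
      ((objNatIntro F).sucSub P).app (new P (new ((objNatIntro F).Nat j X) γ)) := by
  refine (res_new_pair ((objNatIntro F).Nat j X) γ _ _ _).trans ?_
  exact Subtype.ext (Prod.ext (X.res_comp _ _ _) rfl)

theorem res_new_upNat {j : ℕ} {X : Psh C} {a b : C.Con} (γ : X.obj b) (f : C.Sub a b) :
    (oExt X ((objNatIntro F).Nat j X)).res (new ((objNatIntro F).Nat j X) γ) (F.nat.upNat j f) =
      new ((objNatIntro F).Nat j X) (X.res γ f) :=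
  res_new_upTo ((objNatIntro F).Nat j X) γ f

theorem res_new_upTo' {j : ℕ} {X : Psh C} (A : PSub X (tyPsh F j)) {a b : C.Con} (γ : X.obj b)
    (f : C.Sub a b) (δ : X.obj a) (e : X.res γ f = δ) (h : A.app δ = F.tySub (A.app γ) f) :
    (oExt X A).res (new A γ) (F.upTo f (A.app γ) (A.app δ) h) = new A δ := by
  subst e; exact res_new_upTo A γ f

theorem oElim_hz {j k : ℕ} {X : Psh C} (P : PSub (oExt X ((objNatIntro F).Nat j X)) (tyPsh F k))
    (z : PSub X (tmPsh F k))
    (hz : (objCwF F).tyOf z = (objCwF F).tySub P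
      ((objCwF F).inst _ ((objNatIntro F).zero j X) ((objNatIntro F).tyOf_zero j X)))
    {a : C.Con} (γ : X.obj a) :
    F.tyOf (z.app γ) = F.tySub (P.app (new ((objNatIntro F).Nat j X) γ))
      (F.inst (F.nat.Nat j a) (F.nat.zero j a) (F.nat.tyOf_zero j a)) :=
  (tyOf_app_eq hz γ).trans
    (app_new_inst P γ (F.nat.zero j a) (F.nat.tyOf_zero j a)).symm

theorem oElim_hs {j k : ℕ} {X : Psh C} (P : PSub (oExt X ((objNatIntro F).Nat j X)) (tyPsh F k))
    (s : PSub (oExt (oExt X ((objNatIntro F).Nat j X)) P) (tmPsh F k))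
    (hs : (objCwF F).tyOf s = (objCwF F).tySub P ((objNatIntro F).sucSub P))
    {a : C.Con} (γ : X.obj a) :
    F.tyOf (s.app (new P (new ((objNatIntro F).Nat j X) γ))) =
      F.tySub (P.app (new ((objNatIntro F).Nat j X) γ))
        (F.nat.sucSub (P.app (new ((objNatIntro F).Nat j X) γ))) := by
  refine (tyOf_app_eq hs _).trans ?_
  rw [← nat_ty P, res_new_sucSub]
  rfl

theorem oElim_congr {j k : ℕ} {X : Psh C}
    (P : PSub (oExt X ((objNatIntro F).Nat j X)) (tyPsh F k))
    (s : PSub (oExt (oExt X ((objNatIntro F).Nat j X)) P) (tmPsh F k)) {a : C.Con}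
    (x x' : (oExt X ((objNatIntro F).Nat j X)).obj (F.ext a (F.nat.Nat j a)))
    (z : F.Tm k a) (w : F.Tm k (F.ext _ (P.app x'))) (t : F.Tm j a) (hz hs ht hz' hs' ht')
    (e : x = x') (ew : w = s.app (new P x')) :
    F.nat.elim (P.app x) z (s.app (new P x)) t hz hs ht =
      F.nat.elim (P.app x') z w t hz' hs' ht' := by
  subst e ew; rfl

/-- Natural numbers in the object-level family structure, inherited from `F`. -/
abbrev objNat (F : Fam C) : NatStr (objCwF F) where
  toNatIntro := objNatIntro F
  elim {j k X} P z s t hz hs ht :=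
    { app := fun γ => F.nat.elim (P.app (new ((objNatIntro F).Nat j X) γ)) (z.app γ)
        (s.app (new P (new ((objNatIntro F).Nat j X) γ))) (t.app γ) (oElim_hz P z hz γ)
        (oElim_hs P s hs γ) (tyOf_app_eq ht γ)
      nat := fun {a b} γ f => by
        have e : P.app (new ((objNatIntro F).Nat j X) (X.res γ f)) =
            F.tySub (P.app (new ((objNatIntro F).Nat j X) γ)) (F.nat.upNat j f) := by
          rw [← nat_ty P, res_new_upNat]
        apply F.elim_sub' f _ _ _ _ _ _ _ _ e
        · exact nat_tm z γ f
        · rw [← nat_tm s]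
          exact congrArg s.app (res_new_upTo' P _ _ _ (res_new_upNat γ f) e).symm
        · exact nat_tm t γ f }
  tyOf_elim {j k X} P z s t hz hs ht := PSub.ext_app fun a γ => by
    refine (F.nat.tyOf_elim _ _ _ _ _ _ _).trans ?_
    exact app_new_inst P γ (t.app γ) (tyOf_app_eq ht γ)
  elim_zero P z s hz hs := PSub.ext_app fun a γ => F.nat.elim_zero _ _ _ _ _
  elim_suc {j k X} P z s t hz hs ht := PSub.ext_app fun a γ => by
    refine (F.nat.elim_suc _ _ _ _ _ _ _).trans ?_
    rw [← nat_tm s]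
    refine congrArg s.app ((res_new_pair P _ _ _ _).trans ?_)
    exact Subtype.ext (Prod.ext (res_new_inst ((objNatIntro F).Nat j X) γ _ _) rfl)
  elim_sub {j k X Y} P z s t hz hs ht σ := PSub.ext_app fun a γ => by
    apply oElim_congr P s
    · exact (up_new σ ((objNatIntro F).Nat j Y) γ).symm
    · exact congrArg s.app (up_new _ P _)

/-- The object-level family structure of the presheaf model. -/
abbrev objPshFam (F : Fam C) : Fam (pshBase C) where
  toCwF := objCwF F
  univ := objU F
  sg := objSg F
  pi := objPi F
  nat := objNat F

end ObjectFormers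

/-! ### The presheaf model: meta-level family structure -/

section MetaLevel

variable {K : SetHierarchy} {C : Base.{0, 0}}

/-- Displayed presheaves over `X`, valued in the universe `Set_j`: a set `obj γ` in `Set_j` for
each element `γ` of `X`, with functorial restriction maps from `obj γ` to `obj γ'` whenever
`γ' = γ[f]`. -/
structure DTy (K : SetHierarchy) {C : Base.{0, 0}} (j : ℕ) (X : Psh C) where
  obj : ∀ {a : C.Con}, X.obj a → K.V j
  res : ∀ {a b : C.Con} (f : C.Sub a b) (γ : X.obj b) (γ' : X.obj a), γ' = X.res γ f →
    K.El (obj γ) → K.El (obj γ')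
  res_id : ∀ {a : C.Con} (γ : X.obj a) (h : γ = X.res γ (C.id a)) (α : K.El (obj γ)),
    res (C.id a) γ γ h α = α
  res_comp : ∀ {a b c : C.Con} (f : C.Sub b c) (g : C.Sub a b) (γ : X.obj c) (γ' : X.obj b)
    (γ'' : X.obj a) (h : γ' = X.res γ f) (h' : γ'' = X.res γ' g)
    (h'' : γ'' = X.res γ (C.comp f g)) (α : K.El (obj γ)),
    res g γ' γ'' h' (res f γ γ' h α) = res (C.comp f g) γ γ'' h'' α

/-- Sections of a displayed presheaf. -/
structure Sec {j : ℕ} {X : Psh C} (A : DTy K j X) where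
  app : ∀ {a : C.Con} (γ : X.obj a), K.El (A.obj γ)
  nat : ∀ {a b : C.Con} (f : C.Sub a b) (γ : X.obj b) (γ' : X.obj a) (h : γ' = X.res γ f),
    A.res f γ γ' h (app γ) = app γ'

theorem Sec.ext_app {j : ℕ} {X : Psh C} {A : DTy K j X} {s t : Sec A}
    (h : ∀ (a : C.Con) (γ : X.obj a), s.app γ = t.app γ) : s = t := by
  cases s with | mk s hs =>
  cases t with | mk t ht =>
  obtain rfl : @s = @t := by funext a γ; exact h a γ
  rfl

namespace DTy

variable {j : ℕ} {X Y : Psh C}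

theorem ext_heq {A B : DTy K j X} (h : ∀ (a : C.Con) (γ : X.obj a), A.obj γ = B.obj γ)
    (h' : ∀ (a b : C.Con) (f : C.Sub a b) (γ : X.obj b) (γ' : X.obj a) (e : γ' = X.res γ f)
      (α : K.El (A.obj γ)) (β : K.El (B.obj γ)), HEq α β →
      HEq (A.res f γ γ' e α) (B.res f γ γ' e β)) : A = B := by
  cases A with | mk o r _ _ =>
  cases B with | mk o' r' _ _ =>
  obtain rfl : @o = @o' := by funext a γ; exact h a γ
  obtain rfl : @r = @r' := by
    funext a b f γ γ' e α
    exact eq_of_heq (h' a b f γ γ' e α α HEq.rfl)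
  rfl

theorem res_heq {A B : DTy K j X} (hA : A = B) {a b : C.Con} (f : C.Sub a b) {γ δ : X.obj b}
    {γ' δ' : X.obj a} (h : γ' = X.res γ f) (h' : δ' = X.res δ f) (e : γ = δ) (e' : γ' = δ')
    {α : K.El (A.obj γ)} {β : K.El (B.obj δ)} (hα : HEq α β) :
    HEq (A.res f γ γ' h α) (B.res f δ δ' h' β) := by
  subst hA e e'
  obtain rfl := eq_of_heq hα
  rfl

theorem res_id_heq (A : DTy K j X) {a : C.Con} (γ γ' : X.obj a) (h : γ' = X.res γ (C.id a))
    (α : K.El (A.obj γ)) : HEq (A.res (C.id a) γ γ' h α) α := by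
  obtain rfl : γ' = γ := h.trans (X.res_id γ)
  rw [A.res_id]

/-- Substitution of displayed presheaves. -/
abbrev sub (A : DTy K j Y) (σ : PSub X Y) : DTy K j X where
  obj γ := A.obj (σ.app γ)
  res f γ γ' h := A.res f (σ.app γ) (σ.app γ') (by rw [h, σ.nat])
  res_id γ h := A.res_id _ _
  res_comp f g γ γ' γ'' h h' h'' := A.res_comp f g _ _ _ _ _ _

/-- Transport along an equality of elements. -/
def tr (A : DTy K j X) {a : C.Con} {γ γ' : X.obj a} (e : γ = γ') (α : K.El (A.obj γ)) :
    K.El (A.obj γ') := e ▸ α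

theorem res_tr (A : DTy K j X) {a b : C.Con} (f : C.Sub a b) {γ δ : X.obj b} (γ' : X.obj a)
    (e : γ = δ) (h : γ' = X.res δ f) (α : K.El (A.obj γ)) :
    A.res f δ γ' h (A.tr e α) = A.res f γ γ' (by rw [h, e]) α := by
  subst e; rfl

theorem res_eq_tr (A : DTy K j X) {a b : C.Con} (f : C.Sub a b) (γ : X.obj b)
    {γ' δ' : X.obj a} (e : γ' = δ') (h : γ' = X.res γ f) (α : K.El (A.obj γ)) :
    A.res f γ δ' (by rw [← e, h]) α = A.tr e (A.res f γ γ' h α) := by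
  subst e; rfl

theorem tr_heq (A : DTy K j X) {a : C.Con} {γ γ' : X.obj a} (e : γ = γ')
    (α : K.El (A.obj γ)) : HEq (A.tr e α) α := by
  subst e; rfl

end DTy

/-- Substitution of sections. -/
abbrev Sec.sub {j : ℕ} {X Y : Psh C} {A : DTy K j Y} (s : Sec A) (σ : PSub X Y) :
    Sec (A.sub σ) where
  app γ := s.app (σ.app γ)
  nat f γ γ' h := s.nat f _ _ _

/-- Terms over `X` in the meta-level family structure: a displayed presheaf with a section. -/
abbrev MTm (K : SetHierarchy) {C : Base.{0, 0}} (j : ℕ) (X : Psh C) : Type :=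
  Σ A : DTy K j X, Sec A

/-- The section underlying a term of type `A`. -/
abbrev MTm.sec {j : ℕ} {X : Psh C} {A : DTy K j X} (t : MTm K j X) (h : t.1 = A) : Sec A := h ▸ t.2

theorem MTm.eq_mk {j : ℕ} {X : Psh C} {A : DTy K j X} (t : MTm K j X) (h : t.1 = A) :
    t = ⟨A, t.sec h⟩ := by
  cases t; subst h; rfl

theorem MTm.ext_heq {j : ℕ} {X : Psh C} {A B : DTy K j X} {s : Sec A} {t : Sec B} (h : A = B)
    (h' : ∀ (a : C.Con) (γ : X.obj a), HEq (s.app γ) (t.app γ)) :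
    (⟨A, s⟩ : MTm K j X) = ⟨B, t⟩ := by
  subst h
  rw [Sec.ext_app fun a γ => eq_of_heq (h' a γ)]

/-- Extension of a presheaf by a displayed presheaf. -/
abbrev mExt {j : ℕ} (X : Psh C) (A : DTy K j X) : Psh C where
  obj a := Σ γ : X.obj a, K.El (A.obj γ)
  res x f := ⟨X.res x.1 f, A.res f x.1 _ rfl x.2⟩
  res_id x := Sigma.ext (X.res_id _) (A.res_id_heq _ _ _ _)
  res_comp x f g := Sigma.ext (X.res_comp _ _ _) (by
    refine HEq.trans ?_ (heq_of_eq (A.res_comp f g _ _ _ rfl rfl (X.res_comp _ _ _).symm _).symm)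
    exact DTy.res_heq rfl _ _ _ rfl (X.res_comp _ _ _) HEq.rfl)

theorem mExt_eq {j : ℕ} {X : Psh C} {A : DTy K j X} {a b : C.Con} (x : (mExt X A).obj b)
    (f : C.Sub a b) (γ : X.obj a) (h : γ = X.res x.1 f) (α : K.El (A.obj γ))
    (h' : A.res f x.1 γ h x.2 = α) : (⟨γ, α⟩ : (mExt X A).obj a) = (mExt X A).res x f := by
  subst h h'; rfl

/-- The family structure of meta-level types and terms in presheaves: a type over `X` is a
displayed presheaf over `X`, and a term is a section. -/
abbrev mtaCwF (K : SetHierarchy) (C : Base.{0, 0}) : CwF (pshBase C) where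
  Ty j X := DTy K j X
  Tm j X := MTm K j X
  tyOf t := t.1
  tySub A σ := A.sub σ
  tmSub t σ := ⟨t.1.sub σ, t.2.sub σ⟩
  tyOf_tmSub _ _ := rfl
  tySub_id _ := rfl
  tySub_comp _ _ _ := rfl
  tmSub_id _ := rfl
  tmSub_comp _ _ _ := rfl
  ext X A := mExt X A
  p A := ⟨fun x => x.1, fun _ _ => rfl⟩
  q A := ⟨A.sub ⟨fun x => x.1, fun _ _ => rfl⟩, ⟨fun x => x.2, fun f x x' h => by
    subst h; rfl⟩⟩
  tyOf_q _ := rfl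
  pair σ A t h := ⟨fun γ => ⟨σ.app γ, (t.sec h).app γ⟩, fun γ f =>
    mExt_eq _ _ _ (σ.nat γ f) _ ((t.sec h).nat f γ _ rfl)⟩
  p_pair _ _ _ _ := rfl
  q_pair σ A t h := (MTm.eq_mk t h).symm
  pair_eta _ _ := rfl

theorem MTm.sec_sub {j : ℕ} {X Y : Psh C} {A : DTy K j Y} (t : MTm K j Y) (h : t.1 = A)
    (σ : PSub X Y) (h' : ((mtaCwF K C).tmSub t σ).1 = A.sub σ) :
    ((mtaCwF K C).tmSub t σ).sec h' = (t.sec h).sub σ := by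
  subst h; rfl

/-! #### Representable presheaves -/

/-- The presheaf represented by `a`. -/
abbrev yo (a : C.Con) : Psh C :=
  ⟨fun b => C.Sub b a, fun g f => C.comp g f, fun g => C.comp_id g, fun g f k =>
    (C.assoc g f k).symm⟩

/-- The action of a morphism on representable presheaves. -/
abbrev yoMap {a b : C.Con} (f : C.Sub a b) : PSub (yo a) (yo b) :=
  ⟨fun g => C.comp f g, fun g k => (C.assoc f g k).symm⟩

/-- The natural transformation from a representable presheaf which corresponds to an element. -/
abbrev name {X : Psh C} {a : C.Con} (γ : X.obj a) : PSub (yo a) X :=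
  ⟨fun f => X.res γ f, fun f g => X.res_comp γ f g⟩

theorem name_res {X : Psh C} {a b : C.Con} (f : C.Sub a b) (γ : X.obj b) (γ' : X.obj a)
    (h : γ' = X.res γ f) : name γ' = (name γ).comp (yoMap f) := by
  subst h
  exact PSub.ext_app fun c g => (X.res_comp γ f g).symm

theorem name_app {X Y : Psh C} (σ : PSub X Y) {a : C.Con} (γ : X.obj a) :
    name (σ.app γ) = σ.comp (name γ) :=
  PSub.ext_app fun c g => (σ.nat γ g).symm

theorem yoMap_id (a : C.Con) : yoMap (C.id a) = PSub.id (yo a) :=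
  PSub.ext_app fun c g => C.id_comp g

theorem yoMap_comp {a b c : C.Con} (f : C.Sub b c) (g : C.Sub a b) :
    yoMap (C.comp f g) = (yoMap f).comp (yoMap g) :=
  PSub.ext_app fun d k => C.assoc f g k

end MetaLevel

section MetaFormers

variable {K : SetHierarchy} {C : Base.{0, 0}}

/-! #### Function types -/

/-- Lifting of `ρ` under a binder, on presheaves. -/
abbrev mUp {j : ℕ} {X Y : Psh C} (ρ : PSub X Y) (A : DTy K j Y) :
    PSub (mExt X (A.sub ρ)) (mExt Y A) :=
  (mtaCwF K C).up ρ A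

/-- The semantic function space at `ρ : yo a → X`: sections of `B` over `yo a ▹ A[ρ]`, that is,
natural families of elements of `B (ρ f, α)`, for `f : Sub b a` and `α : A (ρ f)`. -/
abbrev PiSet {j : ℕ} {X : Psh C} (A : DTy K j X) (B : DTy K j (mExt X A)) {a : C.Con}
    (ρ : PSub (yo a) X) : Type :=
  Sec (B.sub (mUp ρ A))

/-- Restriction of semantic functions. -/
def PiSet.res {j : ℕ} {X : Psh C} {A : DTy K j X} {B : DTy K j (mExt X A)} {a b : C.Con}
    (f : C.Sub a b) {ρ : PSub (yo b) X} {ρ' : PSub (yo a) X} (h : ρ' = ρ.comp (yoMap f))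
    (φ : PiSet A B ρ) : PiSet A B ρ' :=
  h ▸ Sec.sub φ (mUp (yoMap f) (A.sub ρ))

/-- Application of a semantic function at `g : Sub b a` to `α : A (ρ g)`. -/
def PiSet.ev {j : ℕ} {X : Psh C} {A : DTy K j X} {B : DTy K j (mExt X A)} {a b : C.Con}
    {ρ : PSub (yo a) X} (φ : PiSet A B ρ) (g : C.Sub b a) (δ : X.obj b) (h : δ = ρ.app g)
    (α : K.El (A.obj δ)) : K.El (B.obj (⟨δ, α⟩ : (mExt X A).obj b)) := by
  subst h; exact φ.app ⟨g, α⟩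

namespace PiSet

variable {j : ℕ} {X : Psh C} {A : DTy K j X} {B : DTy K j (mExt X A)} {a b c : C.Con}

theorem ext_ev {ρ : PSub (yo a) X} {φ ψ : PiSet A B ρ}
    (h : ∀ (b : C.Con) (g : C.Sub b a) (δ : X.obj b) (e : δ = ρ.app g) (α : K.El (A.obj δ)),
      φ.ev g δ e α = ψ.ev g δ e α) : φ = ψ :=
  Sec.ext_app fun b x => h b x.1 (ρ.app x.1) rfl x.2

theorem res_ev (f : C.Sub a b) {ρ : PSub (yo b) X} {ρ' : PSub (yo a) X}
    (h : ρ' = ρ.comp (yoMap f)) (φ : PiSet A B ρ) (g : C.Sub c a) (δ : X.obj c)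
    (e : δ = ρ'.app g) (α : K.El (A.obj δ)) :
    (PiSet.res f h φ).ev g δ e α = φ.ev (C.comp f g) δ (by rw [e, h]; rfl) α := by
  subst h; subst e; rfl

theorem ev_congr {ρ : PSub (yo a) X} (φ : PiSet A B ρ) {g g' : C.Sub b a} (hg : g = g')
    (δ : X.obj b) (e : δ = ρ.app g) (α : K.El (A.obj δ)) :
    φ.ev g δ e α = φ.ev g' δ (by rw [e, hg]) α := by
  subst hg; rfl

theorem nat_ev {ρ : PSub (yo a) X} (φ : PiSet A B ρ) (g : C.Sub b a) (f : C.Sub c b)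
    (δ : X.obj b) (e : δ = ρ.app g) (α : K.El (A.obj δ)) (δ' : X.obj c) (h : δ' = X.res δ f)
    (α' : K.El (A.obj δ')) (h' : (⟨δ', α'⟩ : (mExt X A).obj c) = (mExt X A).res ⟨δ, α⟩ f) :
    B.res f ⟨δ, α⟩ ⟨δ', α'⟩ h' (φ.ev g δ e α) =
      φ.ev (C.comp g f) δ' (by rw [h, e]; exact (ρ.nat g f).symm) α' := by
  subst e
  obtain rfl : δ' = ρ.app (C.comp g f) := h.trans (ρ.nat g f).symm
  refine φ.nat f (⟨g, α⟩ : (mExt (yo a) (A.sub ρ)).obj b) ⟨C.comp g f, α'⟩ ?_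
  apply mExt_eq (X := yo a) (A := A.sub ρ) ⟨g, α⟩ f (C.comp g f) rfl α'
  have h₂ := (Sigma.mk.inj h').2
  exact eq_of_heq ((DTy.res_heq rfl f _ _ rfl h HEq.rfl).trans h₂.symm)

theorem sub_ev (t : Sec B) (ρ : PSub (yo a) X) (g : C.Sub b a) (δ : X.obj b)
    (e : δ = ρ.app g) (α : K.El (A.obj δ)) :
    PiSet.ev (A := A) (B := B) (t.sub (mUp ρ A)) g δ e α = t.app ⟨δ, α⟩ := by
  subst e; rfl

theorem res_sub {Y : Psh C} (σ : PSub Y X) (f : C.Sub a b) {ρ : PSub (yo b) Y}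
    {ρ' : PSub (yo a) Y} (h : ρ' = ρ.comp (yoMap f))
    (h' : σ.comp ρ' = (σ.comp ρ).comp (yoMap f)) (φ : PiSet A B (σ.comp ρ)) :
    PiSet.res (A := A.sub σ) (B := B.sub (mUp σ A)) f h φ =
      PiSet.res (A := A) (B := B) f h' φ := by
  subst h; rfl

end PiSet

variable [Countable C.Con] [∀ a b, Countable (C.Sub a b)]

theorem mk_PiSet_lt {j : ℕ} {X : Psh C} (A : DTy K j X) (B : DTy K j (mExt X A)) {a : C.Con}
    (ρ : PSub (yo a) X) : Cardinal.mk (PiSet A B ρ) < K.κ j := by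
  have h : Cardinal.mk (Σ b : C.Con, (mExt (yo a) (A.sub ρ)).obj b) < K.κ j :=
    K.sigma_lt (K.lt_of_countable j _) fun b =>
      K.sigma_lt (K.lt_of_countable j _) fun f => K.mk_El_lt _
  refine K.lt_of_injective (K.pi_lt h fun x => K.mk_El_lt ((B.sub (mUp ρ A)).obj x.2))
    (fun φ x => φ.app x.2) ?_
  intro φ ψ e
  exact Sec.ext_app fun b x => congrFun e ⟨b, x⟩

/-- Meta-level function types. -/
noncomputable abbrev mPi {j : ℕ} {X : Psh C} (A : DTy K j X) (B : DTy K j (mExt X A)) :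
    DTy K j X where
  obj γ := K.code j (PiSet A B (name γ)) (mk_PiSet_lt A B _)
  res f γ γ' h φ := (K.decode (mk_PiSet_lt A B _)).symm
    (PiSet.res f (name_res f γ γ' h) (K.decode (mk_PiSet_lt A B _) φ))
  res_id γ h φ := by
    rw [Equiv.symm_apply_eq]
    refine PiSet.ext_ev fun b g δ e α => ?_
    rw [PiSet.res_ev, PiSet.ev_congr _ (C.id_comp g)]
  res_comp f g γ γ' γ'' h h' h'' φ := by
    rw [Equiv.apply_symm_apply]
    congr 1
    refine PiSet.ext_ev fun b k δ e α => ?_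
    rw [PiSet.res_ev, PiSet.res_ev, PiSet.res_ev, PiSet.ev_congr _ (C.assoc f g k)]

theorem mPi_sub {j : ℕ} {X Y : Psh C} (σ : PSub X Y) (A : DTy K j Y) (B : DTy K j (mExt Y A)) :
    (mPi A B).sub σ = mPi (A.sub σ) (B.sub (mUp σ A)) := by
  have key : ∀ {a : C.Con} (ρ ρ' : PSub (yo a) Y) (_ : ρ = ρ'),
      K.code j (PiSet A B ρ) (mk_PiSet_lt A B ρ) = K.code j (PiSet A B ρ') (mk_PiSet_lt A B ρ') := by
    intro a ρ ρ' e; subst e; rfl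
  have key' : ∀ {a b : C.Con} (f : C.Sub a b) (ρ₁ ρ₂ : PSub (yo b) Y) (ρ₁' ρ₂' : PSub (yo a) Y)
      (h₁ : ρ₁' = ρ₁.comp (yoMap f)) (h₂ : ρ₂' = ρ₂.comp (yoMap f)) (_ : ρ₁ = ρ₂)
      (φ : K.El (K.code j (PiSet A B ρ₁) (mk_PiSet_lt A B _)))
      (ψ : K.El (K.code j (PiSet A B ρ₂) (mk_PiSet_lt A B _))), HEq φ ψ →
      HEq ((K.decode (mk_PiSet_lt A B _)).symm
          (PiSet.res f h₁ (K.decode (mk_PiSet_lt A B _) φ)))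
        ((K.decode (mk_PiSet_lt A B _)).symm
          (PiSet.res f h₂ (K.decode (mk_PiSet_lt A B _) ψ))) := by
    intro a b f ρ₁ ρ₂ ρ₁' ρ₂' h₁ h₂ e φ ψ hφ
    subst e h₁ h₂
    obtain rfl := eq_of_heq hφ
    rfl
  refine DTy.ext_heq (fun a γ => key _ _ (name_app σ γ)) fun a b f γ γ' e φ ψ hφ => ?_
  have e₁ : σ.app γ' = Y.res (σ.app γ) f := by rw [e, σ.nat]
  have e₂ : σ.comp (name γ') = (σ.comp (name γ)).comp (yoMap f) := by
    rw [name_res f γ γ' e]; rfl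
  refine (key' f _ _ _ _ (name_res f _ _ e₁) e₂ (name_app σ γ) φ ψ hφ).trans (heq_of_eq ?_)
  exact congrArg (K.decode (mk_PiSet_lt A B _)).symm
    (PiSet.res_sub σ f (name_res f γ γ' e) e₂ _).symm

/-- Meta-level abstraction. -/
noncomputable abbrev mLam {j : ℕ} {X : Psh C} (A : DTy K j X) {B : DTy K j (mExt X A)}
    (t : Sec B) : Sec (mPi A B) where
  app γ := (K.decode (mk_PiSet_lt A B _)).symm (t.sub (mUp (name γ) A))
  nat f γ γ' h := by
    change (K.decode _).symm (PiSet.res f _ (K.decode _ ((K.decode _).symm _))) = _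
    rw [Equiv.apply_symm_apply]
    congr 1
    refine PiSet.ext_ev fun b g δ e α => ?_
    rw [PiSet.res_ev, PiSet.sub_ev, PiSet.sub_ev]

theorem mPi_ev_res {j : ℕ} {X : Psh C} {A : DTy K j X} {B : DTy K j (mExt X A)}
    (φ : Sec (mPi A B)) {a b c : C.Con} (f : C.Sub a b) (γ : X.obj b) (γ' : X.obj a)
    (h : γ' = X.res γ f) (g : C.Sub c a) (δ : X.obj c) (e : δ = X.res γ' g)
    (α : K.El (A.obj δ)) :
    (K.decode (mk_PiSet_lt A B _) (φ.app γ')).ev g δ e α =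
      (K.decode (mk_PiSet_lt A B _) (φ.app γ)).ev (C.comp f g) δ
        (by rw [e, h]; exact (X.res_comp _ _ _).symm) α := by
  rw [← φ.nat f γ γ' h]
  change PiSet.ev (K.decode (mk_PiSet_lt A B _) ((K.decode (mk_PiSet_lt A B _)).symm _)) g δ e α = _
  rw [Equiv.apply_symm_apply, PiSet.res_ev]

/-- Meta-level application. -/
noncomputable abbrev mApp {j : ℕ} {X : Psh C} {A : DTy K j X} {B : DTy K j (mExt X A)}
    (φ : Sec (mPi A B)) : Sec B where
  app {a} x := (K.decode (mk_PiSet_lt A B _) (φ.app x.1)).ev (C.id a) x.1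
    (X.res_id x.1).symm x.2
  nat f x x' h := by
    have h₁ : x'.1 = X.res x.1 f := congrArg Sigma.fst h
    rw [mPi_ev_res φ f x.1 x'.1 h₁]
    refine (PiSet.nat_ev _ _ f x.1 _ x.2 x'.1 h₁ x'.2 h).trans ?_
    apply PiSet.ev_congr
    rw [C.id_comp, C.comp_id]

/-- Meta-level function types in the presheaf model. -/
noncomputable abbrev mtaPi (K : SetHierarchy) (C : Base.{0, 0}) [Countable C.Con]
    [∀ a b, Countable (C.Sub a b)] : PiStr (mtaCwF K C) where
  Pi A B := mPi A B
  Pi_sub A B σ := mPi_sub σ A B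
  lam A t := ⟨mPi A t.1, mLam A t.2⟩
  app A B t h := ⟨B, mApp (t.sec h)⟩
  tyOf_lam _ _ := rfl
  tyOf_app _ _ _ _ := rfl
  app_lam A t := by
    refine congrArg (Sigma.mk t.1) (Sec.ext_app fun a x => ?_)
    change PiSet.ev (K.decode (mk_PiSet_lt A t.1 _) ((K.decode (mk_PiSet_lt A t.1 _)).symm _))
      (C.id a) x.1 (Psh.res_id _ x.1).symm x.2 = _
    rw [Equiv.apply_symm_apply, PiSet.sub_ev]
  lam_app {j X} A B t h := by
    refine Eq.trans ?_ (MTm.eq_mk t h).symm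
    refine congrArg (Sigma.mk (mPi A B)) (Sec.ext_app fun a γ => ?_)
    change (K.decode _).symm _ = _
    rw [Equiv.symm_apply_eq]
    refine PiSet.ext_ev fun b g δ e α => ?_
    rw [PiSet.sub_ev]
    change PiSet.ev (K.decode (mk_PiSet_lt A B _) ((t.sec h).app δ)) (C.id b) δ
      (Psh.res_id _ δ).symm α = _
    rw [mPi_ev_res (t.sec h) g γ δ e, PiSet.ev_congr _ (C.comp_id g)]
  lam_sub {j X Y} A t σ := by
    refine MTm.ext_heq (mPi_sub σ A t.1) fun a γ => ?_
    have key : ∀ (ρ ρ' : PSub (yo a) Y) (_ : ρ = ρ'),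
        HEq ((K.decode (mk_PiSet_lt A t.1 ρ)).symm (t.2.sub (mUp ρ A)))
          ((K.decode (mk_PiSet_lt A t.1 ρ')).symm (t.2.sub (mUp ρ' A))) := by
      intro ρ ρ' e; subst e; rfl
    exact key _ _ (name_app σ γ)

end MetaFormers

section MetaSigma

variable {K : SetHierarchy} {C : Base.{0, 0}}

/-! #### Sigma types -/

/-- The set of pairs. -/
abbrev SgSet {j : ℕ} {X : Psh C} (A : DTy K j X) (B : DTy K j (mExt X A)) {a : C.Con}
    (γ : X.obj a) : Type :=
  Σ α : K.El (A.obj γ), K.El (B.obj (⟨γ, α⟩ : (mExt X A).obj a))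

theorem mk_SgSet_lt {j : ℕ} {X : Psh C} (A : DTy K j X) (B : DTy K j (mExt X A)) {a : C.Con}
    (γ : X.obj a) : Cardinal.mk (SgSet A B γ) < K.κ j :=
  K.sigma_lt (K.mk_El_lt _) fun _ => K.mk_El_lt _

/-- Restriction of pairs. -/
def sgRes {j : ℕ} {X : Psh C} {A : DTy K j X} {B : DTy K j (mExt X A)} {a b : C.Con}
    (f : C.Sub a b) (γ : X.obj b) (γ' : X.obj a) (h : γ' = X.res γ f) (x : SgSet A B γ) :
    SgSet A B γ' :=
  ⟨A.res f γ γ' h x.1, B.res f ⟨γ, x.1⟩ ⟨γ', A.res f γ γ' h x.1⟩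
    (mExt_eq (X := X) (A := A) ⟨γ, x.1⟩ f γ' h _ rfl) x.2⟩

theorem sg_eq {j : ℕ} {X : Psh C} {A : DTy K j X} {B : DTy K j (mExt X A)} {a : C.Con}
    {γ : X.obj a} {x y : SgSet A B γ} (h : x.1 = y.1) (h' : HEq x.2 y.2) : x = y :=
  Sigma.ext h h'

theorem sgRes_id {j : ℕ} {X : Psh C} {A : DTy K j X} {B : DTy K j (mExt X A)} {a : C.Con}
    (γ : X.obj a) (h : γ = X.res γ (C.id a)) (x : SgSet A B γ) :
    sgRes (C.id a) γ γ h x = x :=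
  sg_eq (A.res_id γ h x.1) (B.res_id_heq _ _ _ _)

theorem sgRes_comp {j : ℕ} {X : Psh C} {A : DTy K j X} {B : DTy K j (mExt X A)} {a b c : C.Con}
    (f : C.Sub b c) (g : C.Sub a b) (γ : X.obj c) (γ' : X.obj b) (γ'' : X.obj a)
    (h : γ' = X.res γ f) (h' : γ'' = X.res γ' g) (h'' : γ'' = X.res γ (C.comp f g))
    (x : SgSet A B γ) :
    sgRes g γ' γ'' h' (sgRes f γ γ' h x) = sgRes (C.comp f g) γ γ'' h'' x := by
  have e := A.res_comp f g γ γ' γ'' h h' h'' x.1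
  have e₁ : (⟨γ'', A.res g γ' γ'' h' (A.res f γ γ' h x.1)⟩ : (mExt X A).obj a) =
      ⟨γ'', A.res (C.comp f g) γ γ'' h'' x.1⟩ := Sigma.ext rfl (heq_of_eq e)
  refine sg_eq e ?_
  refine HEq.trans (heq_of_eq (B.res_comp f g ⟨γ, x.1⟩ ⟨γ', A.res f γ γ' h x.1⟩
    ⟨γ'', A.res g γ' γ'' h' (A.res f γ γ' h x.1)⟩ _ _ ?_ x.2)) ?_
  · rw [e₁]
    exact mExt_eq (X := X) (A := A) ⟨γ, x.1⟩ (C.comp f g) γ'' h'' _ rfl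
  · exact DTy.res_heq rfl _ _ _ rfl e₁ HEq.rfl

/-- Meta-level `Σ`-types: the set of pairs. -/
noncomputable abbrev mSg {j : ℕ} {X : Psh C} (A : DTy K j X) (B : DTy K j (mExt X A)) :
    DTy K j X where
  obj γ := K.code j (SgSet A B γ) (mk_SgSet_lt A B γ)
  res f γ γ' h x := (K.decode (mk_SgSet_lt A B γ')).symm
    (sgRes f γ γ' h (K.decode (mk_SgSet_lt A B γ) x))
  res_id γ h x := by
    rw [Equiv.symm_apply_eq, sgRes_id]
  res_comp f g γ γ' γ'' h h' h'' x := by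
    rw [Equiv.apply_symm_apply, sgRes_comp]

/-- The substitution `γ ↦ (γ, s γ)`. -/
abbrev instSec {j : ℕ} {X : Psh C} {A : DTy K j X} (s : Sec A) : PSub X (mExt X A) :=
  (mtaCwF K C).inst A ⟨A, s⟩ rfl

/-- Meta-level pairing. -/
noncomputable abbrev mPair {j : ℕ} {X : Psh C} {A : DTy K j X} {B : DTy K j (mExt X A)}
    (s : Sec A) (u : Sec (B.sub (instSec s))) : Sec (mSg A B) where
  app γ := (K.decode (mk_SgSet_lt A B γ)).symm ⟨s.app γ, u.app γ⟩
  nat f γ γ' h := by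
    change (K.decode (mk_SgSet_lt A B _)).symm (sgRes f γ γ' h
      (K.decode (mk_SgSet_lt A B _) ((K.decode (mk_SgSet_lt A B _)).symm _))) = _
    rw [Equiv.apply_symm_apply]
    have e := s.nat f γ γ' h
    refine congrArg (K.decode (mk_SgSet_lt A B γ')).symm (sg_eq e ?_)
    have e₁ : (⟨γ', A.res f γ γ' h (s.app γ)⟩ : (mExt X A).obj _) = ⟨γ', s.app γ'⟩ := by rw [e]
    refine HEq.trans ?_ (heq_of_eq (u.nat f γ γ' h))
    exact DTy.res_heq rfl _ _ _ rfl e₁ HEq.rfl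

theorem decode_nat {j : ℕ} {X : Psh C} {A : DTy K j X} {B : DTy K j (mExt X A)}
    (φ : Sec (mSg A B)) {a b : C.Con} (f : C.Sub a b) (γ : X.obj b) (γ' : X.obj a)
    (h : γ' = X.res γ f) :
    sgRes f γ γ' h (K.decode (mk_SgSet_lt A B γ) (φ.app γ)) =
      K.decode (mk_SgSet_lt A B γ') (φ.app γ') := by
  rw [← φ.nat f γ γ' h]
  exact (Equiv.apply_symm_apply _ _).symm

/-- The first projection. -/
noncomputable abbrev mFst {j : ℕ} {X : Psh C} {A : DTy K j X} {B : DTy K j (mExt X A)}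
    (φ : Sec (mSg A B)) : Sec A where
  app γ := (K.decode (mk_SgSet_lt A B γ) (φ.app γ)).1
  nat f γ γ' h := congrArg Sigma.fst (decode_nat φ f γ γ' h)

/-- The second projection. -/
noncomputable abbrev mSnd {j : ℕ} {X : Psh C} {A : DTy K j X} {B : DTy K j (mExt X A)}
    (φ : Sec (mSg A B)) : Sec (B.sub (instSec (mFst φ))) where
  app γ := (K.decode (mk_SgSet_lt A B γ) (φ.app γ)).2
  nat f γ γ' h := by
    have e := decode_nat φ f γ γ' h
    refine eq_of_heq (HEq.trans ?_ (Sigma.ext_iff.1 e).2)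
    have e₁ : (⟨γ', (K.decode (mk_SgSet_lt A B γ') (φ.app γ')).1⟩ : (mExt X A).obj _) =
        ⟨γ', (sgRes f γ γ' h (K.decode (mk_SgSet_lt A B γ) (φ.app γ))).1⟩ := by rw [e]
    exact DTy.res_heq (X := mExt X A) (A := B) (B := B) rfl f
      (γ := ⟨γ, (K.decode (mk_SgSet_lt A B γ) (φ.app γ)).1⟩)
      (δ := ⟨γ, (K.decode (mk_SgSet_lt A B γ) (φ.app γ)).1⟩) _ _ rfl e₁ HEq.rfl

theorem mFst_mPair {j : ℕ} {X : Psh C} {A : DTy K j X} {B : DTy K j (mExt X A)}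
    (s : Sec A) (u : Sec (B.sub (instSec s))) : mFst (mPair s u) = s :=
  Sec.ext_app fun _ γ => congrArg Sigma.fst
    (Equiv.apply_symm_apply (K.decode (mk_SgSet_lt A B γ)) ⟨s.app γ, u.app γ⟩)

/-- Meta-level `Σ`-types in the presheaf model. -/
noncomputable abbrev mtaSg (K : SetHierarchy) (C : Base.{0, 0}) : SgStr (mtaCwF K C) where
  Sg A B := mSg A B
  Sg_sub A B σ := rfl
  tup {j X} A B t w ht hw := ⟨mSg A B, mPair (MTm.sec t ht) (MTm.sec w hw)⟩
  fst {j X} A B t h := ⟨A, mFst (MTm.sec t h)⟩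
  snd {j X} A B t h := ⟨B.sub (instSec (mFst (MTm.sec t h))), mSnd (MTm.sec t h)⟩
  tyOf_tup _ _ _ _ _ _ := rfl
  tyOf_fst _ _ _ _ := rfl
  tyOf_snd _ _ _ _ := rfl
  fst_tup {j X} A B t w ht hw := by
    refine Eq.trans ?_ (MTm.eq_mk t ht).symm
    exact congrArg (Sigma.mk A) (mFst_mPair _ _)
  snd_tup {j X} A B t w ht hw := by
    obtain ⟨A, s⟩ := t
    subst ht
    obtain ⟨B', u⟩ := w
    change B' = DTy.sub B (instSec s) at hw
    subst hw
    exact MTm.ext_heq (congrArg (fun s => B.sub (instSec s)) (mFst_mPair s u)) fun _ γ =>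
      (Sigma.ext_iff.1 (Equiv.apply_symm_apply (K.decode (mk_SgSet_lt A B γ))
        ⟨s.app γ, u.app γ⟩)).2
  tup_eta {j X} A B t h := by
    refine Eq.trans ?_ (MTm.eq_mk t h).symm
    refine congrArg (Sigma.mk (mSg A B)) (Sec.ext_app fun _ γ => ?_)
    exact Equiv.symm_apply_apply (K.decode (mk_SgSet_lt A B γ)) _
  tup_sub {j X Y} A B t w ht hw σ := by
    obtain ⟨A, s⟩ := t
    subst ht
    obtain ⟨B', u⟩ := w
    change B' = DTy.sub B (instSec s) at hw
    subst hw
    rfl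

end MetaSigma

section MetaUniverse

variable {K : SetHierarchy} {C : Base.{0, 0}}

/-! #### Universes -/

theorem mk_DTy_lt [Countable C.Con] [∀ a b, Countable (C.Sub a b)] (j : ℕ) (a : C.Con) :
    Cardinal.mk (DTy K j (yo a)) < K.κ (j + 1) := by
  have h : Cardinal.mk (Σ o : (∀ x : (Σ b, C.Sub b a), K.V j),
      ∀ y : (Σ b c : C.Con, C.Sub b c × C.Sub c a),
        K.El (o ⟨y.2.1, y.2.2.2⟩) → K.El (o ⟨y.1, C.comp y.2.2.2 y.2.2.1⟩)) < K.κ (j + 1) := by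
    refine K.sigma_lt (K.pi_lt (K.lt_of_countable _ _) fun _ => K.mk_V_lt j) fun o => ?_
    exact K.pi_lt (K.lt_of_countable _ _) fun y => K.pi_lt (K.lt_succ (K.mk_El_lt _)) fun _ =>
      K.lt_succ (K.mk_El_lt _)
  refine K.lt_of_injective h (fun A => ⟨fun x => A.obj x.2, fun y α =>
    A.res y.2.2.1 y.2.2.2 _ rfl α⟩) ?_
  intro A B e
  obtain ⟨e₁, e₂⟩ := Sigma.mk.inj e
  cases A with | mk o r _ _ =>
  cases B with | mk o' r' _ _ =>
  obtain rfl : @o = @o' := by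
    funext b g
    exact congrFun e₁ ⟨b, g⟩
  have e₃ := eq_of_heq e₂
  obtain rfl : @r = @r' := by
    funext b c f γ γ' h α
    subst h
    exact congrFun (congrFun e₃ ⟨b, c, f, γ⟩) α
  rfl

/-- Restriction of an element of `T` at the identity along `f`. -/
def uRes {j : ℕ} {a b : C.Con} (f : C.Sub a b) (T : DTy K j (yo b)) (T' : DTy K j (yo a))
    (h : T' = T.sub (yoMap f)) (α : K.El (T.obj (C.id b))) : K.El (T'.obj (C.id a)) := by
  subst h
  exact T.res f (C.id b) (C.comp f (C.id a)) (by rw [C.comp_id]; exact (C.id_comp f).symm) α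

theorem uRes_heq {j : ℕ} {a b : C.Con} (f : C.Sub a b) (T : DTy K j (yo b))
    (T' : DTy K j (yo a)) (h : T' = T.sub (yoMap f)) (S : DTy K j (yo b)) (hS : T = S)
    (g : C.Sub b b) (g' : C.Sub a b) (hg : g = C.id b) (h' : g' = (yo b).res g f)
    (α : K.El (T.obj (C.id b))) (β : K.El (S.obj g)) (hα : HEq α β) :
    HEq (uRes f T T' h α) (S.res f g g' h' β) := by
  subst h hS
  refine DTy.res_heq rfl f _ _ hg.symm ?_ hα
  rw [h', hg, C.comp_id]
  exact (C.id_comp f).symm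

variable [Countable C.Con] [∀ a b, Countable (C.Sub a b)]

/-- Meta-level universes: at a context `a`, the set of displayed presheaves over the presheaf
represented by `a`. -/
noncomputable abbrev mU (K : SetHierarchy) {C : Base.{0, 0}} [Countable C.Con]
    [∀ a b, Countable (C.Sub a b)] (j : ℕ) (X : Psh C) : DTy K (j + 1) X where
  obj {a} _ := K.code (j + 1) (DTy K j (yo a)) (mk_DTy_lt j a)
  res {a b} f _ _ _ T := (K.decode (mk_DTy_lt j a)).symm
    ((K.decode (mk_DTy_lt j b) T).sub (yoMap f))
  res_id {a} γ h T := by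
    rw [Equiv.symm_apply_eq, yoMap_id]
    rfl
  res_comp {a b c} f g γ γ' γ'' h h' h'' T := by
    rw [Equiv.apply_symm_apply, yoMap_comp]
    rfl

/-- The displayed presheaf over a representable presheaf given by an element of the universe. -/
noncomputable abbrev unU {j : ℕ} {X : Psh C} (s : Sec (mU K j X)) {a : C.Con} (γ : X.obj a) :
    DTy K j (yo a) :=
  K.decode (mk_DTy_lt j a) (s.app γ)

theorem unU_nat {j : ℕ} {X : Psh C} (s : Sec (mU K j X)) {a b : C.Con} (f : C.Sub a b)
    (γ : X.obj b) (γ' : X.obj a) (h : γ' = X.res γ f) :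
    unU s γ' = (unU s γ).sub (yoMap f) := by
  unfold unU
  rw [← s.nat f γ γ' h]
  exact Equiv.apply_symm_apply (K.decode (mk_DTy_lt j a)) _

/-- Meta-level decoding. -/
noncomputable abbrev mEl {j : ℕ} {X : Psh C} (s : Sec (mU K j X)) : DTy K j X where
  obj {a} γ := (unU s γ).obj (C.id a)
  res f γ γ' h := uRes f (unU s γ) (unU s γ') (unU_nat s f γ γ' h)
  res_id {a} γ h α := by
    refine eq_of_heq ((uRes_heq _ _ _ _ _ rfl (C.id a) (C.id a) rfl (C.comp_id _).symm α α
      HEq.rfl).trans ?_)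
    exact DTy.res_id_heq _ _ _ _ _
  res_comp {a b c} f g γ γ' γ'' h h' h'' α := by
    have e : f = (yo c).res (C.id c) f := (C.id_comp f).symm
    have e' : C.comp f g = (yo c).res (C.id c) (C.comp f g) := (C.id_comp _).symm
    refine eq_of_heq ((uRes_heq g (unU s γ') (unU s γ'') _ _ (unU_nat s f γ γ' h) (C.id b) g rfl
      (C.id_comp g).symm _ ((unU s γ).res f (C.id c) (C.comp f (C.id b))
        (by rw [C.comp_id]; exact e) α) ?_).trans ?_)
    · exact uRes_heq f _ _ _ _ rfl _ _ rfl _ _ _ HEq.rfl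
    · refine HEq.trans (heq_of_eq ((unU s γ).res_comp f g (C.id c) (C.comp f (C.id b))
        (C.comp f g) _ ?_ e' α)) (uRes_heq _ _ _ _ _ rfl _ _ rfl _ _ _ HEq.rfl).symm
      change _ = C.comp _ _
      rw [C.comp_id]

/-- Meta-level coding. -/
noncomputable abbrev mCode {j : ℕ} {X : Psh C} (A : DTy K j X) : Sec (mU K j X) where
  app {a} γ := (K.decode (mk_DTy_lt j a)).symm (A.sub (name γ))
  nat {a b} f γ γ' h := by
    refine congrArg (K.decode (mk_DTy_lt j a)).symm ?_
    rw [Equiv.apply_symm_apply, name_res f γ γ' h]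
    rfl

theorem unU_mCode {j : ℕ} {X : Psh C} (A : DTy K j X) {a : C.Con} (γ : X.obj a) :
    unU (mCode A) γ = A.sub (name γ) :=
  Equiv.apply_symm_apply (K.decode (mk_DTy_lt j a)) _

theorem mEl_mCode {j : ℕ} {X : Psh C} (A : DTy K j X) : mEl (mCode A) = A := by
  refine DTy.ext_heq (fun a γ => ?_) fun a b f γ γ' e α β hα => ?_
  · change (unU (mCode A) γ).obj (C.id a) = _
    rw [unU_mCode]
    exact congrArg A.obj (X.res_id γ)
  · refine (uRes_heq f _ _ (unU_nat (mCode A) f γ γ' e) _ (unU_mCode A γ) (C.id b) f rfl (C.id_comp f).symm α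
      (A.tr (X.res_id γ).symm β) (hα.trans (DTy.tr_heq _ _ _).symm)).trans ?_
    exact DTy.res_heq (A := A) rfl f _ e (X.res_id γ) e.symm (DTy.tr_heq _ _ _)

theorem mEl_sub_name {j : ℕ} {X : Psh C} (s : Sec (mU K j X)) {a : C.Con} (γ : X.obj a) :
    (mEl s).sub (name γ) = unU s γ := by
  have key : ∀ {b : C.Con} (g : C.Sub b a),
      unU s (X.res γ g) = (unU s γ).sub (yoMap g) := fun g => unU_nat s g γ _ rfl
  refine DTy.ext_heq (fun b g => ?_) fun b c f g g' e α β hα => ?_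
  · change (unU s (X.res γ g)).obj (C.id b) = _
    rw [key g]
    exact congrArg (unU s γ).obj (C.comp_id g)
  · refine (uRes_heq f _ _ (unU_nat s f _ _ ((name γ).nat g f ▸ congrArg _ e)) _ (key g) (C.id c) f rfl (C.id_comp f).symm α
      ((unU s γ).tr (C.comp_id g).symm β) (hα.trans (DTy.tr_heq _ _ _).symm)).trans ?_
    exact DTy.res_heq (A := unU s γ) rfl f _ e (C.comp_id g) e.symm (DTy.tr_heq _ _ _)

theorem mCode_mEl {j : ℕ} {X : Psh C} (s : Sec (mU K j X)) : mCode (mEl s) = s :=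
  Sec.ext_app fun a γ => by
    change (K.decode (mk_DTy_lt j a)).symm ((mEl s).sub (name γ)) = _
    rw [Equiv.symm_apply_eq]
    exact mEl_sub_name s γ

/-- Meta-level universes in the presheaf model. -/
noncomputable abbrev mtaU (K : SetHierarchy) (C : Base.{0, 0}) [Countable C.Con]
    [∀ a b, Countable (C.Sub a b)] : UStr (mtaCwF K C) where
  U j X := mU K j X
  U_sub _ _ _ _ := rfl
  El t h := mEl (MTm.sec t h)
  code A := ⟨mU K _ _, mCode A⟩
  tyOf_code _ := rfl
  El_code A := mEl_mCode A
  code_El t h := by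
    refine Eq.trans ?_ (MTm.eq_mk t h).symm
    exact congrArg (Sigma.mk (mU K _ _)) (mCode_mEl _)
  code_sub {j X Y} A σ := by
    refine congrArg (Sigma.mk (mU K j X)) (Sec.ext_app fun a γ => ?_)
    refine congrArg (K.decode (mk_DTy_lt j a)).symm ?_
    rw [name_app]
    rfl

end MetaUniverse

section MetaNat

variable {K : SetHierarchy} {C : Base.{0, 0}}

/-! #### Natural numbers -/

theorem mk_nat_lt (K : SetHierarchy) (j : ℕ) : Cardinal.mk ℕ < K.κ j := K.lt_of_countable j ℕ

/-- The constant displayed presheaf of natural numbers. -/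
noncomputable abbrev mNat (K : SetHierarchy) {C : Base.{0, 0}} (j : ℕ) (X : Psh C) :
    DTy K j X where
  obj _ := K.code j ℕ (mk_nat_lt K j)
  res _ _ _ _ n := n
  res_id _ _ _ := rfl
  res_comp _ _ _ _ _ _ _ _ _ := rfl

/-- The element of the coded set of natural numbers which corresponds to `n`. -/
noncomputable def num (K : SetHierarchy) (j n : ℕ) : K.El (K.code j ℕ (mk_nat_lt K j)) :=
  (K.decode (mk_nat_lt K j)).symm n

/-- The natural number which corresponds to an element of the coded set. -/
noncomputable def unnum {j : ℕ} (x : K.El (K.code j ℕ (mk_nat_lt K j))) : ℕ :=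
  K.decode (mk_nat_lt K j) x

theorem num_unnum {j : ℕ} (x : K.El (K.code j ℕ (mk_nat_lt K j))) : num K j (unnum x) = x :=
  Equiv.symm_apply_apply _ _

theorem unnum_num (j n : ℕ) : unnum (num K j n) = n :=
  Equiv.apply_symm_apply _ _

/-- Zero. -/
noncomputable abbrev mZero (K : SetHierarchy) {C : Base.{0, 0}} (j : ℕ) (X : Psh C) :
    Sec (mNat K j X) where
  app _ := num K j 0
  nat _ _ _ _ := rfl

/-- Successor. -/
noncomputable abbrev mSuc {j : ℕ} {X : Psh C} (t : Sec (mNat K j X)) : Sec (mNat K j X) where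
  app γ := num K j (unnum (t.app γ) + 1)
  nat f γ γ' h := by rw [← t.nat f γ γ' h]

/-- Formation and introduction rules of meta-level natural numbers in the presheaf model. -/
noncomputable abbrev mtaNatIntro (K : SetHierarchy) (C : Base.{0, 0}) :
    NatIntro (mtaCwF K C) where
  Nat j X := mNat K j X
  Nat_sub _ _ _ _ := rfl
  zero j X := ⟨mNat K j X, mZero K j X⟩
  tyOf_zero _ _ := rfl
  zero_sub _ _ _ _ := rfl
  suc t h := ⟨mNat K _ _, mSuc (MTm.sec t h)⟩
  tyOf_suc _ _ := rfl
  suc_sub t h σ := by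
    obtain ⟨A, s⟩ := t
    have h₁ : A = mNat K _ _ := h
    subst h₁
    rfl

section Elim

variable {j k : ℕ} {X : Psh C} (P : DTy K k (mExt X (mNat K j X)))
  (z : Sec (P.sub (instSec (mZero K j X)))) (s : Sec (P.sub ((mtaNatIntro K C).sucSub P)))

/-- The `n`-th value of the function defined by recursion. -/
noncomputable def mRec {a : C.Con} (γ : X.obj a) :
    ∀ n : ℕ, K.El (P.obj (⟨γ, num K j n⟩ : (mExt X (mNat K j X)).obj a))
  | 0 => z.app γ
  | n + 1 => P.tr (γ := ⟨γ, num K j (unnum (num K j n) + 1)⟩) (by rw [unnum_num])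
      (s.app (⟨⟨γ, num K j n⟩, mRec γ n⟩ : (mExt (mExt X (mNat K j X)) P).obj a))

theorem mRec_nat {a b : C.Con} (f : C.Sub a b) (γ : X.obj b) (γ' : X.obj a)
    (h : γ' = X.res γ f) (n : ℕ)
    (h' : (⟨γ', num K j n⟩ : (mExt X (mNat K j X)).obj a) =
      (mExt X (mNat K j X)).res ⟨γ, num K j n⟩ f) :
    P.res f ⟨γ, num K j n⟩ ⟨γ', num K j n⟩ h' (mRec P z s γ n) = mRec P z s γ' n := by
  subst h
  induction n with
  | zero => exact z.nat f γ _ rfl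
  | succ n ih =>
    refine (P.res_tr (γ := ⟨γ, num K j (unnum (num K j n) + 1)⟩) f _ (by rw [unnum_num]) h'
      (s.app (⟨⟨γ, num K j n⟩, mRec P z s γ n⟩ : (mExt (mExt X (mNat K j X)) P).obj b))).trans ?_
    refine eq_of_heq (HEq.trans ?_ (P.tr_heq _ _).symm)
    have e : (⟨⟨X.res γ f, num K j n⟩, mRec P z s (X.res γ f) n⟩ :
        (mExt (mExt X (mNat K j X)) P).obj a) =
        (mExt (mExt X (mNat K j X)) P).res ⟨⟨γ, num K j n⟩, mRec P z s γ n⟩ f :=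
      mExt_eq (X := mExt X (mNat K j X)) (A := P) ⟨⟨γ, num K j n⟩, mRec P z s γ n⟩ f
        ⟨X.res γ f, num K j n⟩ rfl _ (ih rfl)
    refine HEq.trans ?_ (heq_of_eq (s.nat f _ _ e))
    refine DTy.res_heq rfl f _ _ rfl ?_ HEq.rfl
    change _ = (⟨X.res γ f, num K j (unnum (num K j n) + 1)⟩ : (mExt X (mNat K j X)).obj a)
    rw [unnum_num]

/-- The function defined by recursion. -/
noncomputable def mElimAt {a : C.Con} (γ : X.obj a) (x : K.El (K.code j ℕ (mk_nat_lt K j))) :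
    K.El (P.obj (⟨γ, x⟩ : (mExt X (mNat K j X)).obj a)) :=
  P.tr (γ := ⟨γ, num K j (unnum x)⟩) (by rw [num_unnum]) (mRec P z s γ (unnum x))

theorem mElimAt_heq {a : C.Con} (γ : X.obj a) (x : K.El (K.code j ℕ (mk_nat_lt K j))) :
    HEq (mElimAt P z s γ x) (mRec P z s γ (unnum x)) :=
  P.tr_heq _ _

theorem mElimAt_num {a : C.Con} (γ : X.obj a) (n : ℕ) :
    mElimAt P z s γ (num K j n) = mRec P z s γ n := by
  unfold mElimAt
  refine eq_of_heq ((P.tr_heq _ _).trans ?_)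
  rw [unnum_num]

/-- Elimination. -/
noncomputable abbrev mElim (t : Sec (mNat K j X)) : Sec (P.sub (instSec t)) where
  app γ := mElimAt P z s γ (t.app γ)
  nat f γ γ' h := by
    have key : ∀ (x x' : K.El (K.code j ℕ (mk_nat_lt K j))) (_ : x = x') h',
        P.res f ⟨γ, x⟩ ⟨γ', x'⟩ h' (mElimAt P z s γ x) = mElimAt P z s γ' x' := by
      intro x x' e h'
      subst e
      obtain ⟨n, rfl⟩ : ∃ n, x = num K j n := ⟨_, (num_unnum x).symm⟩
      rw [mElimAt_num, mElimAt_num]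
      exact mRec_nat P z s f γ γ' h n _
    exact key _ _ (t.nat f γ γ' h) _

end Elim

/-- Meta-level natural numbers in the presheaf model. -/
noncomputable abbrev mtaNat (K : SetHierarchy) (C : Base.{0, 0}) : NatStr (mtaCwF K C) where
  toNatIntro := mtaNatIntro K C
  elim {j k X} P z s t hz hs ht :=
    ⟨P.sub (instSec (MTm.sec t ht)), mElim P (MTm.sec z hz) (MTm.sec s hs) (MTm.sec t ht)⟩
  tyOf_elim _ _ _ _ _ _ _ := rfl
  elim_zero {j k X} P z s hz hs := by
    refine Eq.trans ?_ (MTm.eq_mk z hz).symm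
    refine congrArg (Sigma.mk (P.sub (instSec (mZero K j X)))) (Sec.ext_app fun a γ => ?_)
    exact mElimAt_num _ _ _ _ _
  elim_suc {j k X} P z s t hz hs ht := by
    obtain ⟨A, t⟩ := t
    have h₁ : A = mNat K j _ := ht
    subst h₁
    obtain ⟨S, s⟩ := s
    have h₂ : S = P.sub ((mtaNatIntro K C).sucSub P) := hs
    subst h₂
    refine congrArg (Sigma.mk (P.sub (instSec (mSuc t)))) (Sec.ext_app fun a γ => ?_)
    refine (mElimAt_num P _ s γ _).trans (eq_of_heq ((P.tr_heq _ _).trans ?_))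
    have e : (⟨⟨γ, num K j (unnum (t.app γ))⟩, mRec P (MTm.sec z hz) s γ (unnum (t.app γ))⟩ :
        (mExt (mExt X (mNat K j X)) P).obj a) =
        ⟨⟨γ, t.app γ⟩, mElimAt P (MTm.sec z hz) s γ (t.app γ)⟩ :=
      Sigma.ext (congrArg (fun x => (⟨γ, x⟩ : (mExt X (mNat K j X)).obj a)) (num_unnum _))
        (P.tr_heq _ _).symm
    exact congr_arg_heq (fun x => s.app x) e
  elim_sub {j k X Y} P z s t hz hs ht σ := by
    obtain ⟨A, t⟩ := t
    have h₁ : A = mNat K j _ := ht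
    subst h₁
    obtain ⟨S, s⟩ := s
    have h₂ : S = P.sub ((mtaNatIntro K C).sucSub P) := hs
    subst h₂
    obtain ⟨Z, z⟩ := z
    have h₃ : Z = P.sub (instSec (mZero K j _)) := hz
    subst h₃
    have key : ∀ {a : C.Con} (γ : X.obj a) (n : ℕ), mRec P z s (σ.app γ) n =
        mRec (P.sub ((mtaNatIntro K C).upNat j σ)) (z.sub σ)
          (s.sub ((mtaCwF K C).up ((mtaNatIntro K C).upNat j σ) P)) γ n := by
      intro a γ n
      induction n with
      | zero => rfl
      | succ n ih =>
        refine eq_of_heq ((P.tr_heq _ _).trans (HEq.trans ?_ (DTy.tr_heq _ _ _).symm))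
        rw [ih]
        rfl
    refine congrArg (Sigma.mk ((P.sub (instSec t)).sub σ)) (Sec.ext_app fun a γ => ?_)
    exact eq_of_heq ((mElimAt_heq P z s _ _).trans ((heq_of_eq (key γ _)).trans
      (mElimAt_heq _ _ _ _ _).symm))

end MetaNat

section PresheafModel

variable {K : SetHierarchy} {C : Base.{0, 0}} {F : Fam C}

/-! ### The presheaf model: lifting -/

/-- The set of terms of a given type. -/
abbrev Fib (F : Fam C) {j : ℕ} {a : C.Con} (A : F.Ty j a) : Type := { t : F.Tm j a // F.tyOf t = A }

variable [∀ j a, Countable (F.Tm j a)]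

theorem mk_Fib_lt (K : SetHierarchy) {j : ℕ} {a : C.Con} (A : F.Ty j a) :
    Cardinal.mk (Fib F A) < K.κ j :=
  K.lt_of_countable j _

/-- The lifting of an object-level type `A` over `X`: the displayed presheaf of object-level terms
of type `A γ`, for elements `γ` of `X`. -/
noncomputable abbrev mLift (K : SetHierarchy) {j : ℕ} {X : Psh C} (A : PSub X (tyPsh F j)) :
    DTy K j X where
  obj γ := K.code j (Fib F (A.app γ)) (mk_Fib_lt K _)
  res f γ γ' h t := (K.decode (mk_Fib_lt K (A.app γ'))).symm
    ⟨F.tmSub (K.decode (mk_Fib_lt K (A.app γ)) t).1 f, by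
      rw [F.tyOf_tmSub, (K.decode (mk_Fib_lt K (A.app γ)) t).2, h, nat_ty]⟩
  res_id γ h t := by
    rw [Equiv.symm_apply_eq]
    exact Subtype.ext (F.tmSub_id _)
  res_comp f g γ γ' γ'' h h' h'' t := by
    refine congrArg (K.decode (mk_Fib_lt K (A.app γ''))).symm (Subtype.ext ?_)
    refine Eq.trans ?_ (F.tmSub_comp _ f g).symm
    exact congrArg (fun x : Fib F (A.app γ') => F.tmSub x.1 g) (Equiv.apply_symm_apply _ _)

/-- The section of the lifting which corresponds to an object-level term. -/
noncomputable abbrev mQuote (K : SetHierarchy) {j : ℕ} {X : Psh C} (t : PSub X (tmPsh F j)) :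
    Sec (mLift K ((objCwF F).tyOf t)) where
  app γ := (K.decode (mk_Fib_lt K _)).symm ⟨t.app γ, rfl⟩
  nat f γ γ' h := by
    refine congrArg (K.decode (mk_Fib_lt K _)).symm (Subtype.ext ?_)
    subst h
    refine Eq.trans ?_ (nat_tm t γ f).symm
    exact congrArg (fun x : Fib F (F.tyOf (t.app γ)) => F.tmSub x.1 f) (Equiv.apply_symm_apply _ _)

/-- The object-level term which corresponds to a section of the lifting. -/
noncomputable abbrev mSplice {j : ℕ} {X : Psh C} (A : PSub X (tyPsh F j)) (s : Sec (mLift K A)) :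
    PSub X (tmPsh F j) where
  app γ := (K.decode (mk_Fib_lt K (A.app γ)) (s.app γ)).1
  nat γ f := by
    rw [← s.nat f γ _ rfl]
    exact congrArg Subtype.val (Equiv.apply_symm_apply (K.decode (mk_Fib_lt K _)) _)

theorem mQuote_mSplice {j : ℕ} {X : Psh C} (A : PSub X (tyPsh F j)) (s : Sec (mLift K A)) :
    (⟨_, mQuote K (mSplice A s)⟩ : MTm K j X) = ⟨mLift K A, s⟩ := by
  have h : (objCwF F).tyOf (mSplice A s) = A :=
    PSub.ext_app fun a γ => (K.decode (mk_Fib_lt K (A.app γ)) (s.app γ)).2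
  refine MTm.ext_heq (congrArg (mLift K) h) fun a γ => ?_
  have key : ∀ (B : F.Ty j a) (t : Fib F (A.app γ)) (ht : F.tyOf t.1 = B),
      HEq ((K.decode (mk_Fib_lt K B)).symm ⟨t.1, ht⟩)
        ((K.decode (mk_Fib_lt K (A.app γ))).symm t) := by
    intro B t ht
    obtain rfl : A.app γ = B := t.2.symm.trans ht
    rfl
  refine (key _ _ rfl).trans (heq_of_eq ?_)
  exact Equiv.symm_apply_apply (K.decode (mk_Fib_lt K (A.app γ))) _

/-- The lifting structure of the presheaf model. -/
noncomputable abbrev pshLifting (K : SetHierarchy) (F : Fam C) [∀ j a, Countable (F.Tm j a)] :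
    Lifting (objCwF F) (mtaCwF K C) where
  lift A := mLift K A
  lift_sub _ _ := rfl
  quote t := ⟨mLift K ((objCwF F).tyOf t), mQuote K t⟩
  tyOf_quote _ := rfl
  splice A t h := mSplice A (MTm.sec t h)
  tyOf_splice A t h :=
    PSub.ext_app fun a γ => (K.decode (mk_Fib_lt K (A.app γ)) ((MTm.sec t h).app γ)).2
  splice_quote _ := PSub.ext_app fun _ _ =>
    congrArg Subtype.val (Equiv.apply_symm_apply (K.decode (mk_Fib_lt K _)) _)
  quote_splice A t h := (mQuote_mSplice A (MTm.sec t h)).trans (MTm.eq_mk t h).symm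
  quote_sub _ _ := rfl

/-- The meta-level family structure of the presheaf model. -/
noncomputable abbrev mtaPshFam (K : SetHierarchy) (C : Base.{0, 0}) [Countable C.Con]
    [∀ a b, Countable (C.Sub a b)] : Fam (pshBase C) where
  toCwF := mtaCwF K C
  univ := mtaU K C
  sg := mtaSg K C
  pi := mtaPi K C
  nat := mtaNat K C

/-- The two family structures of the presheaf model. -/
noncomputable def pshFam (K : SetHierarchy) [Countable C.Con] [∀ a b, Countable (C.Sub a b)]
    (F : Fam C) : Level → Fam (pshBase C)
  | .obj => objPshFam F
  | .mta => mtaPshFam K C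

end PresheafModel

/-- The presheaf model of two-level type theory over a (countable) model of the object theory. -/
noncomputable def pshModel (K : SetHierarchy) (M : ObjModel.{0, 0}) [Countable M.base.Con]
    [∀ a b, Countable (M.base.Sub a b)] [∀ j a, Countable (M.objFam.Tm j a)] :
    TwoModel.{1, 0} where
  base := pshBase M.base
  fam := pshFam K M.objFam
  lifting _ := pshLifting K M.objFam

/-! ### Products of models -/

section Products

universe w

/-- The product of a family of bases. -/
abbrev prodBase {ι : Type w} (M : ι → Base.{u, v}) : Base.{max w u, max w v} where
  Con := ∀ m, (M m).Con
  Sub Γ Δ := ∀ m, (M m).Sub (Γ m) (Δ m)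
  id Γ m := (M m).id (Γ m)
  comp σ δ m := (M m).comp (σ m) (δ m)
  id_comp _ := funext fun m => (M m).id_comp _
  comp_id _ := funext fun m => (M m).comp_id _
  assoc _ _ _ := funext fun m => (M m).assoc _ _ _
  emp m := (M m).emp
  eps Γ m := (M m).eps (Γ m)
  eps_uniq _ := funext fun m => (M m).eps_uniq _

/-- The product of a family of family structures. -/
abbrev prodFam {ι : Type w} {M : ι → Base.{u, v}} (F : ∀ m, Fam (M m)) : Fam (prodBase M) where
  Ty j Γ := ∀ m, (F m).Ty j (Γ m)
  Tm j Γ := ∀ m, (F m).Tm j (Γ m)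
  tyOf t m := (F m).tyOf (t m)
  tySub A σ m := (F m).tySub (A m) (σ m)
  tmSub t σ m := (F m).tmSub (t m) (σ m)
  tyOf_tmSub _ _ := funext fun m => (F m).tyOf_tmSub _ _
  tySub_id _ := funext fun m => (F m).tySub_id _
  tySub_comp _ _ _ := funext fun m => (F m).tySub_comp _ _ _
  tmSub_id _ := funext fun m => (F m).tmSub_id _
  tmSub_comp _ _ _ := funext fun m => (F m).tmSub_comp _ _ _
  ext Γ A m := (F m).ext (Γ m) (A m)
  p A m := (F m).p (A m)
  q A m := (F m).q (A m)
  tyOf_q _ := funext fun m => (F m).tyOf_q _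
  pair σ A t h m := (F m).pair (σ m) (A m) (t m) (congrFun h m)
  p_pair _ _ _ _ := funext fun m => (F m).p_pair _ _ _ _
  q_pair _ _ _ _ := funext fun m => (F m).q_pair _ _ _ _
  pair_eta _ _ := funext fun m => (F m).pair_eta _ _
  univ :=
    { U := fun j Γ m => (F m).univ.U j (Γ m)
      U_sub := fun _ _ _ _ => funext fun m => (F m).univ.U_sub _ _
      El := fun a h m => (F m).univ.El (a m) (congrFun h m)
      code := fun A m => (F m).univ.code (A m)
      tyOf_code := fun _ => funext fun m => (F m).univ.tyOf_code _
      El_code := fun _ => funext fun m => (F m).univ.El_code _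
      code_El := fun _ _ => funext fun m => (F m).univ.code_El _ _
      code_sub := fun _ _ => funext fun m => (F m).univ.code_sub _ _ }
  sg :=
    { Sg := fun A B m => (F m).sg.Sg (A m) (B m)
      Sg_sub := fun _ _ _ => funext fun m => (F m).sg.Sg_sub _ _ _
      tup := fun A B t w ht hw m =>
        (F m).sg.tup (A m) (B m) (t m) (w m) (congrFun ht m) (congrFun hw m)
      fst := fun A B t h m => (F m).sg.fst (A m) (B m) (t m) (congrFun h m)
      snd := fun A B t h m => (F m).sg.snd (A m) (B m) (t m) (congrFun h m)
      tyOf_tup := fun _ _ _ _ _ _ => funext fun m => (F m).sg.tyOf_tup _ _ _ _ _ _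
      tyOf_fst := fun _ _ _ _ => funext fun m => (F m).sg.tyOf_fst _ _ _ _
      tyOf_snd := fun _ _ _ _ => funext fun m => (F m).sg.tyOf_snd _ _ _ _
      fst_tup := fun _ _ _ _ _ _ => funext fun m => (F m).sg.fst_tup _ _ _ _ _ _
      snd_tup := fun _ _ _ _ _ _ => funext fun m => (F m).sg.snd_tup _ _ _ _ _ _
      tup_eta := fun _ _ _ _ => funext fun m => (F m).sg.tup_eta _ _ _ _
      tup_sub := fun _ _ _ _ _ _ _ => funext fun m => (F m).sg.tup_sub _ _ _ _ _ _ _ }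
  pi :=
    { Pi := fun A B m => (F m).pi.Pi (A m) (B m)
      Pi_sub := fun _ _ _ => funext fun m => (F m).pi.Pi_sub _ _ _
      lam := fun A t m => (F m).pi.lam (A m) (t m)
      app := fun A B t h m => (F m).pi.app (A m) (B m) (t m) (congrFun h m)
      tyOf_lam := fun _ _ => funext fun m => (F m).pi.tyOf_lam _ _
      tyOf_app := fun _ _ _ _ => funext fun m => (F m).pi.tyOf_app _ _ _ _
      app_lam := fun _ _ => funext fun m => (F m).pi.app_lam _ _
      lam_app := fun _ _ _ _ => funext fun m => (F m).pi.lam_app _ _ _ _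
      lam_sub := fun _ _ _ => funext fun m => (F m).pi.lam_sub _ _ _ }
  nat :=
    { Nat := fun j Γ m => (F m).nat.Nat j (Γ m)
      Nat_sub := fun _ _ _ _ => funext fun m => (F m).nat.Nat_sub _ _
      zero := fun j Γ m => (F m).nat.zero j (Γ m)
      tyOf_zero := fun _ _ => funext fun m => (F m).nat.tyOf_zero _ _
      zero_sub := fun _ _ _ _ => funext fun m => (F m).nat.zero_sub _ _
      suc := fun t h m => (F m).nat.suc (t m) (congrFun h m)
      tyOf_suc := fun _ _ => funext fun m => (F m).nat.tyOf_suc _ _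
      suc_sub := fun _ _ _ => funext fun m => (F m).nat.suc_sub _ _ _
      elim := fun P z s t hz hs ht m => (F m).nat.elim (P m) (z m) (s m) (t m) (congrFun hz m)
        (congrFun hs m) (congrFun ht m)
      tyOf_elim := fun _ _ _ _ _ _ _ => funext fun m => (F m).nat.tyOf_elim _ _ _ _ _ _ _
      elim_zero := fun _ _ _ _ _ => funext fun m => (F m).nat.elim_zero _ _ _ _ _
      elim_suc := fun _ _ _ _ _ _ _ => funext fun m => (F m).nat.elim_suc _ _ _ _ _ _ _
      elim_sub := fun _ _ _ _ _ _ _ _ => funext fun m => (F m).nat.elim_sub _ _ _ _ _ _ _ _ }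

/-- The product of a family of models. -/
abbrev prodModel {S : Stages} {ι : Type w} (M : ι → Model.{u, v} S) :
    Model.{max w u, max w v} S where
  base := prodBase fun m => (M m).base
  fam i := prodFam fun m => (M m).fam i
  lifting l :=
    { lift := fun A m => ((M m).lifting l).lift (A m)
      lift_sub := fun _ _ => funext fun m => ((M m).lifting l).lift_sub _ _
      quote := fun t m => ((M m).lifting l).quote (t m)
      tyOf_quote := fun _ => funext fun m => ((M m).lifting l).tyOf_quote _
      splice := fun A t h m => ((M m).lifting l).splice (A m) (t m) (congrFun h m)
      tyOf_splice := fun _ _ _ => funext fun m => ((M m).lifting l).tyOf_splice _ _ _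
      splice_quote := fun _ => funext fun m => ((M m).lifting l).splice_quote _
      quote_splice := fun _ _ _ => funext fun m => ((M m).lifting l).quote_splice _ _ _
      quote_sub := fun _ _ => funext fun m => ((M m).lifting l).quote_sub _ _ }

end Products

/-! ### Syntax: raw expressions -/

/-- Fully annotated raw expressions for the operations of models: every operation records its
stage, levels, and all of its context and type arguments. -/
inductive Raw (St Li : Type) where
  | emp
  | ext (i : St) (j : ℕ) (Γ A : Raw St Li)
  | id (Γ : Raw St Li)
  | comp (Γ Δ Θ σ δ : Raw St Li)
  | eps (Γ : Raw St Li)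
  | p (i : St) (j : ℕ) (Γ A : Raw St Li)
  | pair (i : St) (j : ℕ) (Γ Δ σ A t : Raw St Li)
  | tyOf (i : St) (j : ℕ) (Γ t : Raw St Li)
  | tySub (i : St) (j : ℕ) (Γ Δ A σ : Raw St Li)
  | tmSub (i : St) (j : ℕ) (Γ Δ t σ : Raw St Li)
  | q (i : St) (j : ℕ) (Γ A : Raw St Li)
  | U (i : St) (j : ℕ) (Γ : Raw St Li)
  | El (i : St) (j : ℕ) (Γ a : Raw St Li)
  | code (i : St) (j : ℕ) (Γ A : Raw St Li)
  | Sg (i : St) (j : ℕ) (Γ A B : Raw St Li)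
  | tup (i : St) (j : ℕ) (Γ A B t w : Raw St Li)
  | fst (i : St) (j : ℕ) (Γ A B t : Raw St Li)
  | snd (i : St) (j : ℕ) (Γ A B t : Raw St Li)
  | Pi (i : St) (j : ℕ) (Γ A B : Raw St Li)
  | lam (i : St) (j : ℕ) (Γ A t : Raw St Li)
  | app (i : St) (j : ℕ) (Γ A B t : Raw St Li)
  | Nat (i : St) (j : ℕ) (Γ : Raw St Li)
  | zero (i : St) (j : ℕ) (Γ : Raw St Li)
  | suc (i : St) (j : ℕ) (Γ t : Raw St Li)
  | elim (i : St) (j k : ℕ) (Γ P z s t : Raw St Li)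
  | lift (l : Li) (j : ℕ) (Γ A : Raw St Li)
  | quote (l : Li) (j : ℕ) (Γ t : Raw St Li)
  | splice (l : Li) (j : ℕ) (Γ A t : Raw St Li)
  deriving Countable

/-! ### Denotation of raw expressions -/

/-- The elements of all sorts of a model. -/
inductive Val {S : Stages} (N : Model.{u, v} S) : Type (max u v)
  | con (Γ : N.base.Con)
  | sub (Γ Δ : N.base.Con) (σ : N.base.Sub Γ Δ)
  | ty (i : S.Stage) (j : ℕ) (Γ : N.base.Con) (A : (N.fam i).Ty j Γ)
  | tm (i : S.Stage) (j : ℕ) (Γ : N.base.Con) (t : (N.fam i).Tm j Γ)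

/-- `Den N r v` says that the raw expression `r` is well-formed in `N` and denotes `v`. -/
inductive Den {S : Stages} (N : Model.{u, v} S) : Raw S.Stage S.Lift → Val N → Prop
  | emp : Den N .emp (.con N.base.emp)
  | ext {i j g a Γ A} : Den N g (.con Γ) → Den N a (.ty i j Γ A) →
      Den N (.ext i j g a) (.con ((N.fam i).ext Γ A))
  | id {g Γ} : Den N g (.con Γ) → Den N (.id g) (.sub Γ Γ (N.base.id Γ))
  | comp {g d e s r Γ Δ Θ σ δ} : Den N g (.con Γ) → Den N d (.con Δ) → Den N e (.con Θ) →
      Den N s (.sub Δ Θ σ) → Den N r (.sub Γ Δ δ) →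
      Den N (.comp g d e s r) (.sub Γ Θ (N.base.comp σ δ))
  | eps {g Γ} : Den N g (.con Γ) → Den N (.eps g) (.sub Γ N.base.emp (N.base.eps Γ))
  | p {i j g a Γ A} : Den N g (.con Γ) → Den N a (.ty i j Γ A) →
      Den N (.p i j g a) (.sub ((N.fam i).ext Γ A) Γ ((N.fam i).p A))
  | pair {i j g d s a x Γ Δ σ A t} (h : (N.fam i).tyOf t = (N.fam i).tySub A σ) :
      Den N g (.con Γ) → Den N d (.con Δ) → Den N s (.sub Γ Δ σ) → Den N a (.ty i j Δ A) →
      Den N x (.tm i j Γ t) →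
      Den N (.pair i j g d s a x) (.sub Γ ((N.fam i).ext Δ A) ((N.fam i).pair σ A t h))
  | tyOf {i j g x Γ t} : Den N g (.con Γ) → Den N x (.tm i j Γ t) →
      Den N (.tyOf i j g x) (.ty i j Γ ((N.fam i).tyOf t))
  | tySub {i j g d a s Γ Δ A σ} : Den N g (.con Γ) → Den N d (.con Δ) →
      Den N a (.ty i j Δ A) → Den N s (.sub Γ Δ σ) →
      Den N (.tySub i j g d a s) (.ty i j Γ ((N.fam i).tySub A σ))
  | tmSub {i j g d x s Γ Δ t σ} : Den N g (.con Γ) → Den N d (.con Δ) →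
      Den N x (.tm i j Δ t) → Den N s (.sub Γ Δ σ) →
      Den N (.tmSub i j g d x s) (.tm i j Γ ((N.fam i).tmSub t σ))
  | q {i j g a Γ A} : Den N g (.con Γ) → Den N a (.ty i j Γ A) →
      Den N (.q i j g a) (.tm i j ((N.fam i).ext Γ A) ((N.fam i).q A))
  | U {i j g Γ} : Den N g (.con Γ) → Den N (.U i j g) (.ty i (j + 1) Γ ((N.fam i).univ.U j Γ))
  | El {i j g x Γ t} (h : (N.fam i).tyOf t = (N.fam i).univ.U j Γ) : Den N g (.con Γ) →
      Den N x (.tm i (j + 1) Γ t) → Den N (.El i j g x) (.ty i j Γ ((N.fam i).univ.El t h))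
  | code {i j g a Γ A} : Den N g (.con Γ) → Den N a (.ty i j Γ A) →
      Den N (.code i j g a) (.tm i (j + 1) Γ ((N.fam i).univ.code A))
  | Sg {i j g a b Γ A B} : Den N g (.con Γ) → Den N a (.ty i j Γ A) →
      Den N b (.ty i j ((N.fam i).ext Γ A) B) →
      Den N (.Sg i j g a b) (.ty i j Γ ((N.fam i).sg.Sg A B))
  | tup {i j g a b x y Γ A B t w} (ht : (N.fam i).tyOf t = A)
      (hw : (N.fam i).tyOf w = (N.fam i).tySub B ((N.fam i).inst A t ht)) : Den N g (.con Γ) →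
      Den N a (.ty i j Γ A) → Den N b (.ty i j ((N.fam i).ext Γ A) B) → Den N x (.tm i j Γ t) →
      Den N y (.tm i j Γ w) →
      Den N (.tup i j g a b x y) (.tm i j Γ ((N.fam i).sg.tup A B t w ht hw))
  | fst {i j g a b x Γ A B t} (h : (N.fam i).tyOf t = (N.fam i).sg.Sg A B) : Den N g (.con Γ) →
      Den N a (.ty i j Γ A) → Den N b (.ty i j ((N.fam i).ext Γ A) B) → Den N x (.tm i j Γ t) →
      Den N (.fst i j g a b x) (.tm i j Γ ((N.fam i).sg.fst A B t h))
  | snd {i j g a b x Γ A B t} (h : (N.fam i).tyOf t = (N.fam i).sg.Sg A B) : Den N g (.con Γ) →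
      Den N a (.ty i j Γ A) → Den N b (.ty i j ((N.fam i).ext Γ A) B) → Den N x (.tm i j Γ t) →
      Den N (.snd i j g a b x) (.tm i j Γ ((N.fam i).sg.snd A B t h))
  | Pi {i j g a b Γ A B} : Den N g (.con Γ) → Den N a (.ty i j Γ A) →
      Den N b (.ty i j ((N.fam i).ext Γ A) B) →
      Den N (.Pi i j g a b) (.ty i j Γ ((N.fam i).pi.Pi A B))
  | lam {i j g a x Γ A t} : Den N g (.con Γ) → Den N a (.ty i j Γ A) →
      Den N x (.tm i j ((N.fam i).ext Γ A) t) →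
      Den N (.lam i j g a x) (.tm i j Γ ((N.fam i).pi.lam A t))
  | app {i j g a b x Γ A B t} (h : (N.fam i).tyOf t = (N.fam i).pi.Pi A B) : Den N g (.con Γ) →
      Den N a (.ty i j Γ A) → Den N b (.ty i j ((N.fam i).ext Γ A) B) → Den N x (.tm i j Γ t) →
      Den N (.app i j g a b x) (.tm i j ((N.fam i).ext Γ A) ((N.fam i).pi.app A B t h))
  | Nat {i j g Γ} : Den N g (.con Γ) → Den N (.Nat i j g) (.ty i j Γ ((N.fam i).nat.Nat j Γ))
  | zero {i j g Γ} : Den N g (.con Γ) →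
      Den N (.zero i j g) (.tm i j Γ ((N.fam i).nat.zero j Γ))
  | suc {i j g x Γ t} (h : (N.fam i).tyOf t = (N.fam i).nat.Nat j Γ) : Den N g (.con Γ) →
      Den N x (.tm i j Γ t) → Den N (.suc i j g x) (.tm i j Γ ((N.fam i).nat.suc t h))
  | elim {i j k g p x y m Γ P z s t}
      (hz : (N.fam i).tyOf z = (N.fam i).tySub P ((N.fam i).inst ((N.fam i).nat.Nat j Γ)
        ((N.fam i).nat.zero j Γ) ((N.fam i).nat.tyOf_zero j Γ)))
      (hs : (N.fam i).tyOf s = (N.fam i).tySub P ((N.fam i).nat.sucSub P))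
      (ht : (N.fam i).tyOf t = (N.fam i).nat.Nat j Γ) : Den N g (.con Γ) →
      Den N p (.ty i k ((N.fam i).ext Γ ((N.fam i).nat.Nat j Γ)) P) → Den N x (.tm i k Γ z) →
      Den N y (.tm i k ((N.fam i).ext ((N.fam i).ext Γ ((N.fam i).nat.Nat j Γ)) P) s) →
      Den N m (.tm i j Γ t) →
      Den N (.elim i j k g p x y m) (.tm i k Γ ((N.fam i).nat.elim P z s t hz hs ht))
  | lift {l j g a Γ A} : Den N g (.con Γ) → Den N a (.ty (S.src l) j Γ A) →
      Den N (.lift l j g a) (.ty (S.tgt l) j Γ ((N.lifting l).lift A))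
  | quote {l j g x Γ t} : Den N g (.con Γ) → Den N x (.tm (S.src l) j Γ t) →
      Den N (.quote l j g x) (.tm (S.tgt l) j Γ ((N.lifting l).quote t))
  | splice {l j g a x Γ A t} (h : (N.fam (S.tgt l)).tyOf t = (N.lifting l).lift A) :
      Den N g (.con Γ) → Den N a (.ty (S.src l) j Γ A) → Den N x (.tm (S.tgt l) j Γ t) →
      Den N (.splice l j g a x) (.tm (S.src l) j Γ ((N.lifting l).splice A t h))

theorem Den.unique {S : Stages} {N : Model.{u, v} S} {r : Raw S.Stage S.Lift} {v w : Val N}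
    (h : Den N r v) (h' : Den N r w) : v = w := by
  induction h generalizing w with
  | emp => cases h'; rfl
  | ext _ _ ih₁ ih₂ => cases h' with | ext h₁ h₂ => cases ih₁ h₁; cases ih₂ h₂; rfl
  | id _ ih₁ => cases h' with | id h₁ => cases ih₁ h₁; rfl
  | comp _ _ _ _ _ ih₁ ih₂ ih₃ ih₄ ih₅ => cases h' with | comp h₁ h₂ h₃ h₄ h₅ =>
    cases ih₁ h₁; cases ih₂ h₂; cases ih₃ h₃; cases ih₄ h₄; cases ih₅ h₅; rfl
  | eps _ ih₁ => cases h' with | eps h₁ => cases ih₁ h₁; rfl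
  | p _ _ ih₁ ih₂ => cases h' with | p h₁ h₂ => cases ih₁ h₁; cases ih₂ h₂; rfl
  | pair _ _ _ _ _ _ ih₁ ih₂ ih₃ ih₄ ih₅ => cases h' with | pair _ h₁ h₂ h₃ h₄ h₅ =>
    cases ih₁ h₁; cases ih₂ h₂; cases ih₃ h₃; cases ih₄ h₄; cases ih₅ h₅; rfl
  | tyOf _ _ ih₁ ih₂ => cases h' with | tyOf h₁ h₂ => cases ih₁ h₁; cases ih₂ h₂; rfl
  | tySub _ _ _ _ ih₁ ih₂ ih₃ ih₄ => cases h' with | tySub h₁ h₂ h₃ h₄ =>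
    cases ih₁ h₁; cases ih₂ h₂; cases ih₃ h₃; cases ih₄ h₄; rfl
  | tmSub _ _ _ _ ih₁ ih₂ ih₃ ih₄ => cases h' with | tmSub h₁ h₂ h₃ h₄ =>
    cases ih₁ h₁; cases ih₂ h₂; cases ih₃ h₃; cases ih₄ h₄; rfl
  | q _ _ ih₁ ih₂ => cases h' with | q h₁ h₂ => cases ih₁ h₁; cases ih₂ h₂; rfl
  | U _ ih₁ => cases h' with | U h₁ => cases ih₁ h₁; rfl
  | El _ _ _ ih₁ ih₂ => cases h' with | El _ h₁ h₂ => cases ih₁ h₁; cases ih₂ h₂; rfl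
  | code _ _ ih₁ ih₂ => cases h' with | code h₁ h₂ => cases ih₁ h₁; cases ih₂ h₂; rfl
  | Sg _ _ _ ih₁ ih₂ ih₃ => cases h' with | Sg h₁ h₂ h₃ =>
    cases ih₁ h₁; cases ih₂ h₂; cases ih₃ h₃; rfl
  | tup _ _ _ _ _ _ _ ih₁ ih₂ ih₃ ih₄ ih₅ => cases h' with | tup _ _ h₁ h₂ h₃ h₄ h₅ =>
    cases ih₁ h₁; cases ih₂ h₂; cases ih₃ h₃; cases ih₄ h₄; cases ih₅ h₅; rfl
  | fst _ _ _ _ _ ih₁ ih₂ ih₃ ih₄ => cases h' with | fst _ h₁ h₂ h₃ h₄ =>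
    cases ih₁ h₁; cases ih₂ h₂; cases ih₃ h₃; cases ih₄ h₄; rfl
  | snd _ _ _ _ _ ih₁ ih₂ ih₃ ih₄ => cases h' with | snd _ h₁ h₂ h₃ h₄ =>
    cases ih₁ h₁; cases ih₂ h₂; cases ih₃ h₃; cases ih₄ h₄; rfl
  | Pi _ _ _ ih₁ ih₂ ih₃ => cases h' with | Pi h₁ h₂ h₃ =>
    cases ih₁ h₁; cases ih₂ h₂; cases ih₃ h₃; rfl
  | lam _ _ _ ih₁ ih₂ ih₃ => cases h' with | lam h₁ h₂ h₃ =>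
    cases ih₁ h₁; cases ih₂ h₂; cases ih₃ h₃; rfl
  | app _ _ _ _ _ ih₁ ih₂ ih₃ ih₄ => cases h' with | app _ h₁ h₂ h₃ h₄ =>
    cases ih₁ h₁; cases ih₂ h₂; cases ih₃ h₃; cases ih₄ h₄; rfl
  | Nat _ ih₁ => cases h' with | Nat h₁ => cases ih₁ h₁; rfl
  | zero _ ih₁ => cases h' with | zero h₁ => cases ih₁ h₁; rfl
  | suc _ _ _ ih₁ ih₂ => cases h' with | suc _ h₁ h₂ => cases ih₁ h₁; cases ih₂ h₂; rfl
  | elim _ _ _ _ _ _ _ _ ih₁ ih₂ ih₃ ih₄ ih₅ => cases h' with | elim _ _ _ h₁ h₂ h₃ h₄ h₅ =>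
    cases ih₁ h₁; cases ih₂ h₂; cases ih₃ h₃; cases ih₄ h₄; cases ih₅ h₅; rfl
  | lift _ _ ih₁ ih₂ => cases h' with | lift h₁ h₂ => cases ih₁ h₁; cases ih₂ h₂; rfl
  | quote _ _ ih₁ ih₂ => cases h' with | quote h₁ h₂ => cases ih₁ h₁; cases ih₂ h₂; rfl
  | splice _ _ _ _ ih₁ ih₂ ih₃ => cases h' with | splice _ h₁ h₂ h₃ =>
    cases ih₁ h₁; cases ih₂ h₂; cases ih₃ h₃; rfl

section Generated

/-! ### The submodel generated by raw expressions -/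

variable {S : Stages} {N : Model.{u, v} S}

/-- The elements that are denoted by a raw expression. -/
def Gen (v : Val N) : Prop := ∃ r, Den N r v

theorem sub_inj (Γ Δ : N.base.Con) : Function.Injective (Val.sub (N := N) Γ Δ) := by
  intro x y h; cases h; rfl

theorem ty_inj (i : S.Stage) (j : ℕ) (Γ : N.base.Con) :
    Function.Injective (Val.ty (N := N) i j Γ) := by
  intro x y h; cases h; rfl

theorem tm_inj (i : S.Stage) (j : ℕ) (Γ : N.base.Con) :
    Function.Injective (Val.tm (N := N) i j Γ) := by
  intro x y h; cases h; rfl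

variable [Countable S.Stage] [Countable S.Lift] {X : Type u₁}

theorem countable_gen (f : X → Val N) (hf : Function.Injective f) :
    Countable { x : X // Gen (f x) } :=
  Function.Injective.countable (f := fun x : { x : X // Gen (f x) } => x.2.choose) fun x y e =>
    Subtype.ext (hf (x.2.choose_spec.unique (by
      have e' : x.2.choose = y.2.choose := e
      rw [e']; exact y.2.choose_spec)))

/-- The set of the `x` for which `f x` is denoted by a raw expression. There are only countably
many raw expressions, so this set has a copy in the lowest universe. -/
def Sm (f : X → Val N) (hf : Function.Injective f) : Type :=
  haveI := countable_gen f hf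
  Shrink.{0} { x : X // Gen (f x) }

namespace Sm

variable {f : X → Val N} {hf : Function.Injective f}

/-- The underlying element. -/
noncomputable def val (x : Sm f hf) : X :=
  haveI := countable_gen f hf
  ((equivShrink.{0} { x : X // Gen (f x) }).symm x).1

theorem gen (x : Sm f hf) : Gen (f x.val) :=
  haveI := countable_gen f hf
  ((equivShrink.{0} { x : X // Gen (f x) }).symm x).2

/-- The element of the copy with a given underlying element. -/
noncomputable def mk (x : X) (h : Gen (f x)) : Sm f hf :=
  haveI := countable_gen f hf
  equivShrink.{0} { x : X // Gen (f x) } ⟨x, h⟩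

@[simp]
theorem val_mk (x : X) (h : Gen (f x)) : (mk x h : Sm f hf).val = x :=
  haveI := countable_gen f hf
  congrArg Subtype.val ((equivShrink.{0} { x : X // Gen (f x) }).symm_apply_apply ⟨x, h⟩)

theorem ext_val {x y : Sm f hf} (h : x.val = y.val) : x = y :=
  haveI := countable_gen f hf
  (equivShrink.{0} { x : X // Gen (f x) }).symm.injective (Subtype.ext h)

instance : Countable (Sm f hf) :=
  haveI := countable_gen f hf
  (equivShrink.{0} { x : X // Gen (f x) }).symm.injective.countable

attribute [irreducible] Sm val mk

end Sm

/-- Generated substitutions. -/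
abbrev SSub (Γ Δ : N.base.Con) : Type := Sm _ (sub_inj Γ Δ)

/-- Generated types. -/
abbrev STy (i : S.Stage) (j : ℕ) (Γ : N.base.Con) : Type := Sm _ (ty_inj i j Γ)

/-- Generated terms. -/
abbrev STm (i : S.Stage) (j : ℕ) (Γ : N.base.Con) : Type := Sm _ (tm_inj i j Γ)

/-- Generated contexts of length `n`: sequences of generated types, each over the context given by
the preceding ones. The second component is the context of `N` given by such a sequence. -/
@[reducible]
noncomputable def tele (N : Model.{u, v} S) : ℕ → Σ T : Type, T → N.base.Con
  | 0 => ⟨Unit, fun _ => N.base.emp⟩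
  | n + 1 => ⟨Σ Γ : (tele N n).1, Σ i : S.Stage, Σ j : ℕ, STy i j ((tele N n).2 Γ),
      fun x => (N.fam x.2.1).ext ((tele N n).2 x.1) x.2.2.2.val⟩

/-- Generated contexts. -/
abbrev SCon (N : Model.{u, v} S) : Type := Σ n, (tele N n).1

/-- The underlying context. -/
noncomputable abbrev SCon.val (Γ : SCon N) : N.base.Con := (tele N Γ.1).2 Γ.2

/-- The empty context. -/
abbrev SCon.emp (N : Model.{u, v} S) : SCon N := ⟨0, ()⟩

/-- Context extension. -/
abbrev SCon.ext {i : S.Stage} {j : ℕ} (Γ : SCon N) (A : STy i j Γ.val) : SCon N :=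
  ⟨Γ.1 + 1, Γ.2, i, j, A⟩

theorem SCon.ind {motive : SCon N → Prop} (emp : motive (SCon.emp N))
    (ext : ∀ (i : S.Stage) (j : ℕ) (Γ : SCon N) (A : STy i j Γ.val), motive Γ →
      motive (SCon.ext Γ A)) (Γ : SCon N) : motive Γ := by
  obtain ⟨n, Γ⟩ := Γ
  induction n with
  | zero => exact emp
  | succ n ih => exact ext Γ.2.1 Γ.2.2.1 ⟨n, Γ.1⟩ Γ.2.2.2 (ih Γ.1)

theorem SCon.gen (Γ : SCon N) : Gen (.con Γ.val) := by
  induction Γ using SCon.ind with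
  | emp => exact ⟨_, .emp⟩
  | ext i j Γ A ih =>
    obtain ⟨g, hg⟩ := ih
    obtain ⟨a, ha⟩ := A.gen
    exact ⟨_, .ext hg ha⟩

instance (N : Model.{u, v} S) : Countable (SCon N) := by
  have h : ∀ n, Countable (tele N n).1 := by
    intro n
    induction n with
    | zero => exact (inferInstance : Countable Unit)
    | succ n ih =>
      exact (inferInstance : Countable (Σ Γ : (tele N n).1, Σ i : S.Stage, Σ j : ℕ,
        STy i j ((tele N n).2 Γ)))
  infer_instance

end Generated

/-! ### Elimination over a type equal to the type of natural numbers -/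

namespace Fam

variable {C : Base.{u, v}} (F : Fam C) {j k : ℕ} {Γ Δ : C.Con} (σ : C.Sub Γ Δ)

/-- `sucSub`, over a type equal to the type of natural numbers. -/
def sucSubTo (N : F.Ty j Γ) (hN : N = F.nat.Nat j Γ) (P : F.Ty k (F.ext Γ N)) :
    C.Sub (F.ext (F.ext Γ N) P) (F.ext Γ N) :=
  F.pair (C.comp (F.p N) (F.p P)) N
    (F.nat.suc (F.tmSub (F.q N) (F.p P)) (by
      subst hN
      rw [F.tyOf_tmSub, F.tyOf_q, F.nat.Nat_sub, F.nat.Nat_sub]))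
    (by
      subst hN
      rw [F.nat.tyOf_suc, F.nat.Nat_sub])

/-- Elimination, over a type equal to the type of natural numbers. -/
def elimTo (N : F.Ty j Γ) (hN : N = F.nat.Nat j Γ) (P : F.Ty k (F.ext Γ N)) (z : F.Tm k Γ)
    (s : F.Tm k (F.ext (F.ext Γ N) P)) (t : F.Tm j Γ)
    (hz : F.tyOf z = F.tySub P (F.inst N (F.nat.zero j Γ) ((F.nat.tyOf_zero j Γ).trans hN.symm)))
    (hs : F.tyOf s = F.tySub P (F.sucSubTo N hN P)) (ht : F.tyOf t = N) : F.Tm k Γ := by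
  subst hN
  exact F.nat.elim P z s t hz hs ht

theorem tyOf_elimTo (N : F.Ty j Γ) (hN : N = F.nat.Nat j Γ) (P : F.Ty k (F.ext Γ N)) (z : F.Tm k Γ)
    (s : F.Tm k (F.ext (F.ext Γ N) P)) (t : F.Tm j Γ) (hz hs ht) :
    F.tyOf (F.elimTo N hN P z s t hz hs ht) = F.tySub P (F.inst N t ht) := by
  subst hN
  exact F.nat.tyOf_elim P z s t hz hs ht

theorem elimTo_zero (N : F.Ty j Γ) (hN : N = F.nat.Nat j Γ) (P : F.Ty k (F.ext Γ N)) (z : F.Tm k Γ)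
    (s : F.Tm k (F.ext (F.ext Γ N) P)) (t : F.Tm j Γ) (hz hs ht) (e : t = F.nat.zero j Γ) :
    F.elimTo N hN P z s t hz hs ht = z := by
  subst hN e
  exact F.nat.elim_zero P z s hz hs

theorem elimTo_suc (N : F.Ty j Γ) (hN : N = F.nat.Nat j Γ) (P : F.Ty k (F.ext Γ N)) (z : F.Tm k Γ)
    (s : F.Tm k (F.ext (F.ext Γ N) P)) (t : F.Tm j Γ) (hz hs ht) (t' : F.Tm j Γ) (ht' ht'')
    (e : t' = F.nat.suc t ht'') (τ : C.Sub Γ (F.ext (F.ext Γ N) P))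
    (hτ : τ = F.pair (F.inst N t ht) P (F.elimTo N hN P z s t hz hs ht)
      (F.tyOf_elimTo N hN P z s t hz hs ht)) :
    F.elimTo N hN P z s t' hz hs ht' = F.tmSub s τ := by
  subst hN e hτ
  exact F.nat.elim_suc P z s t hz hs ht

theorem elimTo_sub (N : F.Ty j Δ) (hN : N = F.nat.Nat j Δ) (P : F.Ty k (F.ext Δ N)) (z : F.Tm k Δ)
    (s : F.Tm k (F.ext (F.ext Δ N) P)) (t : F.Tm j Δ) (hz hs ht)
    (N' : F.Ty j Γ) (hN' : N' = F.nat.Nat j Γ) (hN'' : N' = F.tySub N σ)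
    (P' : F.Ty k (F.ext Γ N')) (hP : P' = F.tySub P (F.upTo σ N N' hN''))
    (z' : F.Tm k Γ) (s' : F.Tm k (F.ext (F.ext Γ N') P')) (t' : F.Tm j Γ)
    (hz' hs' ht') (ez : z' = F.tmSub z σ)
    (es : s' = F.tmSub s (F.upTo (F.upTo σ N N' hN'') P P' hP)) (et : t' = F.tmSub t σ) :
    F.tmSub (F.elimTo N hN P z s t hz hs ht) σ = F.elimTo N' hN' P' z' s' t' hz' hs' ht' := by
  subst hN hN' hP ez es et
  exact F.nat.elim_sub P z s t hz hs ht σ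

theorem tup_congr (A : F.Ty j Γ) (B : F.Ty j (F.ext Γ A)) {t t' w w' : F.Tm j Γ} (e : t = t')
    (e' : w = w') (ht hw ht' hw') : F.sg.tup A B t w ht hw = F.sg.tup A B t' w' ht' hw' := by
  subst e e'; rfl

end Fam

theorem Lifting.splice_eq {C : Base.{u, v}} {F G : CwF C} (L : Lifting F G) {j : ℕ} {Γ : C.Con}
    (A : F.Ty j Γ) (t : G.Tm j Γ) (h : G.tyOf t = L.lift A) (s : F.Tm j Γ) (hs : A = F.tyOf s)
    (e : t = L.quote s) : L.splice A t h = s := by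
  subst hs e
  exact L.splice_quote s

section SynModel

/-! ### The syntax -/

variable {S : Stages} {N : Model.{u, v} S} {i : S.Stage}

theorem gen_elimTo {j k : ℕ} {Γ : N.base.Con} (T : (N.fam i).Ty j Γ) (hT P z s t hz hs ht)
    (h₁ : Gen (.con Γ)) (h₂ : Gen (.ty i k ((N.fam i).ext Γ T) P)) (h₃ : Gen (.tm i k Γ z))
    (h₄ : Gen (.tm i k ((N.fam i).ext ((N.fam i).ext Γ T) P) s)) (h₅ : Gen (.tm i j Γ t)) :
    Gen (.tm i k Γ ((N.fam i).elimTo T hT P z s t hz hs ht)) := by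
  subst hT
  obtain ⟨g, h₁⟩ := h₁
  obtain ⟨p, h₂⟩ := h₂
  obtain ⟨x, h₃⟩ := h₃
  obtain ⟨y, h₄⟩ := h₄
  obtain ⟨m, h₅⟩ := h₅
  exact ⟨_, .elim hz hs ht h₁ h₂ h₃ h₄ h₅⟩

variable (N) [Countable S.Stage] [Countable S.Lift]

/-- The base of the generated submodel. -/
noncomputable abbrev synBase : Base.{0, 0} where
  Con := SCon N
  Sub Γ Δ := SSub Γ.val Δ.val
  id Γ := Sm.mk (N.base.id Γ.val) (by
    obtain ⟨g, hg⟩ := Γ.gen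
    exact ⟨_, .id hg⟩)
  comp {Γ Δ Θ} σ δ := Sm.mk (N.base.comp σ.val δ.val) (by
    obtain ⟨g, hg⟩ := Γ.gen
    obtain ⟨d, hd⟩ := Δ.gen
    obtain ⟨e, he⟩ := Θ.gen
    obtain ⟨s, hs⟩ := σ.gen
    obtain ⟨r, hr⟩ := δ.gen
    exact ⟨_, .comp hg hd he hs hr⟩)
  id_comp σ := Sm.ext_val (by simp only [Sm.val_mk, N.base.id_comp])
  comp_id σ := Sm.ext_val (by simp only [Sm.val_mk, N.base.comp_id])
  assoc σ δ ν := Sm.ext_val (by simp only [Sm.val_mk, N.base.assoc])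
  emp := SCon.emp N
  eps Γ := Sm.mk (N.base.eps Γ.val) (by
    obtain ⟨g, hg⟩ := Γ.gen
    exact ⟨_, .eps hg⟩)
  eps_uniq σ := Sm.ext_val (by rw [Sm.val_mk]; exact N.base.eps_uniq σ.val)

variable {N}

theorem val_eq {X : Type u₁} {f : X → Val N} {hf : Function.Injective f} {x : Sm f hf} {y : X}
    {h : Gen (f y)} (e : x = Sm.mk y h) : x.val = y := by
  rw [e, Sm.val_mk]

variable (N)

/-- The families of the generated submodel. -/
noncomputable abbrev synCwF (i : S.Stage) : CwF (synBase N) where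
  Ty j Γ := STy i j Γ.val
  Tm j Γ := STm i j Γ.val
  tyOf {j Γ} t := Sm.mk ((N.fam i).tyOf t.val) (by
    obtain ⟨g, hg⟩ := Γ.gen
    obtain ⟨x, hx⟩ := t.gen
    exact ⟨_, .tyOf hg hx⟩)
  tySub {j Γ Δ} A σ := Sm.mk ((N.fam i).tySub A.val σ.val) (by
    obtain ⟨g, hg⟩ := Γ.gen
    obtain ⟨d, hd⟩ := Δ.gen
    obtain ⟨a, ha⟩ := A.gen
    obtain ⟨s, hs⟩ := σ.gen
    exact ⟨_, .tySub hg hd ha hs⟩)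
  tmSub {j Γ Δ} t σ := Sm.mk ((N.fam i).tmSub t.val σ.val) (by
    obtain ⟨g, hg⟩ := Γ.gen
    obtain ⟨d, hd⟩ := Δ.gen
    obtain ⟨x, hx⟩ := t.gen
    obtain ⟨s, hs⟩ := σ.gen
    exact ⟨_, .tmSub hg hd hx hs⟩)
  tyOf_tmSub t σ := Sm.ext_val (by simp only [Sm.val_mk, (N.fam i).tyOf_tmSub])
  tySub_id A := Sm.ext_val (by simp only [Sm.val_mk, (N.fam i).tySub_id])
  tySub_comp A σ δ := Sm.ext_val (by simp only [Sm.val_mk, (N.fam i).tySub_comp])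
  tmSub_id t := Sm.ext_val (by simp only [Sm.val_mk, (N.fam i).tmSub_id])
  tmSub_comp t σ δ := Sm.ext_val (by simp only [Sm.val_mk, (N.fam i).tmSub_comp])
  ext Γ A := SCon.ext Γ A
  p {j Γ} A := Sm.mk (f := Val.sub (SCon.ext Γ A).val Γ.val) ((N.fam i).p A.val) (by
    obtain ⟨g, hg⟩ := Γ.gen
    obtain ⟨a, ha⟩ := A.gen
    exact ⟨_, .p hg ha⟩)
  q {j Γ} A := Sm.mk (f := Val.tm i j (SCon.ext Γ A).val) ((N.fam i).q A.val) (by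
    obtain ⟨g, hg⟩ := Γ.gen
    obtain ⟨a, ha⟩ := A.gen
    exact ⟨_, .q hg ha⟩)
  tyOf_q A := Sm.ext_val (by
    rw [Sm.val_mk, Sm.val_mk, Sm.val_mk, Sm.val_mk]
    exact (N.fam i).tyOf_q A.val)
  pair {j Γ Δ} σ A t h := Sm.mk (f := Val.sub Γ.val (SCon.ext Δ A).val)
    ((N.fam i).pair σ.val A.val t.val (by
      have e := congrArg Sm.val h
      rwa [Sm.val_mk, Sm.val_mk] at e)) (by
    obtain ⟨g, hg⟩ := Γ.gen
    obtain ⟨d, hd⟩ := Δ.gen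
    obtain ⟨a, ha⟩ := A.gen
    obtain ⟨s, hs⟩ := σ.gen
    obtain ⟨x, hx⟩ := t.gen
    exact ⟨_, .pair _ hg hd hs ha hx⟩)
  p_pair σ A t h := Sm.ext_val (by
    rw [Sm.val_mk, Sm.val_mk, Sm.val_mk]
    exact (N.fam i).p_pair _ _ _ _)
  q_pair σ A t h := Sm.ext_val (by
    rw [Sm.val_mk, Sm.val_mk, Sm.val_mk]
    exact (N.fam i).q_pair _ _ _ _)
  pair_eta A τ := Sm.ext_val (by
    rw [Sm.val_mk]
    refine Eq.trans ?_ ((N.fam i).pair_eta A.val τ.val)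
    apply (N.fam i).pair_congr
    · rw [Sm.val_mk, Sm.val_mk]
    · rw [Sm.val_mk, Sm.val_mk])

variable {N}

theorem val_tyOf_eq {j : ℕ} {Γ : SCon N} {t : STm i j Γ.val} {A : STy i j Γ.val}
    (h : (synCwF N i).tyOf t = A) : (N.fam i).tyOf t.val = A.val := by
  rw [← h, Sm.val_mk]

theorem val_upTo {j : ℕ} {Γ Δ : SCon N} (σ : SSub Γ.val Δ.val) (A : STy i j Δ.val)
    (A' : STy i j Γ.val) (h : A' = (synCwF N i).tySub A σ) :
    Sm.val ((synCwF N i).upTo (Γ := Γ) (Δ := Δ) σ A A' h) =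
      (N.fam i).upTo σ.val A.val A'.val (val_eq h) := by
  unfold CwF.upTo
  rw [Sm.val_mk]
  apply (N.fam i).pair_congr
  · rw [Sm.val_mk, Sm.val_mk]
  · rw [Sm.val_mk]

theorem val_inst {j : ℕ} {Γ : SCon N} (A : STy i j Γ.val) (t : STm i j Γ.val)
    (h : (synCwF N i).tyOf t = A) :
    Sm.val ((synCwF N i).inst (Γ := Γ) A t h) = (N.fam i).inst A.val t.val (val_tyOf_eq h) := by
  unfold CwF.inst
  rw [Sm.val_mk]
  apply (N.fam i).pair_congr
  · rw [Sm.val_mk]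
  · rfl

variable (N i)

/-- Universes of the generated submodel. -/
noncomputable abbrev synU : UStr (synCwF N i) where
  U j Γ := Sm.mk ((N.fam i).univ.U j Γ.val) (by
    obtain ⟨g, hg⟩ := Γ.gen
    exact ⟨_, .U hg⟩)
  U_sub j {Γ Δ} σ := Sm.ext_val (by
    simp only [Sm.val_mk, (N.fam i).univ.U_sub])
  El {j Γ} a h := Sm.mk ((N.fam i).univ.El a.val ((val_tyOf_eq h).trans (Sm.val_mk _ _))) (by
    obtain ⟨g, hg⟩ := Γ.gen
    obtain ⟨x, hx⟩ := a.gen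
    exact ⟨_, .El _ hg hx⟩)
  code {j Γ} A := Sm.mk ((N.fam i).univ.code A.val) (by
    obtain ⟨g, hg⟩ := Γ.gen
    obtain ⟨a, ha⟩ := A.gen
    exact ⟨_, .code hg ha⟩)
  tyOf_code A := Sm.ext_val (by
    simp only [Sm.val_mk, (N.fam i).univ.tyOf_code])
  El_code A := Sm.ext_val (by
    rw [Sm.val_mk]
    exact (N.fam i).El_eq _ _ _ (Sm.val_mk _ _))
  code_El a h := Sm.ext_val (by
    rw [Sm.val_mk, Sm.val_mk]
    exact (N.fam i).univ.code_El _ _)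
  code_sub A σ := Sm.ext_val (by
    simp only [Sm.val_mk, (N.fam i).univ.code_sub])

/-- Function types of the generated submodel. -/
noncomputable abbrev synPi : PiStr (synCwF N i) where
  Pi {j Γ} A B := Sm.mk ((N.fam i).pi.Pi A.val B.val) (by
    obtain ⟨g, hg⟩ := Γ.gen
    obtain ⟨a, ha⟩ := A.gen
    obtain ⟨b, hb⟩ := B.gen
    exact ⟨_, .Pi hg ha hb⟩)
  Pi_sub {j Γ Δ} A B σ := Sm.ext_val (by
    rw [Sm.val_mk, Sm.val_mk, Sm.val_mk]
    refine ((N.fam i).Pi_sub' σ.val A.val _ (Sm.val_mk _ _) B.val).trans (congrArg _ ?_)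
    exact ((Sm.val_mk _ _).trans (congrArg _ (val_upTo σ A _ rfl))).symm)
  lam {j Γ} A t := Sm.mk ((N.fam i).pi.lam A.val t.val) (by
    obtain ⟨g, hg⟩ := Γ.gen
    obtain ⟨a, ha⟩ := A.gen
    obtain ⟨x, hx⟩ := t.gen
    exact ⟨_, .lam hg ha hx⟩)
  app {j Γ} A B t h := Sm.mk (f := Val.tm i j (SCon.ext Γ A).val)
    ((N.fam i).pi.app A.val B.val t.val ((val_tyOf_eq h).trans (Sm.val_mk _ _))) (by
    obtain ⟨g, hg⟩ := Γ.gen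
    obtain ⟨a, ha⟩ := A.gen
    obtain ⟨b, hb⟩ := B.gen
    obtain ⟨x, hx⟩ := t.gen
    exact ⟨_, .app _ hg ha hb hx⟩)
  tyOf_lam A t := Sm.ext_val (by
    rw [Sm.val_mk, Sm.val_mk, Sm.val_mk, Sm.val_mk]
    exact (N.fam i).pi.tyOf_lam _ _)
  tyOf_app A B t h := Sm.ext_val (by
    rw [Sm.val_mk, Sm.val_mk]
    exact (N.fam i).pi.tyOf_app _ _ _ _)
  app_lam A t := Sm.ext_val (by
    rw [Sm.val_mk]
    exact (N.fam i).app_eq _ _ _ _ _ (Sm.val_mk _ _).symm (Sm.val_mk _ _))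
  lam_app A B t h := Sm.ext_val (by
    rw [Sm.val_mk, Sm.val_mk]
    exact (N.fam i).pi.lam_app _ _ _ _)
  lam_sub {j Γ Δ} A t σ := Sm.ext_val (by
    rw [Sm.val_mk, Sm.val_mk, Sm.val_mk]
    refine ((N.fam i).lam_sub' σ.val A.val _ (Sm.val_mk _ _) t.val).trans (congrArg _ ?_)
    exact ((Sm.val_mk _ _).trans (congrArg _ (val_upTo σ A _ rfl))).symm)

/-- `Σ`-types of the generated submodel. -/
noncomputable abbrev synSg : SgStr (synCwF N i) where
  Sg {j Γ} A B := Sm.mk ((N.fam i).sg.Sg A.val B.val) (by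
    obtain ⟨g, hg⟩ := Γ.gen
    obtain ⟨a, ha⟩ := A.gen
    obtain ⟨b, hb⟩ := B.gen
    exact ⟨_, .Sg hg ha hb⟩)
  Sg_sub {j Γ Δ} A B σ := Sm.ext_val (by
    rw [Sm.val_mk, Sm.val_mk, Sm.val_mk]
    refine ((N.fam i).Sg_sub' σ.val A.val _ (Sm.val_mk _ _) B.val).trans (congrArg _ ?_)
    exact ((Sm.val_mk _ _).trans (congrArg _ (val_upTo σ A _ rfl))).symm)
  tup {j Γ} A B t w ht hw := Sm.mk ((N.fam i).sg.tup A.val B.val t.val w.val (val_tyOf_eq ht)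
    ((val_tyOf_eq hw).trans ((Sm.val_mk _ _).trans (congrArg _ (val_inst A t ht))))) (by
    obtain ⟨g, hg⟩ := Γ.gen
    obtain ⟨a, ha⟩ := A.gen
    obtain ⟨b, hb⟩ := B.gen
    obtain ⟨x, hx⟩ := t.gen
    obtain ⟨y, hy⟩ := w.gen
    exact ⟨_, .tup _ _ hg ha hb hx hy⟩)
  fst {j Γ} A B t h := Sm.mk
    ((N.fam i).sg.fst A.val B.val t.val ((val_tyOf_eq h).trans (Sm.val_mk _ _))) (by
    obtain ⟨g, hg⟩ := Γ.gen
    obtain ⟨a, ha⟩ := A.gen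
    obtain ⟨b, hb⟩ := B.gen
    obtain ⟨x, hx⟩ := t.gen
    exact ⟨_, .fst _ hg ha hb hx⟩)
  snd {j Γ} A B t h := Sm.mk
    ((N.fam i).sg.snd A.val B.val t.val ((val_tyOf_eq h).trans (Sm.val_mk _ _))) (by
    obtain ⟨g, hg⟩ := Γ.gen
    obtain ⟨a, ha⟩ := A.gen
    obtain ⟨b, hb⟩ := B.gen
    obtain ⟨x, hx⟩ := t.gen
    exact ⟨_, .snd _ hg ha hb hx⟩)
  tyOf_tup A B t w ht hw := Sm.ext_val (by
    refine ((Sm.val_mk _ _).trans (congrArg _ (Sm.val_mk _ _))).trans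
      (Eq.trans ?_ (Sm.val_mk _ _).symm)
    exact (N.fam i).sg.tyOf_tup _ _ _ _ _ _)
  tyOf_fst A B t h := Sm.ext_val (by
    rw [Sm.val_mk, Sm.val_mk]
    exact (N.fam i).sg.tyOf_fst _ _ _ _)
  tyOf_snd {j Γ} A B t h := Sm.ext_val (by
    refine ((Sm.val_mk _ _).trans (congrArg _ (Sm.val_mk _ _))).trans
      (Eq.trans ?_ (Sm.val_mk _ _).symm)
    refine ((N.fam i).sg.tyOf_snd _ _ _ _).trans (congrArg _ ?_)
    refine Eq.trans ?_ (val_inst A _ _).symm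
    apply (N.fam i).pair_congr
    · rfl
    · exact (Sm.val_mk _ _).symm)
  fst_tup A B t w ht hw := Sm.ext_val (by
    rw [Sm.val_mk]
    exact (N.fam i).fst_eq _ _ _ _ _ _ _ _ (Sm.val_mk _ _))
  snd_tup A B t w ht hw := Sm.ext_val (by
    rw [Sm.val_mk]
    exact (N.fam i).snd_eq _ _ _ _ _ _ _ _ (Sm.val_mk _ _))
  tup_eta A B t h := Sm.ext_val (by
    rw [Sm.val_mk]
    refine Eq.trans ?_ ((N.fam i).sg.tup_eta A.val B.val t.val
      ((val_tyOf_eq h).trans (Sm.val_mk _ _)))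
    exact (N.fam i).tup_congr _ _ (Sm.val_mk _ _) (Sm.val_mk _ _) _ _ _ _)
  tup_sub {j Γ Δ} A B t w ht hw σ := Sm.ext_val (by
    refine ((Sm.val_mk _ _).trans (congrArg (fun x => (N.fam i).tmSub x σ.val)
      (Sm.val_mk _ _))).trans (Eq.trans ?_ (Sm.val_mk _ _).symm)
    refine (N.fam i).tup_sub' σ.val A.val _ (Sm.val_mk _ _) B.val _ _ _ _ _ ?_ _ _ _ _
      (Sm.val_mk _ _) (Sm.val_mk _ _)
    exact (Sm.val_mk _ _).trans (congrArg _ (val_upTo σ A _ rfl)))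

/-- Natural numbers of the generated submodel. -/
noncomputable abbrev synNatIntro : NatIntro (synCwF N i) where
  Nat j Γ := Sm.mk ((N.fam i).nat.Nat j Γ.val) (by
    obtain ⟨g, hg⟩ := Γ.gen
    exact ⟨_, .Nat hg⟩)
  Nat_sub j {Γ Δ} σ := Sm.ext_val (by simp only [Sm.val_mk, (N.fam i).nat.Nat_sub])
  zero j Γ := Sm.mk ((N.fam i).nat.zero j Γ.val) (by
    obtain ⟨g, hg⟩ := Γ.gen
    exact ⟨_, .zero hg⟩)
  tyOf_zero j Γ := Sm.ext_val (by simp only [Sm.val_mk, (N.fam i).nat.tyOf_zero])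
  zero_sub j {Γ Δ} σ := Sm.ext_val (by simp only [Sm.val_mk, (N.fam i).nat.zero_sub])
  suc {j Γ} t h := Sm.mk ((N.fam i).nat.suc t.val ((val_tyOf_eq h).trans (Sm.val_mk _ _))) (by
    obtain ⟨g, hg⟩ := Γ.gen
    obtain ⟨x, hx⟩ := t.gen
    exact ⟨_, .suc _ hg hx⟩)
  tyOf_suc t h := Sm.ext_val (by
    refine ((Sm.val_mk _ _).trans (congrArg _ (Sm.val_mk _ _))).trans
      (Eq.trans ?_ (Sm.val_mk _ _).symm)
    exact (N.fam i).nat.tyOf_suc _ _)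
  suc_sub t h σ := Sm.ext_val (by
    refine ((Sm.val_mk _ _).trans (congrArg (fun x => (N.fam i).tmSub x σ.val)
      (Sm.val_mk _ _))).trans (Eq.trans ?_ (Sm.val_mk _ _).symm)
    exact ((N.fam i).suc_sub' σ.val _ _ _ _ (Sm.val_mk _ _)).symm)

variable {N i}

theorem val_sucSub {j k : ℕ} {Γ : SCon N}
    (P : STy i k (SCon.ext Γ ((synNatIntro N i).Nat j Γ)).val) :
    Sm.val ((synNatIntro N i).sucSub (Γ := Γ) P) =
      (N.fam i).sucSubTo (Sm.val ((synNatIntro N i).Nat j Γ)) (Sm.val_mk _ _) P.val := by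
  unfold NatIntro.sucSub Fam.sucSubTo
  rw [Sm.val_mk]
  apply (N.fam i).pair_congr
  · exact (Sm.val_mk _ _).trans (congr (congrArg _ (Sm.val_mk _ _)) (Sm.val_mk _ _))
  · refine (Sm.val_mk _ _).trans ?_
    congr 1
    exact (Sm.val_mk _ _).trans (congr (congrArg _ (Sm.val_mk _ _)) (Sm.val_mk _ _))

theorem val_elim_hz {j k : ℕ} {Γ : SCon N}
    {P : STy i k (SCon.ext Γ ((synNatIntro N i).Nat j Γ)).val} {z : STm i k Γ.val}
    (hz : (synCwF N i).tyOf z = (synCwF N i).tySub P ((synCwF N i).inst (Γ := Γ)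
      ((synNatIntro N i).Nat j Γ) ((synNatIntro N i).zero j Γ)
      ((synNatIntro N i).tyOf_zero j Γ))) :
    (N.fam i).tyOf z.val = (N.fam i).tySub P.val ((N.fam i).inst _ ((N.fam i).nat.zero j Γ.val)
      (((N.fam i).nat.tyOf_zero j Γ.val).trans (Sm.val_mk _ _).symm)) := by
  rw [val_tyOf_eq hz, Sm.val_mk, val_inst]
  refine congrArg _ ((N.fam i).pair_congr _ _ rfl (Sm.val_mk _ _))

variable (N i)

/-- Natural numbers of the generated submodel, with elimination. -/
noncomputable abbrev synNat : NatStr (synCwF N i) where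
  toNatIntro := synNatIntro N i
  elim {j k Γ} P z s t hz hs ht := Sm.mk ((N.fam i).elimTo
    (Sm.val ((synNatIntro N i).Nat j Γ)) (Sm.val_mk _ _) P.val z.val s.val t.val (val_elim_hz hz)
    ((val_tyOf_eq hs).trans ((Sm.val_mk _ _).trans (congrArg _ (val_sucSub P))))
    (val_tyOf_eq ht)) (gen_elimTo _ _ _ _ _ _ _ _ _ Γ.gen P.gen z.gen s.gen t.gen)
  tyOf_elim {j k Γ} P z s t hz hs ht := Sm.ext_val (by
    refine ((Sm.val_mk _ _).trans (congrArg _ (Sm.val_mk _ _))).trans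
      (Eq.trans ?_ (Sm.val_mk _ _).symm)
    refine ((N.fam i).tyOf_elimTo _ _ _ _ _ _ _ _ _).trans (congrArg _ ?_)
    exact (val_inst _ t ht).symm)
  elim_zero {j k Γ} P z s hz hs := Sm.ext_val (by
    rw [Sm.val_mk]
    exact (N.fam i).elimTo_zero _ _ _ _ _ _ _ _ _ (Sm.val_mk _ _))
  elim_suc {j k Γ} P z s t hz hs ht := Sm.ext_val (by
    refine (Sm.val_mk _ _).trans (Eq.trans ?_ (Sm.val_mk _ _).symm)
    refine (N.fam i).elimTo_suc _ _ _ _ _ t.val _ _ (val_tyOf_eq ht) _ _ _ (Sm.val_mk _ _) _ ?_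
    refine (Sm.val_mk _ _).trans ?_
    exact (N.fam i).pair_congr _ _ (val_inst _ t ht) (Sm.val_mk _ _))
  elim_sub {j k Γ Δ} P z s t hz hs ht σ := Sm.ext_val (by
    refine ((Sm.val_mk _ _).trans (congrArg (fun x => (N.fam i).tmSub x σ.val)
      (Sm.val_mk _ _))).trans (Eq.trans ?_ (Sm.val_mk _ _).symm)
    have e : Sm.val ((synCwF N i).tySub P ((synNatIntro N i).upNat j σ)) =
        (N.fam i).tySub P.val ((N.fam i).upTo σ.val _ _
          (val_eq ((synNatIntro N i).Nat_sub j σ).symm)) :=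
      (Sm.val_mk _ _).trans (congrArg _ (val_upTo σ _ _ _))
    refine (N.fam i).elimTo_sub σ.val _ (Sm.val_mk _ _) _ _ _ _ _ _ _ _ (Sm.val_mk _ _) _ _ e
      _ _ _ _ _ _ (Sm.val_mk _ _) ?_ (Sm.val_mk _ _)
    refine (Sm.val_mk _ _).trans (congrArg _ ?_)
    refine (val_upTo _ P _ rfl).trans ?_
    apply (N.fam i).pair_congr
    · exact congrArg (fun x => N.base.comp x _) (val_upTo σ _ _ _)
    · rfl)

/-- The family structures of the generated submodel. -/
noncomputable abbrev synFam : Fam (synBase N) where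
  toCwF := synCwF N i
  univ := synU N i
  sg := synSg N i
  pi := synPi N i
  nat := synNat N i

/-- The submodel of `N` generated by raw expressions. -/
noncomputable abbrev genModel : Model.{0, 0} S where
  base := synBase N
  fam i := synFam N i
  lifting l :=
    { lift := fun {j Γ} A => Sm.mk ((N.lifting l).lift A.val) (by
        obtain ⟨g, hg⟩ := SCon.gen Γ
        obtain ⟨a, ha⟩ := A.gen
        exact ⟨_, .lift hg ha⟩)
      lift_sub := fun A σ => Sm.ext_val (by simp only [Sm.val_mk, (N.lifting l).lift_sub])
      quote := fun {j Γ} t => Sm.mk ((N.lifting l).quote t.val) (by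
        obtain ⟨g, hg⟩ := SCon.gen Γ
        obtain ⟨x, hx⟩ := t.gen
        exact ⟨_, .quote hg hx⟩)
      tyOf_quote := fun t => Sm.ext_val (by simp only [Sm.val_mk, (N.lifting l).tyOf_quote])
      splice := fun {j Γ} A t h => Sm.mk ((N.lifting l).splice A.val t.val
          ((val_tyOf_eq h).trans (Sm.val_mk _ _))) (by
        obtain ⟨g, hg⟩ := SCon.gen Γ
        obtain ⟨a, ha⟩ := A.gen
        obtain ⟨x, hx⟩ := t.gen
        exact ⟨_, .splice _ hg ha hx⟩)
      tyOf_splice := fun A t h => Sm.ext_val (by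
        rw [Sm.val_mk, Sm.val_mk]
        exact (N.lifting l).tyOf_splice _ _ _)
      splice_quote := fun t => Sm.ext_val (by
        rw [Sm.val_mk]
        exact (N.lifting l).splice_eq _ _ _ _ (Sm.val_mk _ _) (Sm.val_mk _ _))
      quote_splice := fun A t h => Sm.ext_val (by
        rw [Sm.val_mk, Sm.val_mk]
        exact (N.lifting l).quote_splice _ _ _)
      quote_sub := fun t σ => Sm.ext_val (by
        simp only [Sm.val_mk, (N.lifting l).quote_sub]) }

end SynModel

section Syntactic

variable (S : Stages) [Countable S.Stage] [Countable S.Lift]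

/-- The syntax: the submodel of the product of all models that is generated by raw expressions. In
other words, contexts, substitutions, types and terms are the well-formed raw expressions, and two
of them are equal if they have the same value in every model; the syntax is the initial model. -/
noncomputable abbrev Syn : Model.{0, 0} S := genModel (prodModel fun M : Model.{1, 0} S => M)

variable {S}

theorem Fam.elimTo_eq {C : Base.{u, v}} (F : Fam C) {j k : ℕ} {Γ : C.Con} (N : F.Ty j Γ)
    (hN : N = F.nat.Nat j Γ) (P : F.Ty k (F.ext Γ N)) (z : F.Tm k Γ)
    (s : F.Tm k (F.ext (F.ext Γ N) P)) (t : F.Tm j Γ) (hz hs ht)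
    (P' : F.Ty k (F.ext Γ (F.nat.Nat j Γ))) (s' : F.Tm k (F.ext (F.ext Γ (F.nat.Nat j Γ)) P'))
    (hz' hs' ht') (eP : HEq P P') (es : HEq s s') :
    F.elimTo N hN P z s t hz hs ht = F.nat.elim P' z s' t hz' hs' ht' := by
  subst hN
  obtain rfl := eq_of_heq eP
  obtain rfl := eq_of_heq es
  rfl

theorem Fam.prod_elimTo {ι : Type u₁} {M : ι → Base.{u, v}} (F : ∀ m, Fam (M m)) {j k : ℕ}
    {Γ : (prodBase M).Con} (N : (prodFam F).Ty j Γ) (hN P) (z : (prodFam F).Tm k Γ) (s)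
    (t : (prodFam F).Tm j Γ) (hz hs ht) (m : ι) :
    (prodFam F).elimTo N hN P z s t hz hs ht m =
      (F m).elimTo (N m) (congrFun hN m) (P m) (z m) (s m) (t m) (congrFun hz m) (congrFun hs m)
        (congrFun ht m) := by
  subst hN
  rfl

/-- The context denoted by a syntactic context in a model. -/
noncomputable abbrev evCon (M : Model.{1, 0} S) (Γ : (Syn S).base.Con) : M.base.Con := SCon.val Γ M

/-- The substitution denoted by a syntactic substitution in a model. -/
noncomputable abbrev evSub (M : Model.{1, 0} S) {Γ Δ : (Syn S).base.Con}
    (σ : (Syn S).base.Sub Γ Δ) : M.base.Sub (evCon M Γ) (evCon M Δ) :=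
  Sm.val σ M

/-- The type denoted by a syntactic type in a model. -/
noncomputable abbrev evTy (M : Model.{1, 0} S) {i : S.Stage} {j : ℕ} {Γ : (Syn S).base.Con}
    (A : ((Syn S).fam i).Ty j Γ) : (M.fam i).Ty j (evCon M Γ) :=
  Sm.val A M

/-- The term denoted by a syntactic term in a model. -/
noncomputable abbrev evTm (M : Model.{1, 0} S) {i : S.Stage} {j : ℕ} {Γ : (Syn S).base.Con}
    (t : ((Syn S).fam i).Tm j Γ) : (M.fam i).Tm j (evCon M Γ) :=
  Sm.val t M

theorem val_mk_at {ι : Type u} {Y : ι → Type v} {N : Model.{u₁, v₁} S} {f : (∀ m, Y m) → Val N}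
    {hf : Function.Injective f} (x : ∀ m, Y m) (h : Gen (f x)) (m : ι) :
    (Sm.mk x h : Sm f hf).val m = x m :=
  congrFun (Sm.val_mk x h) m

/-- Evaluation of the base of the syntax in a model. -/
noncomputable abbrev evalBase (M : Model.{1, 0} S) : BaseHom (Syn S).base M.base where
  con Γ := evCon M Γ
  sub σ := evSub M σ
  sub_id Γ := val_mk_at _ _ M
  sub_comp σ δ := val_mk_at _ _ M
  con_emp := rfl

/-- Evaluation of the families of the syntax in a model. -/
noncomputable abbrev evalFam (M : Model.{1, 0} S) (i : S.Stage) :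
    FamHom (evalBase M) ((Syn S).fam i) (M.fam i) where
  ty A := evTy M A
  tm t := evTm M t
  tyOf_tm t := by
    symm
    exact val_mk_at _ _ M
  ty_sub A σ := val_mk_at _ _ M
  tm_sub t σ := val_mk_at _ _ M
  con_ext A := rfl
  sub_p A := heq_of_eq (val_mk_at _ _ M)
  tm_q A := heq_of_eq (val_mk_at _ _ M)
  ty_U j Γ := val_mk_at _ _ M
  tm_code A := val_mk_at _ _ M
  ty_Sg A B B' e := by
    obtain rfl := eq_of_heq e
    exact val_mk_at _ _ M
  tm_tup A B t w ht hw B' ht' hw' e := by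
    obtain rfl := eq_of_heq e
    exact val_mk_at _ _ M
  ty_Pi A B B' e := by
    obtain rfl := eq_of_heq e
    exact val_mk_at _ _ M
  tm_lam A t t' e := by
    obtain rfl := eq_of_heq e
    exact val_mk_at _ _ M
  ty_Nat j Γ := val_mk_at _ _ M
  tm_zero j Γ := val_mk_at _ _ M
  tm_suc t h := val_mk_at _ _ M
  tm_elim P z s t hz hs ht P' s' hz' hs' ht' eP es :=
    (val_mk_at _ _ M).trans ((Fam.prod_elimTo _ _ _ _ _ _ _ _ _ _ M).trans
      ((M.fam i).elimTo_eq _ _ _ _ _ _ _ _ _ _ _ _ _ _ eP es))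

/-- Evaluation of the syntax in a model. -/
noncomputable def eval (M : Model.{1, 0} S) : Hom (Syn S) M where
  base := evalBase M
  fam i := evalFam M i
  ty_lift l _ _ A := val_mk_at _ _ M
  tm_quote l _ _ t := val_mk_at _ _ M

end Syntactic

/-! ### Morphisms preserve all operations -/

section Preservation

variable {C : Base.{u, v}} {D : Base.{u₁, v₁}} {H : BaseHom C D} {F : Fam C} {G : Fam D}
  (f : FamHom H F G)

theorem BaseHom.sub_comp_heq (H : BaseHom C D) {Γ Δ Θ : C.Con} (σ : C.Sub Δ Θ) (δ : C.Sub Γ Δ)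
    {Γ' Δ' Θ' : D.Con} (eΓ : H.con Γ = Γ') (eΔ : H.con Δ = Δ') (eΘ : H.con Θ = Θ')
    (σ' : D.Sub Δ' Θ') (δ' : D.Sub Γ' Δ') (hσ : HEq (H.sub σ) σ') (hδ : HEq (H.sub δ) δ') :
    HEq (H.sub (C.comp σ δ)) (D.comp σ' δ') := by
  subst eΓ eΔ eΘ
  obtain rfl := eq_of_heq hσ
  obtain rfl := eq_of_heq hδ
  exact heq_of_eq (H.sub_comp σ δ)

theorem BaseHom.sub_eps_heq (H : BaseHom C D) {Γ : C.Con} {Γ' : D.Con} (eΓ : H.con Γ = Γ') :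
    HEq (H.sub (C.eps Γ)) (D.eps Γ') := by
  subst eΓ
  have key : ∀ (X : D.Con) (_ : X = D.emp) (σ : D.Sub (H.con Γ) X), HEq σ (D.eps (H.con Γ)) := by
    intro X e σ
    subst e
    exact heq_of_eq (D.eps_uniq σ)
  exact key _ H.con_emp _

namespace FamHom

variable {j k : ℕ} {Γ Δ : C.Con} {Γ' Δ' : D.Con}

theorem ext_eq (A : F.Ty j Γ) (eΓ : H.con Γ = Γ') (A' : G.Ty j Γ') (hA : HEq (f.ty A) A') :
    H.con (F.ext Γ A) = G.ext Γ' A' := by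
  subst eΓ
  obtain rfl := eq_of_heq hA
  exact f.con_ext A

theorem p_heq (A : F.Ty j Γ) (eΓ : H.con Γ = Γ') (A' : G.Ty j Γ') (hA : HEq (f.ty A) A') :
    HEq (H.sub (F.p A)) (G.p A') := by
  subst eΓ
  obtain rfl := eq_of_heq hA
  exact f.sub_p A

theorem q_heq (A : F.Ty j Γ) (eΓ : H.con Γ = Γ') (A' : G.Ty j Γ') (hA : HEq (f.ty A) A') :
    HEq (f.tm (F.q A)) (G.q A') := by
  subst eΓ
  obtain rfl := eq_of_heq hA
  exact f.tm_q A

theorem pair_heq (σ : C.Sub Γ Δ) (A : F.Ty j Δ) (t : F.Tm j Γ) (h : F.tyOf t = F.tySub A σ)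
    (eΓ : H.con Γ = Γ') (eΔ : H.con Δ = Δ') (σ' : D.Sub Γ' Δ') (A' : G.Ty j Δ') (t' : G.Tm j Γ')
    (h' : G.tyOf t' = G.tySub A' σ') (hσ : HEq (H.sub σ) σ') (hA : HEq (f.ty A) A')
    (ht : HEq (f.tm t) t') : HEq (H.sub (F.pair σ A t h)) (G.pair σ' A' t' h') := by
  subst eΓ eΔ
  obtain rfl := eq_of_heq hσ
  obtain rfl := eq_of_heq hA
  obtain rfl := eq_of_heq ht
  have key : ∀ (X : D.Con) (_ : X = G.ext (H.con Δ) (f.ty A)) (p' : D.Sub X (H.con Δ))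
      (_ : HEq p' (G.p (f.ty A))) (q' : G.Tm j X) (_ : HEq q' (G.q (f.ty A)))
      (τ : D.Sub (H.con Γ) X), D.comp p' τ = H.sub σ → G.tmSub q' τ = f.tm t →
      HEq τ (G.pair (H.sub σ) (f.ty A) (f.tm t) h') := by
    intro X eX p' hp q' hq τ e₁ e₂
    subst eX
    obtain rfl := eq_of_heq hp
    obtain rfl := eq_of_heq hq
    refine heq_of_eq ((G.pair_eta _ τ).symm.trans ?_)
    exact G.pair_congr _ _ e₁ e₂
  refine key _ (f.con_ext A) _ (f.sub_p A) _ (f.tm_q A) _ ?_ ?_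
  · rw [← H.sub_comp, F.p_pair]
  · rw [← f.tm_sub, F.q_pair]

theorem tyOf_heq (t : F.Tm j Γ) (eΓ : H.con Γ = Γ') (t' : G.Tm j Γ') (ht : HEq (f.tm t) t') :
    HEq (f.ty (F.tyOf t)) (G.tyOf t') := by
  subst eΓ
  obtain rfl := eq_of_heq ht
  exact heq_of_eq (f.tyOf_tm t).symm

theorem tySub_heq (A : F.Ty j Δ) (σ : C.Sub Γ Δ) (eΓ : H.con Γ = Γ') (eΔ : H.con Δ = Δ')
    (A' : G.Ty j Δ') (σ' : D.Sub Γ' Δ') (hA : HEq (f.ty A) A') (hσ : HEq (H.sub σ) σ') :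
    HEq (f.ty (F.tySub A σ)) (G.tySub A' σ') := by
  subst eΓ eΔ
  obtain rfl := eq_of_heq hA
  obtain rfl := eq_of_heq hσ
  exact heq_of_eq (f.ty_sub A σ)

theorem tmSub_heq (t : F.Tm j Δ) (σ : C.Sub Γ Δ) (eΓ : H.con Γ = Γ') (eΔ : H.con Δ = Δ')
    (t' : G.Tm j Δ') (σ' : D.Sub Γ' Δ') (ht : HEq (f.tm t) t') (hσ : HEq (H.sub σ) σ') :
    HEq (f.tm (F.tmSub t σ)) (G.tmSub t' σ') := by
  subst eΓ eΔ
  obtain rfl := eq_of_heq ht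
  obtain rfl := eq_of_heq hσ
  exact heq_of_eq (f.tm_sub t σ)

theorem U_heq (eΓ : H.con Γ = Γ') : HEq (f.ty (F.univ.U j Γ)) (G.univ.U j Γ') := by
  subst eΓ
  exact heq_of_eq (f.ty_U j Γ)

theorem El_heq (t : F.Tm (j + 1) Γ) (h : F.tyOf t = F.univ.U j Γ) (eΓ : H.con Γ = Γ')
    (t' : G.Tm (j + 1) Γ') (h' : G.tyOf t' = G.univ.U j Γ') (ht : HEq (f.tm t) t') :
    HEq (f.ty (F.univ.El t h)) (G.univ.El t' h') := by
  subst eΓ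
  obtain rfl := eq_of_heq ht
  refine heq_of_eq (G.El_eq _ _ _ ?_).symm
  rw [← f.tm_code, F.univ.code_El]

theorem code_heq (A : F.Ty j Γ) (eΓ : H.con Γ = Γ') (A' : G.Ty j Γ') (hA : HEq (f.ty A) A') :
    HEq (f.tm (F.univ.code A)) (G.univ.code A') := by
  subst eΓ
  obtain rfl := eq_of_heq hA
  exact heq_of_eq (f.tm_code A)

theorem Sg_heq (A : F.Ty j Γ) (B : F.Ty j (F.ext Γ A)) (eΓ : H.con Γ = Γ') (A' : G.Ty j Γ')
    (B' : G.Ty j (G.ext Γ' A')) (hA : HEq (f.ty A) A') (hB : HEq (f.ty B) B') :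
    HEq (f.ty (F.sg.Sg A B)) (G.sg.Sg A' B') := by
  subst eΓ
  obtain rfl := eq_of_heq hA
  exact heq_of_eq (f.ty_Sg A B B' hB)

theorem inst_heq (A : F.Ty j Γ) (t : F.Tm j Γ) (h : F.tyOf t = A) (eΓ : H.con Γ = Γ')
    (A' : G.Ty j Γ') (t' : G.Tm j Γ') (h' : G.tyOf t' = A') (hA : HEq (f.ty A) A')
    (ht : HEq (f.tm t) t') : HEq (H.sub (F.inst A t h)) (G.inst A' t' h') := by
  refine f.pair_heq _ _ _ _ eΓ eΓ _ _ _ _ ?_ hA ht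
  subst eΓ
  exact heq_of_eq (H.sub_id Γ)

theorem tup_heq (A : F.Ty j Γ) (B : F.Ty j (F.ext Γ A)) (t w : F.Tm j Γ) (ht hw)
    (eΓ : H.con Γ = Γ') (A' : G.Ty j Γ') (B' : G.Ty j (G.ext Γ' A')) (t' w' : G.Tm j Γ')
    (ht' hw') (hA : HEq (f.ty A) A') (hB : HEq (f.ty B) B') (et : HEq (f.tm t) t')
    (ew : HEq (f.tm w) w') : HEq (f.tm (F.sg.tup A B t w ht hw)) (G.sg.tup A' B' t' w' ht' hw') := by
  subst eΓ
  obtain rfl := eq_of_heq hA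
  obtain rfl := eq_of_heq et
  obtain rfl := eq_of_heq ew
  exact heq_of_eq (f.tm_tup A B t w ht hw B' ht' hw' hB)

theorem tm_eq_tup (A : F.Ty j Γ) (B : F.Ty j (F.ext Γ A)) (t : F.Tm j Γ)
    (h : F.tyOf t = F.sg.Sg A B) (B' : G.Ty j (G.ext (H.con Γ) (f.ty A))) (hB : HEq (f.ty B) B') :
    ∃ h₁ h₂, f.tm t =
      G.sg.tup (f.ty A) B' (f.tm (F.sg.fst A B t h)) (f.tm (F.sg.snd A B t h)) h₁ h₂ := by
  have h₁ : G.tyOf (f.tm (F.sg.fst A B t h)) = f.ty A := by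
    rw [f.tyOf_tm, F.sg.tyOf_fst]
  have h₂ : G.tyOf (f.tm (F.sg.snd A B t h)) = G.tySub B' (G.inst (f.ty A) _ h₁) := by
    rw [f.tyOf_tm, F.sg.tyOf_snd]
    exact eq_of_heq (f.tySub_heq _ _ rfl (f.con_ext A) _ _ hB
      (f.inst_heq _ _ _ rfl _ _ _ HEq.rfl HEq.rfl))
  refine ⟨h₁, h₂, ?_⟩
  rw [← f.tm_tup A B _ _ (F.sg.tyOf_fst A B t h) (F.sg.tyOf_snd A B t h) B' h₁ h₂ hB,
    F.sg.tup_eta]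

theorem fst_heq (A : F.Ty j Γ) (B : F.Ty j (F.ext Γ A)) (t : F.Tm j Γ) (h)
    (eΓ : H.con Γ = Γ') (A' : G.Ty j Γ') (B' : G.Ty j (G.ext Γ' A')) (t' : G.Tm j Γ') (h')
    (hA : HEq (f.ty A) A') (hB : HEq (f.ty B) B') (et : HEq (f.tm t) t') :
    HEq (f.tm (F.sg.fst A B t h)) (G.sg.fst A' B' t' h') := by
  subst eΓ
  obtain rfl := eq_of_heq hA
  obtain rfl := eq_of_heq et
  obtain ⟨h₁, h₂, e⟩ := f.tm_eq_tup A B t h B' hB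
  exact heq_of_eq (G.fst_eq _ _ _ _ _ _ _ _ e).symm

theorem snd_heq (A : F.Ty j Γ) (B : F.Ty j (F.ext Γ A)) (t : F.Tm j Γ) (h)
    (eΓ : H.con Γ = Γ') (A' : G.Ty j Γ') (B' : G.Ty j (G.ext Γ' A')) (t' : G.Tm j Γ') (h')
    (hA : HEq (f.ty A) A') (hB : HEq (f.ty B) B') (et : HEq (f.tm t) t') :
    HEq (f.tm (F.sg.snd A B t h)) (G.sg.snd A' B' t' h') := by
  subst eΓ
  obtain rfl := eq_of_heq hA
  obtain rfl := eq_of_heq et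
  obtain ⟨h₁, h₂, e⟩ := f.tm_eq_tup A B t h B' hB
  exact heq_of_eq (G.snd_eq _ _ _ _ _ _ _ _ e).symm

theorem Pi_heq (A : F.Ty j Γ) (B : F.Ty j (F.ext Γ A)) (eΓ : H.con Γ = Γ') (A' : G.Ty j Γ')
    (B' : G.Ty j (G.ext Γ' A')) (hA : HEq (f.ty A) A') (hB : HEq (f.ty B) B') :
    HEq (f.ty (F.pi.Pi A B)) (G.pi.Pi A' B') := by
  subst eΓ
  obtain rfl := eq_of_heq hA
  exact heq_of_eq (f.ty_Pi A B B' hB)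

theorem lam_heq (A : F.Ty j Γ) (t : F.Tm j (F.ext Γ A)) (eΓ : H.con Γ = Γ') (A' : G.Ty j Γ')
    (t' : G.Tm j (G.ext Γ' A')) (hA : HEq (f.ty A) A') (ht : HEq (f.tm t) t') :
    HEq (f.tm (F.pi.lam A t)) (G.pi.lam A' t') := by
  subst eΓ
  obtain rfl := eq_of_heq hA
  exact heq_of_eq (f.tm_lam A t t' ht)

theorem app_heq (A : F.Ty j Γ) (B : F.Ty j (F.ext Γ A)) (t : F.Tm j Γ) (h)
    (eΓ : H.con Γ = Γ') (A' : G.Ty j Γ') (B' : G.Ty j (G.ext Γ' A')) (t' : G.Tm j Γ') (h')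
    (hA : HEq (f.ty A) A') (hB : HEq (f.ty B) B') (et : HEq (f.tm t) t') :
    HEq (f.tm (F.pi.app A B t h)) (G.pi.app A' B' t' h') := by
  subst eΓ
  obtain rfl := eq_of_heq hA
  obtain rfl := eq_of_heq et
  have e₁ := f.tyOf_heq (F.pi.app A B t h) (f.con_ext A)
  have e₂ := f.tm_lam A (F.pi.app A B t h)
  rw [F.pi.tyOf_app] at e₁
  rw [F.pi.lam_app] at e₂
  have key : ∀ (X : D.Con) (_ : X = G.ext (H.con Γ) (f.ty A)) (s : G.Tm j X),
      (∀ t' : G.Tm j (G.ext (H.con Γ) (f.ty A)), HEq s t' → HEq (f.ty B) (G.tyOf t')) →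
      (∀ t' : G.Tm j (G.ext (H.con Γ) (f.ty A)), HEq s t' → f.tm t = G.pi.lam (f.ty A) t') →
      HEq s (G.pi.app (f.ty A) B' (f.tm t) h') := by
    intro X eX s k₁ k₂
    subst eX
    refine heq_of_eq (G.app_eq _ _ _ _ _ ?_ (k₂ s HEq.rfl)).symm
    exact eq_of_heq ((k₁ s HEq.rfl).symm.trans hB)
  exact key _ (f.con_ext A) _ e₁ e₂

theorem Nat_heq (eΓ : H.con Γ = Γ') : HEq (f.ty (F.nat.Nat j Γ)) (G.nat.Nat j Γ') := by
  subst eΓ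
  exact heq_of_eq (f.ty_Nat j Γ)

theorem zero_heq (eΓ : H.con Γ = Γ') : HEq (f.tm (F.nat.zero j Γ)) (G.nat.zero j Γ') := by
  subst eΓ
  exact heq_of_eq (f.tm_zero j Γ)

theorem suc_heq (t : F.Tm j Γ) (h) (eΓ : H.con Γ = Γ') (t' : G.Tm j Γ') (h')
    (ht : HEq (f.tm t) t') : HEq (f.tm (F.nat.suc t h)) (G.nat.suc t' h') := by
  subst eΓ
  obtain rfl := eq_of_heq ht
  exact heq_of_eq (f.tm_suc t h)

theorem elim_heq (P : F.Ty k (F.ext Γ (F.nat.Nat j Γ))) (z : F.Tm k Γ)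
    (s : F.Tm k (F.ext (F.ext Γ (F.nat.Nat j Γ)) P)) (t : F.Tm j Γ) (hz hs ht)
    (eΓ : H.con Γ = Γ') (P' : G.Ty k (G.ext Γ' (G.nat.Nat j Γ'))) (z' : G.Tm k Γ')
    (s' : G.Tm k (G.ext (G.ext Γ' (G.nat.Nat j Γ')) P')) (t' : G.Tm j Γ') (hz' hs' ht')
    (eP : HEq (f.ty P) P') (ez : HEq (f.tm z) z') (es : HEq (f.tm s) s') (et : HEq (f.tm t) t') :
    HEq (f.tm (F.nat.elim P z s t hz hs ht)) (G.nat.elim P' z' s' t' hz' hs' ht') := by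
  subst eΓ
  obtain rfl := eq_of_heq ez
  obtain rfl := eq_of_heq et
  exact heq_of_eq (f.tm_elim P z s t hz hs ht P' s' hz' hs' ht' eP es)

end FamHom

end Preservation

namespace Hom

variable {S : Stages} {M : Model.{u, v} S} {N : Model.{u₁, v₁} S} (f : Hom M N) (l : S.Lift)
  {j : ℕ} {Γ : M.base.Con} {Γ' : N.base.Con}

theorem lift_heq (A : (M.fam (S.src l)).Ty j Γ) (eΓ : f.base.con Γ = Γ')
    (A' : (N.fam (S.src l)).Ty j Γ') (hA : HEq ((f.fam (S.src l)).ty A) A') :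
    HEq ((f.fam (S.tgt l)).ty ((M.lifting l).lift A)) ((N.lifting l).lift A') := by
  subst eΓ
  obtain rfl := eq_of_heq hA
  exact heq_of_eq (f.ty_lift l A)

theorem quote_heq (t : (M.fam (S.src l)).Tm j Γ) (eΓ : f.base.con Γ = Γ')
    (t' : (N.fam (S.src l)).Tm j Γ') (ht : HEq ((f.fam (S.src l)).tm t) t') :
    HEq ((f.fam (S.tgt l)).tm ((M.lifting l).quote t)) ((N.lifting l).quote t') := by
  subst eΓ
  obtain rfl := eq_of_heq ht
  exact heq_of_eq (f.tm_quote l t)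

theorem splice_heq (A : (M.fam (S.src l)).Ty j Γ) (t : (M.fam (S.tgt l)).Tm j Γ) (h)
    (eΓ : f.base.con Γ = Γ') (A' : (N.fam (S.src l)).Ty j Γ') (t' : (N.fam (S.tgt l)).Tm j Γ') (h')
    (hA : HEq ((f.fam (S.src l)).ty A) A') (ht : HEq ((f.fam (S.tgt l)).tm t) t') :
    HEq ((f.fam (S.src l)).tm ((M.lifting l).splice A t h)) ((N.lifting l).splice A' t' h') := by
  subst eΓ
  obtain rfl := eq_of_heq hA
  obtain rfl := eq_of_heq ht
  refine heq_of_eq ((N.lifting l).splice_eq _ _ _ _ ?_ ?_).symm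
  · rw [(f.fam (S.src l)).tyOf_tm, (M.lifting l).tyOf_splice]
  · rw [← f.tm_quote, (M.lifting l).quote_splice]

end Hom

/-! ### Denotations are preserved by morphisms -/

section Naturality

variable {S : Stages} {ι : Type u} {N : ι → Model.{u₁, v₁} S} {m m' : ι} (h : Hom (N m) (N m'))

/-- `h` maps the component of an element at `m` to its component at `m'`. -/
def Agree (h : Hom (N m) (N m')) : Val (prodModel N) → Prop
  | .con Γ => h.base.con (Γ m) = Γ m'
  | .sub Γ Δ σ => h.base.con (Γ m) = Γ m' ∧ h.base.con (Δ m) = Δ m' ∧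
      HEq (h.base.sub (σ m)) (σ m')
  | .ty i _ Γ A => h.base.con (Γ m) = Γ m' ∧ HEq ((h.fam i).ty (A m)) (A m')
  | .tm i _ Γ t => h.base.con (Γ m) = Γ m' ∧ HEq ((h.fam i).tm (t m)) (t m')

theorem Den.agree {r : Raw S.Stage S.Lift} {v : Val (prodModel N)} (d : Den (prodModel N) r v) :
    Agree h v := by
  induction d with
  | emp => exact h.base.con_emp
  | ext _ _ e₁ e₂ => exact (h.fam _).ext_eq _ e₁ _ e₂.2
  | id _ e₁ =>
    refine ⟨e₁, e₁, ?_⟩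
    refine (heq_of_eq (h.base.sub_id _)).trans ?_
    exact congr_arg_heq (N m').base.id e₁
  | comp _ _ _ _ _ e₁ e₂ e₃ e₄ e₅ =>
    exact ⟨e₁, e₃, h.base.sub_comp_heq _ _ e₁ e₂ e₃ _ _ e₄.2.2 e₅.2.2⟩
  | eps _ e₁ => exact ⟨e₁, h.base.con_emp, h.base.sub_eps_heq e₁⟩
  | p _ _ e₁ e₂ => exact ⟨(h.fam _).ext_eq _ e₁ _ e₂.2, e₁, (h.fam _).p_heq _ e₁ _ e₂.2⟩
  | pair _ _ _ _ _ _ e₁ e₂ e₃ e₄ e₅ =>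
    exact ⟨e₁, (h.fam _).ext_eq _ e₂ _ e₄.2,
      (h.fam _).pair_heq _ _ _ _ e₁ e₂ _ _ _ _ e₃.2.2 e₄.2 e₅.2⟩
  | tyOf _ _ e₁ e₂ => exact ⟨e₁, (h.fam _).tyOf_heq _ e₁ _ e₂.2⟩
  | tySub _ _ _ _ e₁ e₂ e₃ e₄ =>
    exact ⟨e₁, (h.fam _).tySub_heq _ _ e₁ e₂ _ _ e₃.2 e₄.2.2⟩
  | tmSub _ _ _ _ e₁ e₂ e₃ e₄ =>
    exact ⟨e₁, (h.fam _).tmSub_heq _ _ e₁ e₂ _ _ e₃.2 e₄.2.2⟩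
  | q _ _ e₁ e₂ => exact ⟨(h.fam _).ext_eq _ e₁ _ e₂.2, (h.fam _).q_heq _ e₁ _ e₂.2⟩
  | U _ e₁ => exact ⟨e₁, (h.fam _).U_heq e₁⟩
  | El _ _ _ e₁ e₂ => exact ⟨e₁, (h.fam _).El_heq _ _ e₁ _ _ e₂.2⟩
  | code _ _ e₁ e₂ => exact ⟨e₁, (h.fam _).code_heq _ e₁ _ e₂.2⟩
  | Sg _ _ _ e₁ e₂ e₃ => exact ⟨e₁, (h.fam _).Sg_heq _ _ e₁ _ _ e₂.2 e₃.2⟩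
  | tup _ _ _ _ _ _ _ e₁ e₂ e₃ e₄ e₅ =>
    exact ⟨e₁, (h.fam _).tup_heq _ _ _ _ _ _ e₁ _ _ _ _ _ _ e₂.2 e₃.2 e₄.2 e₅.2⟩
  | fst _ _ _ _ _ e₁ e₂ e₃ e₄ =>
    exact ⟨e₁, (h.fam _).fst_heq _ _ _ _ e₁ _ _ _ _ e₂.2 e₃.2 e₄.2⟩
  | snd _ _ _ _ _ e₁ e₂ e₃ e₄ =>
    exact ⟨e₁, (h.fam _).snd_heq _ _ _ _ e₁ _ _ _ _ e₂.2 e₃.2 e₄.2⟩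
  | Pi _ _ _ e₁ e₂ e₃ => exact ⟨e₁, (h.fam _).Pi_heq _ _ e₁ _ _ e₂.2 e₃.2⟩
  | lam _ _ _ e₁ e₂ e₃ => exact ⟨e₁, (h.fam _).lam_heq _ _ e₁ _ _ e₂.2 e₃.2⟩
  | app _ _ _ _ _ e₁ e₂ e₃ e₄ =>
    exact ⟨(h.fam _).ext_eq _ e₁ _ e₂.2, (h.fam _).app_heq _ _ _ _ e₁ _ _ _ _ e₂.2 e₃.2 e₄.2⟩
  | Nat _ e₁ => exact ⟨e₁, (h.fam _).Nat_heq e₁⟩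
  | zero _ e₁ => exact ⟨e₁, (h.fam _).zero_heq e₁⟩
  | suc _ _ _ e₁ e₂ => exact ⟨e₁, (h.fam _).suc_heq _ _ e₁ _ _ e₂.2⟩
  | elim _ _ _ _ _ _ _ _ e₁ e₂ e₃ e₄ e₅ =>
    exact ⟨e₁, (h.fam _).elim_heq _ _ _ _ _ _ _ e₁ _ _ _ _ _ _ _ e₂.2 e₃.2 e₄.2 e₅.2⟩
  | lift _ _ e₁ e₂ => exact ⟨e₁, h.lift_heq _ _ e₁ _ e₂.2⟩
  | quote _ _ e₁ e₂ => exact ⟨e₁, h.quote_heq _ _ e₁ _ e₂.2⟩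
  | splice _ _ _ _ e₁ e₂ e₃ => exact ⟨e₁, h.splice_heq _ _ _ _ e₁ _ _ _ e₂.2 e₃.2⟩

end Naturality

section SyntaxNaturality

variable {S : Stages} [Countable S.Stage] [Countable S.Lift] {M M' : Model.{1, 0} S}
  (h : Hom M M')

theorem evCon_nat (Γ : (Syn S).base.Con) : h.base.con (evCon M Γ) = evCon M' Γ := by
  obtain ⟨r, d⟩ := SCon.gen Γ
  exact d.agree (N := fun M : Model.{1, 0} S => M) h

theorem evSub_nat {Γ Δ : (Syn S).base.Con} (σ : (Syn S).base.Sub Γ Δ) :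
    HEq (h.base.sub (evSub M σ)) (evSub M' σ) := by
  obtain ⟨r, d⟩ := Sm.gen σ
  exact (d.agree (N := fun M : Model.{1, 0} S => M) h).2.2

theorem evTy_nat {i : S.Stage} {j : ℕ} {Γ : (Syn S).base.Con} (A : ((Syn S).fam i).Ty j Γ) :
    HEq ((h.fam i).ty (evTy M A)) (evTy M' A) := by
  obtain ⟨r, d⟩ := Sm.gen A
  exact (d.agree (N := fun M : Model.{1, 0} S => M) h).2

theorem evTm_nat {i : S.Stage} {j : ℕ} {Γ : (Syn S).base.Con} (t : ((Syn S).fam i).Tm j Γ) :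
    HEq ((h.fam i).tm (evTm M t)) (evTm M' t) := by
  obtain ⟨r, d⟩ := Sm.gen t
  exact (d.agree (N := fun M : Model.{1, 0} S => M) h).2

end SyntaxNaturality

/-! ### Changing the universe of contexts -/

section LiftCon

/-- Moving the contexts of a base to a larger universe. -/
abbrev liftBase (C : Base.{0, 0}) : Base.{1, 0} where
  Con := ULift.{1} C.Con
  Sub Γ Δ := C.Sub Γ.down Δ.down
  id Γ := C.id Γ.down
  comp σ δ := C.comp σ δ
  id_comp := C.id_comp
  comp_id := C.comp_id
  assoc := C.assoc
  emp := ⟨C.emp⟩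
  eps Γ := C.eps Γ.down
  eps_uniq := C.eps_uniq

/-- Moving the contexts of a family structure to a larger universe. -/
abbrev liftFam {C : Base.{0, 0}} (F : Fam C) : Fam (liftBase C) where
  Ty j Γ := F.Ty j Γ.down
  Tm j Γ := F.Tm j Γ.down
  tyOf := F.tyOf
  tySub := F.tySub
  tmSub := F.tmSub
  tyOf_tmSub := F.tyOf_tmSub
  tySub_id := F.tySub_id
  tySub_comp := F.tySub_comp
  tmSub_id := F.tmSub_id
  tmSub_comp := F.tmSub_comp
  ext Γ A := ⟨F.ext Γ.down A⟩
  p := F.p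
  q := F.q
  tyOf_q := F.tyOf_q
  pair := F.pair
  p_pair := F.p_pair
  q_pair := F.q_pair
  pair_eta := F.pair_eta
  univ :=
    { U := fun j Γ => F.univ.U j Γ.down
      U_sub := fun j _ _ σ => F.univ.U_sub j σ
      El := F.univ.El
      code := F.univ.code
      tyOf_code := F.univ.tyOf_code
      El_code := F.univ.El_code
      code_El := F.univ.code_El
      code_sub := F.univ.code_sub }
  sg :=
    { Sg := F.sg.Sg
      Sg_sub := F.sg.Sg_sub
      tup := F.sg.tup
      fst := F.sg.fst
      snd := F.sg.snd
      tyOf_tup := F.sg.tyOf_tup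
      tyOf_fst := F.sg.tyOf_fst
      tyOf_snd := F.sg.tyOf_snd
      fst_tup := F.sg.fst_tup
      snd_tup := F.sg.snd_tup
      tup_eta := F.sg.tup_eta
      tup_sub := F.sg.tup_sub }
  pi :=
    { Pi := F.pi.Pi
      Pi_sub := F.pi.Pi_sub
      lam := F.pi.lam
      app := F.pi.app
      tyOf_lam := F.pi.tyOf_lam
      tyOf_app := F.pi.tyOf_app
      app_lam := F.pi.app_lam
      lam_app := F.pi.lam_app
      lam_sub := F.pi.lam_sub }
  nat :=
    { Nat := fun j Γ => F.nat.Nat j Γ.down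
      Nat_sub := fun j _ _ σ => F.nat.Nat_sub j σ
      zero := fun j Γ => F.nat.zero j Γ.down
      tyOf_zero := fun j Γ => F.nat.tyOf_zero j Γ.down
      zero_sub := fun j _ _ σ => F.nat.zero_sub j σ
      suc := F.nat.suc
      tyOf_suc := F.nat.tyOf_suc
      suc_sub := F.nat.suc_sub
      elim := F.nat.elim
      tyOf_elim := F.nat.tyOf_elim
      elim_zero := F.nat.elim_zero
      elim_suc := F.nat.elim_suc
      elim_sub := F.nat.elim_sub }

/-- Moving the contexts of a model to a larger universe. -/
abbrev liftCon {S : Stages} (M : Model.{0, 0} S) : Model.{1, 0} S where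
  base := liftBase M.base
  fam i := liftFam (M.fam i)
  lifting l :=
    { lift := (M.lifting l).lift
      lift_sub := (M.lifting l).lift_sub
      quote := (M.lifting l).quote
      tyOf_quote := (M.lifting l).tyOf_quote
      splice := (M.lifting l).splice
      tyOf_splice := (M.lifting l).tyOf_splice
      splice_quote := (M.lifting l).splice_quote
      quote_splice := (M.lifting l).quote_splice
      quote_sub := (M.lifting l).quote_sub }

/-- A morphism, precomposed with the change of universe. -/
abbrev Hom.ofLift {S : Stages} {M : Model.{0, 0} S} {N : Model.{u, v} S} (h : Hom M N) :
    Hom (liftCon M) N where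
  base :=
    { con := fun Γ => h.base.con Γ.down
      sub := h.base.sub
      sub_id := fun Γ => h.base.sub_id Γ.down
      sub_comp := h.base.sub_comp
      con_emp := h.base.con_emp }
  fam i :=
    { ty := (h.fam i).ty
      tm := (h.fam i).tm
      tyOf_tm := (h.fam i).tyOf_tm
      ty_sub := (h.fam i).ty_sub
      tm_sub := (h.fam i).tm_sub
      con_ext := (h.fam i).con_ext
      sub_p := (h.fam i).sub_p
      tm_q := (h.fam i).tm_q
      ty_U := fun j Γ => (h.fam i).ty_U j Γ.down
      tm_code := (h.fam i).tm_code
      ty_Sg := (h.fam i).ty_Sg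
      tm_tup := (h.fam i).tm_tup
      ty_Pi := (h.fam i).ty_Pi
      tm_lam := (h.fam i).tm_lam
      ty_Nat := fun j Γ => (h.fam i).ty_Nat j Γ.down
      tm_zero := fun j Γ => (h.fam i).tm_zero j Γ.down
      tm_suc := (h.fam i).tm_suc
      tm_elim := (h.fam i).tm_elim }
  ty_lift l _ _ A := h.ty_lift l A
  tm_quote l _ _ t := h.tm_quote l t

end LiftCon

/-! ### Object-level part of a model of two-level type theory -/

/-- The object-level part of a model of two-level type theory. -/
abbrev Model.reduct (M : TwoModel.{u, v}) : ObjModel.{u, v} where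
  base := M.base
  fam _ := M.fam .obj
  lifting l := l.elim

/-- The object-level part of a morphism. -/
abbrev Hom.reduct {M : TwoModel.{u, v}} {N : TwoModel.{u₁, v₁}} (h : Hom M N) :
    Hom M.reduct N.reduct where
  base := h.base
  fam _ := h.fam .obj
  ty_lift l := l.elim
  tm_quote l := l.elim

/-! ### Initiality of the syntax -/

section Initiality

variable {S : Stages} [Countable S.Stage] [Countable S.Lift]

theorem sub_heq_of_val {Γ Γ' Δ Δ' : (Syn S).base.Con} (e : Γ = Γ') (e' : Δ = Δ')
    (x : (Syn S).base.Sub Γ Δ) (y : (Syn S).base.Sub Γ' Δ')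
    (h : ∀ M : Model.{1, 0} S, HEq (evSub M x) (evSub M y)) : HEq x y := by
  subst e e'
  exact heq_of_eq (Sm.ext_val (funext fun M => eq_of_heq (h M)))

theorem ty_heq_of_val {i : S.Stage} {j : ℕ} {Γ Γ' : (Syn S).base.Con} (e : Γ = Γ')
    (x : ((Syn S).fam i).Ty j Γ) (y : ((Syn S).fam i).Ty j Γ')
    (h : ∀ M : Model.{1, 0} S, HEq (evTy M x) (evTy M y)) : HEq x y := by
  subst e
  exact heq_of_eq (Sm.ext_val (funext fun M => eq_of_heq (h M)))

theorem tm_heq_of_val {i : S.Stage} {j : ℕ} {Γ Γ' : (Syn S).base.Con} (e : Γ = Γ')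
    (x : ((Syn S).fam i).Tm j Γ) (y : ((Syn S).fam i).Tm j Γ')
    (h : ∀ M : Model.{1, 0} S, HEq (evTm M x) (evTm M y)) : HEq x y := by
  subst e
  exact heq_of_eq (Sm.ext_val (funext fun M => eq_of_heq (h M)))

theorem evSyn_con (Γ : (Syn S).base.Con) : (evCon (liftCon (Syn S)) Γ).down = Γ := by
  induction Γ using SCon.ind with
  | emp => rfl
  | ext i j Γ A ih =>
    have h : HEq (evTy (liftCon (Syn S)) (i := i) A) A :=
      ty_heq_of_val ih _ _ fun M => evTy_nat (eval M).ofLift A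
    have key : ∀ (Γ' : (Syn S).base.Con) (A' : ((Syn S).fam i).Ty j Γ'), Γ' = Γ → HEq A' A →
        ((Syn S).fam i).ext Γ' A' = ((Syn S).fam i).ext Γ A := by
      intro Γ' A' e e'
      subst e
      obtain rfl := eq_of_heq e'
      rfl
    exact key _ _ ih h

theorem evSyn_sub {Γ Δ : (Syn S).base.Con} (σ : (Syn S).base.Sub Γ Δ) :
    HEq (evSub (liftCon (Syn S)) σ) σ :=
  sub_heq_of_val (evSyn_con Γ) (evSyn_con Δ) _ _ fun M => evSub_nat (eval M).ofLift σ

theorem evSyn_ty {i : S.Stage} {j : ℕ} {Γ : (Syn S).base.Con} (A : ((Syn S).fam i).Ty j Γ) :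
    HEq (evTy (liftCon (Syn S)) A) A :=
  ty_heq_of_val (evSyn_con Γ) _ _ fun M => evTy_nat (eval M).ofLift A

theorem evSyn_tm {i : S.Stage} {j : ℕ} {Γ : (Syn S).base.Con} (t : ((Syn S).fam i).Tm j Γ) :
    HEq (evTm (liftCon (Syn S)) t) t :=
  tm_heq_of_val (evSyn_con Γ) _ _ fun M => evTm_nat (eval M).ofLift t

variable {M : Model.{1, 0} S} (h : Hom (Syn S) M)

/-- Evaluation is the unique morphism from the syntax: the action on contexts. -/
theorem con_eq_eval (Γ : (Syn S).base.Con) : h.base.con Γ = evCon M Γ := by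
  have e := evCon_nat h.ofLift Γ
  rw [← e]
  exact congrArg h.base.con (evSyn_con Γ).symm

/-- Evaluation is the unique morphism from the syntax: the action on substitutions. -/
theorem sub_heq_eval {Γ Δ : (Syn S).base.Con} (σ : (Syn S).base.Sub Γ Δ) :
    HEq (h.base.sub σ) (evSub M σ) := by
  refine HEq.trans ?_ (evSub_nat h.ofLift σ)
  have key : ∀ (Γ' Δ' : (Syn S).base.Con) (σ' : (Syn S).base.Sub Γ' Δ'), Γ' = Γ → Δ' = Δ →
      HEq σ' σ → HEq (h.base.sub σ) (h.base.sub σ') := by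
    intro Γ' Δ' σ' e e' e''
    subst e e'
    obtain rfl := eq_of_heq e''
    rfl
  exact key _ _ _ (evSyn_con Γ) (evSyn_con Δ) (evSyn_sub σ)

/-- Evaluation is the unique morphism from the syntax: the action on types. -/
theorem ty_heq_eval {i : S.Stage} {j : ℕ} {Γ : (Syn S).base.Con} (A : ((Syn S).fam i).Ty j Γ) :
    HEq ((h.fam i).ty A) (evTy M A) := by
  refine HEq.trans ?_ (evTy_nat h.ofLift A)
  have key : ∀ (Γ' : (Syn S).base.Con) (A' : ((Syn S).fam i).Ty j Γ'), Γ' = Γ → HEq A' A →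
      HEq ((h.fam i).ty A) ((h.fam i).ty A') := by
    intro Γ' A' e e'
    subst e
    obtain rfl := eq_of_heq e'
    rfl
  exact key _ _ (evSyn_con Γ) (evSyn_ty A)

/-- Evaluation is the unique morphism from the syntax: the action on terms. -/
theorem tm_heq_eval {i : S.Stage} {j : ℕ} {Γ : (Syn S).base.Con} (t : ((Syn S).fam i).Tm j Γ) :
    HEq ((h.fam i).tm t) (evTm M t) := by
  refine HEq.trans ?_ (evTm_nat h.ofLift t)
  have key : ∀ (Γ' : (Syn S).base.Con) (t' : ((Syn S).fam i).Tm j Γ'), Γ' = Γ → HEq t' t →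
      HEq ((h.fam i).tm t) ((h.fam i).tm t') := by
    intro Γ' t' e e'
    subst e
    obtain rfl := eq_of_heq e'
    rfl
  exact key _ _ (evSyn_con Γ) (evSyn_tm t)

end Initiality

/-! ### The model of presheaves with a chosen element -/

section Pointed

variable {C : Base.{0, 0}}

/-- Presheaves `X` with a chosen element over a chosen object `a`. -/
structure PtCon (C : Base.{0, 0}) where
  psh : Psh C
  obj : C.Con
  elt : psh.obj obj

/-- Morphisms of presheaves and of chosen objects which map the chosen element of `X` to the
restriction of the chosen element of `Y`. -/
@[ext]
structure PtSub (X Y : PtCon C) where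
  psh : PSub X.psh Y.psh
  obj : C.Sub X.obj Y.obj
  elt : psh.app X.elt = Y.psh.res Y.elt obj

/-- The category of presheaves with a chosen element. -/
abbrev ptBase (C : Base.{0, 0}) : Base.{1, 0} where
  Con := PtCon C
  Sub := PtSub
  id X := ⟨PSub.id X.psh, C.id X.obj, (X.psh.res_id X.elt).symm⟩
  comp {X Y Z} σ δ := ⟨σ.psh.comp δ.psh, C.comp σ.obj δ.obj, by
    change σ.psh.app (δ.psh.app X.elt) = _
    rw [δ.elt, σ.psh.nat, σ.elt, Z.psh.res_comp]⟩
  id_comp σ := PtSub.ext rfl (C.id_comp _)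
  comp_id σ := PtSub.ext rfl (C.comp_id _)
  assoc σ δ ν := PtSub.ext rfl (C.assoc _ _ _)
  emp := ⟨(pshBase C).emp, C.emp, ()⟩
  eps X := ⟨(pshBase C).eps X.psh, C.eps X.obj, rfl⟩
  eps_uniq σ := PtSub.ext rfl (C.eps_uniq _)

/-- The object-level family structure over presheaves with a chosen element. The chosen element of
an extended context is the generic one. -/
abbrev ptFam (F : Fam C) : Fam (ptBase C) where
  Ty j X := PSub X.psh (tyPsh F j)
  Tm j X := PSub X.psh (tmPsh F j)
  tyOf := (objPshFam F).tyOf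
  tySub A σ := (objPshFam F).tySub A σ.psh
  tmSub t σ := (objPshFam F).tmSub t σ.psh
  tyOf_tmSub t σ := (objPshFam F).tyOf_tmSub t σ.psh
  tySub_id := (objPshFam F).tySub_id
  tySub_comp A σ δ := (objPshFam F).tySub_comp A σ.psh δ.psh
  tmSub_id := (objPshFam F).tmSub_id
  tmSub_comp t σ δ := (objPshFam F).tmSub_comp t σ.psh δ.psh
  ext X A := ⟨oExt X.psh A, F.ext X.obj (A.app X.elt), new A X.elt⟩
  p A := ⟨(objPshFam F).p A, F.p _, rfl⟩
  q := (objPshFam F).q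
  tyOf_q := (objPshFam F).tyOf_q
  pair {j X Y} σ A t h := ⟨(objPshFam F).pair σ.psh A t h,
    F.pair σ.obj (A.app Y.elt) (t.app X.elt)
      ((tyOf_app_eq h X.elt).trans ((congrArg A.app σ.elt).trans (nat_ty A _ _))),
    by
      rw [res_new_pair]
      exact Subtype.ext (Prod.ext σ.elt rfl)⟩
  p_pair σ A t h := PtSub.ext rfl (F.p_pair _ _ _ _)
  q_pair _ _ _ _ := rfl
  pair_eta {j X Y} A τ := PtSub.ext rfl (by
    refine Eq.trans ?_ (F.pair_eta _ τ.obj)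
    apply F.pair_congr
    · rfl
    · exact congrArg (fun x => x.1.2) τ.elt)
  univ :=
    { U := fun j X => (objPshFam F).univ.U j X.psh
      U_sub := fun _ _ _ _ => rfl
      El := (objPshFam F).univ.El
      code := (objPshFam F).univ.code
      tyOf_code := (objPshFam F).univ.tyOf_code
      El_code := (objPshFam F).univ.El_code
      code_El := (objPshFam F).univ.code_El
      code_sub := fun _ _ => rfl }
  sg :=
    { Sg := (objPshFam F).sg.Sg
      Sg_sub := fun A B σ => (objPshFam F).sg.Sg_sub A B σ.psh
      tup := (objPshFam F).sg.tup
      fst := (objPshFam F).sg.fst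
      snd := (objPshFam F).sg.snd
      tyOf_tup := (objPshFam F).sg.tyOf_tup
      tyOf_fst := (objPshFam F).sg.tyOf_fst
      tyOf_snd := (objPshFam F).sg.tyOf_snd
      fst_tup := (objPshFam F).sg.fst_tup
      snd_tup := (objPshFam F).sg.snd_tup
      tup_eta := (objPshFam F).sg.tup_eta
      tup_sub := fun A B t w ht hw σ => (objPshFam F).sg.tup_sub A B t w ht hw σ.psh }
  pi :=
    { Pi := (objPshFam F).pi.Pi
      Pi_sub := fun A B σ => (objPshFam F).pi.Pi_sub A B σ.psh
      lam := (objPshFam F).pi.lam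
      app := (objPshFam F).pi.app
      tyOf_lam := (objPshFam F).pi.tyOf_lam
      tyOf_app := (objPshFam F).pi.tyOf_app
      app_lam := (objPshFam F).pi.app_lam
      lam_app := (objPshFam F).pi.lam_app
      lam_sub := fun A t σ => (objPshFam F).pi.lam_sub A t σ.psh }
  nat :=
    { Nat := fun j X => (objPshFam F).nat.Nat j X.psh
      Nat_sub := fun _ _ _ _ => rfl
      zero := fun j X => (objPshFam F).nat.zero j X.psh
      tyOf_zero := fun j X => (objPshFam F).nat.tyOf_zero j X.psh
      zero_sub := fun _ _ _ _ => rfl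
      suc := (objPshFam F).nat.suc
      tyOf_suc := (objPshFam F).nat.tyOf_suc
      suc_sub := fun t h σ => (objPshFam F).nat.suc_sub t h σ.psh
      elim := (objPshFam F).nat.elim
      tyOf_elim := (objPshFam F).nat.tyOf_elim
      elim_zero := (objPshFam F).nat.elim_zero
      elim_suc := (objPshFam F).nat.elim_suc
      elim_sub := fun P z s t hz hs ht σ => (objPshFam F).nat.elim_sub P z s t hz hs ht σ.psh }

/-- The model of the object theory in presheaves with a chosen element. -/
abbrev ptModel (M : ObjModel.{0, 0}) : ObjModel.{1, 0} where
  base := ptBase M.base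
  fam _ := ptFam M.objFam
  lifting l := l.elim

/-- Forgetting the chosen element. -/
abbrev ptToPsh (K : SetHierarchy) (M : ObjModel.{0, 0}) [Countable M.base.Con]
    [∀ a b, Countable (M.base.Sub a b)] [∀ j a, Countable (M.objFam.Tm j a)] :
    Hom (ptModel M) (pshModel K M).reduct where
  base :=
    { con := fun X => X.psh
      sub := fun σ => σ.psh
      sub_id := fun _ => rfl
      sub_comp := fun _ _ => rfl
      con_emp := rfl }
  fam _ :=
    { ty := fun A => A
      tm := fun t => t
      tyOf_tm := fun _ => rfl
      ty_sub := fun _ _ => rfl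
      tm_sub := fun _ _ => rfl
      con_ext := fun _ => rfl
      sub_p := fun _ => HEq.rfl
      tm_q := fun _ => HEq.rfl
      ty_U := fun _ _ => rfl
      tm_code := fun _ => rfl
      ty_Sg := fun A B B' e => by
        obtain rfl := eq_of_heq e
        rfl
      tm_tup := fun A B t w ht hw B' ht' hw' e => by
        obtain rfl := eq_of_heq e
        rfl
      ty_Pi := fun A B B' e => by
        obtain rfl := eq_of_heq e
        rfl
      tm_lam := fun A t t' e => by
        obtain rfl := eq_of_heq e
        rfl
      ty_Nat := fun _ _ => rfl
      tm_zero := fun _ _ => rfl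
      tm_suc := fun _ _ => rfl
      tm_elim := fun P z s t hz hs ht P' s' hz' hs' ht' eP es => by
        obtain rfl := eq_of_heq eP
        obtain rfl := eq_of_heq es
        rfl }
  ty_lift l := l.elim
  tm_quote l := l.elim

/-- Keeping only the chosen object, and the value of types and terms at the chosen element. -/
abbrev ptToSyn (M : ObjModel.{0, 0}) : Hom (ptModel M) (liftCon M) where
  base :=
    { con := fun X => ⟨X.obj⟩
      sub := fun σ => σ.obj
      sub_id := fun _ => rfl
      sub_comp := fun _ _ => rfl
      con_emp := rfl }
  fam _ :=
    { ty := fun {j X} A => A.app X.elt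
      tm := fun {j X} t => t.app X.elt
      tyOf_tm := fun _ => rfl
      ty_sub := fun A σ => (congrArg A.app σ.elt).trans (nat_ty A _ _)
      tm_sub := fun t σ => (congrArg t.app σ.elt).trans (nat_tm t _ _)
      con_ext := fun _ => rfl
      sub_p := fun _ => HEq.rfl
      tm_q := fun _ => HEq.rfl
      ty_U := fun _ _ => rfl
      tm_code := fun _ => rfl
      ty_Sg := fun A B B' e => by
        obtain rfl := eq_of_heq e
        rfl
      tm_tup := fun A B t w ht hw B' ht' hw' e => by
        obtain rfl := eq_of_heq e
        rfl
      ty_Pi := fun A B B' e => by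
        obtain rfl := eq_of_heq e
        rfl
      tm_lam := fun A t t' e => by
        obtain rfl := eq_of_heq e
        rfl
      ty_Nat := fun _ _ => rfl
      tm_zero := fun _ _ => rfl
      tm_suc := fun _ _ => rfl
      tm_elim := fun P z s t hz hs ht P' s' hz' hs' ht' eP es => by
        obtain rfl := eq_of_heq eP
        obtain rfl := eq_of_heq es
        rfl }
  ty_lift l := l.elim
  tm_quote l := l.elim

end Pointed

/-! ### The syntaxes, embedding and evaluation -/

section Staging

instance : Countable Level :=
  Function.Injective.countable (f := fun l : Level => match l with | .obj => true | .mta => false)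
    (by intro a b h; cases a <;> cases b <;> first | rfl | cases h)

instance : Countable twoStages.Stage := inferInstanceAs (Countable Level)

instance : Countable twoStages.Lift := inferInstanceAs (Countable Unit)

instance : Countable oneStage.Stage := inferInstanceAs (Countable Unit)

instance : Countable oneStage.Lift := inferInstanceAs (Countable Empty)

/-- The syntax of two-level type theory. -/
noncomputable abbrev Syn2 : TwoModel.{0, 0} := Syn twoStages

/-- The syntax of the object theory. -/
noncomputable abbrev SynO : ObjModel.{0, 0} := Syn oneStage

/-- Object-level types of two-level type theory. -/
abbrev Ty0 (j : ℕ) (Γ : Syn2.base.Con) : Type := (Syn2.fam .obj).Ty j Γ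

/-- Object-level terms of two-level type theory. -/
abbrev Tm0 (j : ℕ) (Γ : Syn2.base.Con) : Type := (Syn2.fam .obj).Tm j Γ

/-- Types of the object theory. -/
abbrev TyO (j : ℕ) (Γ : SynO.base.Con) : Type := SynO.objFam.Ty j Γ

/-- Terms of the object theory. -/
abbrev TmO (j : ℕ) (Γ : SynO.base.Con) : Type := SynO.objFam.Tm j Γ

/-- The embedding of the object theory into two-level type theory: the morphism of models from
the syntax of the object theory to the object-level part of the syntax of two-level type theory. -/
noncomputable abbrev emb : Hom SynO (liftCon Syn2.reduct) := eval _

/-- Embedding of contexts. -/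
noncomputable abbrev embCon (Γ : SynO.base.Con) : Syn2.base.Con := (emb.base.con Γ).down

/-- Embedding of types. -/
noncomputable abbrev embTy {j : ℕ} {Γ : SynO.base.Con} (A : TyO j Γ) : Ty0 j (embCon Γ) :=
  (emb.fam ()).ty A

/-- Embedding of terms. -/
noncomputable abbrev embTm {j : ℕ} {Γ : SynO.base.Con} (t : TmO j Γ) : Tm0 j (embCon Γ) :=
  (emb.fam ()).tm t

variable (K : SetHierarchy)

/-- The presheaf model over the syntax of the object theory. -/
noncomputable abbrev PshO : TwoModel.{1, 0} := pshModel K SynO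

/-- The evaluation morphism. -/
noncomputable abbrev E : Hom Syn2 (PshO K) := eval _

/-- Evaluation of embedded contexts. -/
noncomputable abbrev EEmb (Γ : SynO.base.Con) : Psh SynO.base := (E K).base.con (embCon Γ)

/-- Evaluation of object-level types. -/
noncomputable abbrev ETy {j : ℕ} {Γ : Syn2.base.Con} (A : Ty0 j Γ) :
    PSub ((E K).base.con Γ) (tyPsh SynO.objFam j) :=
  ((E K).fam .obj).ty A

/-- Evaluation of object-level terms. -/
noncomputable abbrev ETm {j : ℕ} {Γ : Syn2.base.Con} (t : Tm0 j Γ) :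
    PSub ((E K).base.con Γ) (tmPsh SynO.objFam j) :=
  ((E K).fam .obj).tm t

/-- The generic environment, over an object which is built along with it, by recursion on the
length of object-theoretic contexts. -/
noncomputable def preEnv : ∀ (n : ℕ) (Γ : (tele (prodModel fun M : Model.{1, 0} oneStage => M) n).1),
    Σ a : SynO.base.Con, (EEmb K ⟨n, Γ⟩).obj a
  | 0, _ => ⟨SynO.base.emp, ()⟩
  | n + 1, x => ⟨SynO.objFam.ext (preEnv n x.1).1
      ((ETy K (embTy (Γ := ⟨n, x.1⟩) x.2.2.2)).app (preEnv n x.1).2),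
      new (ETy K (embTy (Γ := ⟨n, x.1⟩) x.2.2.2)) (preEnv n x.1).2⟩

/-- The evaluation of embedded types and terms agrees with the evaluation of the syntax of the
object theory in the object-level part of the presheaf model. -/
theorem EEmb_eq (Γ : SynO.base.Con) : EEmb K Γ = evCon (PshO K).reduct Γ :=
  evCon_nat (M := liftCon Syn2.reduct) (E K).reduct.ofLift Γ

theorem ETy_embTy_heq {j : ℕ} {Γ : SynO.base.Con} (A : TyO j Γ) :
    HEq (ETy K (embTy A)) (evTy (PshO K).reduct A) :=
  evTy_nat (M := liftCon Syn2.reduct) (E K).reduct.ofLift A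

theorem evPt_psh (Γ : SynO.base.Con) : (evCon (ptModel SynO) Γ).psh = EEmb K Γ :=
  (evCon_nat (ptToPsh K SynO) Γ).trans (EEmb_eq K Γ).symm

theorem evPt_ty {j : ℕ} {Γ : SynO.base.Con} (A : TyO j Γ) :
    HEq (evTy (ptModel SynO) A) (ETy K (embTy A)) :=
  (evTy_nat (ptToPsh K SynO) A).trans (ETy_embTy_heq K A).symm

theorem ptCon_ext_congr {C : Base.{0, 0}} {F : Fam C} {j : ℕ} (x : PtCon C) (X : Psh C) (a : C.Con)
    (γ : X.obj a) (e : x = ⟨X, a, γ⟩) (A : PSub x.psh (tyPsh F j)) (B : PSub X (tyPsh F j))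
    (h : HEq A B) : (ptFam F).ext x A = ⟨oExt X B, F.ext a (B.app γ), new B γ⟩ := by
  subst e
  obtain rfl := eq_of_heq h
  rfl

theorem evPt_eq (Γ : SynO.base.Con) : evCon (ptModel SynO) Γ =
    ⟨EEmb K Γ, (preEnv K Γ.1 Γ.2).1, (preEnv K Γ.1 Γ.2).2⟩ := by
  induction Γ using SCon.ind with
  | emp => rfl
  | ext i j Γ A ih => exact ptCon_ext_congr _ _ _ _ ih _ _ (evPt_ty K A)

/-- The generic environment lives over the given context. -/
theorem preEnv_fst (Γ : SynO.base.Con) : (preEnv K Γ.1 Γ.2).1 = Γ := by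
  have h := congrArg ULift.down (evCon_nat (ptToSyn SynO) Γ)
  rw [evPt_eq K, evSyn_con] at h
  exact h

/-- Transport along an equality of objects. -/
def castObj {C : Base.{0, 0}} {X : Psh C} (x : Σ a, X.obj a) {a : C.Con} (e : x.1 = a) : X.obj a :=
  e ▸ x.2

/-- The generic environment `Γ^P`. -/
noncomputable def genEnv (Γ : SynO.base.Con) : (EEmb K Γ).obj Γ :=
  castObj (X := EEmb K Γ) (preEnv K Γ.1 Γ.2) (preEnv_fst K Γ)

theorem mk_genEnv (Γ : SynO.base.Con) :
    (⟨Γ, genEnv K Γ⟩ : Σ a, (EEmb K Γ).obj a) = preEnv K Γ.1 Γ.2 := by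
  have key : ∀ (x : Σ a, (EEmb K Γ).obj a) (a : SynO.base.Con) (e : x.1 = a),
      (⟨a, castObj x e⟩ : Σ a, (EEmb K Γ).obj a) = x := by
    rintro x a rfl
    rfl
  exact key _ _ (preEnv_fst K Γ)

/-- Evaluating an embedded type at the generic environment gives back the type. -/
theorem ETy_genEnv {j : ℕ} {Γ : SynO.base.Con} (A : TyO j Γ) :
    (ETy K (embTy A)).app (genEnv K Γ) = A := by
  have h : HEq ((evTy (ptModel SynO) A).app (evCon (ptModel SynO) Γ).elt) A :=
    (evTy_nat (ptToSyn SynO) A).trans (evSyn_ty A)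
  have key : ∀ (x : PtCon SynO.base) (B : PSub x.psh (tyPsh SynO.objFam j)),
      x = ⟨EEmb K Γ, Γ, genEnv K Γ⟩ → HEq B (ETy K (embTy A)) → HEq (B.app x.elt) A →
      (ETy K (embTy A)).app (genEnv K Γ) = A := by
    intro x B e e' e''
    subst e
    obtain rfl := eq_of_heq e'
    exact eq_of_heq e''
  refine key _ _ ((evPt_eq K Γ).trans ?_) (evPt_ty K A) h
  have e := mk_genEnv K Γ
  generalize preEnv K Γ.1 Γ.2 = y at e
  subst e
  rfl

/-- The generic environment of the empty context. -/
theorem genEnv_emp : genEnv K SynO.base.emp = () := rfl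

/-- The generic environment of an extended context: `(Γ ▹ A)^P = (Γ^P[p], q)`. -/
theorem genEnv_ext {j : ℕ} {Γ : SynO.base.Con} (A : TyO j Γ) :
    (genEnv K (SynO.objFam.ext Γ A)).1 =
      ((EEmb K Γ).res (genEnv K Γ) (SynO.objFam.p A), SynO.objFam.q A) := by
  have h := mk_genEnv K (SynO.objFam.ext Γ A)
  have h' : preEnv K (SynO.objFam.ext Γ A).1 (SynO.objFam.ext Γ A).2 =
      ⟨SynO.objFam.ext (preEnv K Γ.1 Γ.2).1 ((ETy K (embTy A)).app (preEnv K Γ.1 Γ.2).2),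
        new (ETy K (embTy A)) (preEnv K Γ.1 Γ.2).2⟩ := rfl
  rw [h', ← mk_genEnv K Γ] at h
  have key : ∀ (B : TyO j Γ) (_ : B = A) (γ : (EEmb K (SynO.objFam.ext Γ A)).obj
      (SynO.objFam.ext Γ B)), γ.1 = ((EEmb K Γ).res (genEnv K Γ) (SynO.objFam.p B), SynO.objFam.q B) →
      (⟨SynO.objFam.ext Γ A, genEnv K (SynO.objFam.ext Γ A)⟩ :
        Σ a, (EEmb K (SynO.objFam.ext Γ A)).obj a) = ⟨_, γ⟩ →
      (genEnv K (SynO.objFam.ext Γ A)).1 =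
        ((EEmb K Γ).res (genEnv K Γ) (SynO.objFam.p A), SynO.objFam.q A) := by
    intro B e γ e' e''
    subst e
    rw [eq_of_heq (Sigma.mk.inj e'').2, e']
  exact key _ (ETy_genEnv K A) _ rfl h

/-- Staging of types. -/
noncomputable def stageTy {j : ℕ} {Γ : SynO.base.Con} (A : Ty0 j (embCon Γ)) : TyO j Γ :=
  (ETy K A).app (genEnv K Γ)

/-- Staging of terms. -/
noncomputable def stageTm {j : ℕ} {Γ : SynO.base.Con} (t : Tm0 j (embCon Γ)) : TmO j Γ :=
  (ETm K t).app (genEnv K Γ)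

end Staging

end TwoLevel

/-!
Staging is the evaluation of the syntax of two-level type theory in presheaves over the syntax of
the object theory, at the generic environment. On the image of the embedding, evaluation at the
generic environment is inverse to the embedding: for types this is `TwoLevel.ETy_genEnv`, and for
terms `TwoLevel.ETm_genEnv`. It therefore suffices that the embedding is full, that is, surjective
on object-level types and terms over embedded contexts (`TwoLevel.embTy_surjective` and
`TwoLevel.embTm_surjective`): if `A` is the image of `B`, then staging `A` yields `B`, whose image
is `A`.

Fullness is proved by a logical relation between the syntax and the presheaf model, packaged as a
model of two-level type theory glued along the embedding (`TwoLevel.gModel`). A glued context is a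
syntactic context `Δ` with a presheaf, each element of which over an object `Γ` carries a
substitution from the image of `Γ` to `Δ`, its environment. A glued object-level type is a syntactic
type with a natural transformation to the types of the object theory, whose values embed to the
instances of the syntactic type at environments; object-level terms are glued in the same way. A
glued meta-level type is a syntactic type with a displayed presheaf, each element of which has an
underlying syntactic term, and the terms are sections whose values are underlain by the instances of
a syntactic term. All type formers extend those of the presheaf model. Numbers are underlain by
numerals; elements of function types are glued terms of the codomain over the extension of a
represented context, and are underlain by abstractions; elements of universes are glued types over
represented contexts, and are underlain by codes; elements of lifted types are underlain by
quotations. The sets concerned are small enough since the syntax is countable.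

The glued model projects onto the syntax of two-level type theory (`TwoLevel.gProj`). By uniqueness
of morphisms out of the syntax, the value of a type `A` in the glued model is therefore a glued type
over `A` itself. By induction on a context `Γ` of the object theory, the value of its image contains
an element over `Γ` with the identity as its environment (`TwoLevel.hasGeneric_emb`); the extension
step uses that the embedding is injective on types. At this element, the value of `A` is a type of
the object theory which embeds to `A[id] = A`, and similarly for terms.
-/

namespace TwoLevel

/-! ### Liftings under a binder -/

theorem CwF.upTo_comp_inst_eq_pair {D : Base.{u, v}} (G : CwF D) {j : ℕ} {Γ Δ : D.Con}
    (σ : D.Sub Γ Δ) (A : G.Ty j Δ) (A' : G.Ty j Γ) (h : A' = G.tySub A σ) (t : G.Tm j Γ)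
    (ht : G.tyOf t = A') :
    D.comp (G.upTo σ A A' h) (G.inst A' t ht) = G.pair σ A t (ht.trans h) := by
  unfold CwF.upTo CwF.inst
  rw [G.pair_comp]
  apply G.pair_congr
  · rw [D.assoc, G.p_pair, D.comp_id]
  · rw [G.q_pair]

theorem CwF.upTo_comp {D : Base.{u, v}} (G : CwF D) {j : ℕ} {Γ Δ Θ : D.Con}
    (σ : D.Sub Δ Θ) (δ : D.Sub Γ Δ) (A : G.Ty j Θ) (A' : G.Ty j Δ) (A'' : G.Ty j Γ)
    (h : A' = G.tySub A σ) (h' : A'' = G.tySub A' δ) (h'' : A'' = G.tySub A (D.comp σ δ)) :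
    D.comp (G.upTo σ A A' h) (G.upTo δ A' A'' h') = G.upTo (D.comp σ δ) A A'' h'' := by
  unfold CwF.upTo
  rw [G.pair_comp]
  apply G.pair_congr
  · rw [D.assoc, G.p_pair, D.assoc]
  · rw [G.q_pair]

theorem CwF.tySub_heq_congr {D : Base.{u, v}} (G : CwF D) {j : ℕ} {Γ Γ' Δ : D.Con}
    (A : G.Ty j Δ) (e : Γ = Γ') {σ : D.Sub Γ Δ} {σ' : D.Sub Γ' Δ} (h : HEq σ σ') :
    HEq (G.tySub A σ) (G.tySub A σ') := by
  subst e
  obtain rfl := eq_of_heq h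
  rfl

theorem CwF.tmSub_heq_congr {D : Base.{u, v}} (G : CwF D) {j : ℕ} {Γ Γ' Δ : D.Con}
    (t : G.Tm j Δ) (e : Γ = Γ') {σ : D.Sub Γ Δ} {σ' : D.Sub Γ' Δ} (h : HEq σ σ') :
    HEq (G.tmSub t σ) (G.tmSub t σ') := by
  subst e
  obtain rfl := eq_of_heq h
  rfl

/-- A functor which preserves comprehension sends a substitution out of `a ▹ B` of the form
`(σ ∘ p, q)` to the lifting of `σ` under a binder. -/
theorem CwF.pair_heq_upTo {D : Base.{u, v}} (G : CwF D) {j : ℕ} {Γ Δ X : D.Con}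
    (σ : D.Sub Γ Δ) (A : G.Ty j Δ) (A' : G.Ty j Γ) (h : A' = G.tySub A σ)
    (eX : X = G.ext Γ A') (p' : D.Sub X Γ) (hp : HEq p' (G.p A')) (q' : G.Tm j X)
    (hq : HEq q' (G.q A')) (h') :
    HEq (G.pair (D.comp σ p') A q' h') (G.upTo σ A A' h) := by
  subst eX
  obtain rfl := eq_of_heq hp
  obtain rfl := eq_of_heq hq
  rfl

theorem NatIntro.sucSub_comp_pair {C : Base.{u, v}} {F : CwF C} (N : NatIntro F) {j k : ℕ}
    {Γ : C.Con} (P : F.Ty k (F.ext Γ (N.Nat j Γ))) (t : F.Tm j Γ) (ht : F.tyOf t = N.Nat j Γ)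
    (w : F.Tm k Γ) (hw : F.tyOf w = F.tySub P (F.inst (N.Nat j Γ) t ht)) :
    C.comp (N.sucSub P) (F.pair (F.inst (N.Nat j Γ) t ht) P w hw) =
      F.inst (N.Nat j Γ) (N.suc t ht) (N.tyOf_suc t ht) := by
  have key : ∀ (x : F.Tm j Γ) (hx : F.tyOf x = N.Nat j Γ), x = t → N.suc x hx = N.suc t ht := by
    intro x hx e
    subst e
    rfl
  unfold NatIntro.sucSub
  rw [F.pair_comp]
  refine F.pair_congr _ _ ?_ ?_
  · rw [C.assoc, F.p_pair]
    exact F.p_pair _ _ _ _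
  · rw [N.suc_sub]
    refine key _ _ ?_
    rw [← F.tmSub_comp, F.p_pair]
    exact F.q_pair _ _ _ _

/-! ### Glued contexts -/

section GluedBase

variable {C : Base.{0, 0}} {D : Base.{1, 0}} (H : BaseHom C D)

/-- Glued contexts: a context of `D` and a presheaf over `C`, each element of which carries an
environment, that is, a substitution from an object in the image of `H`. In other words, a presheaf
over `C` with a natural transformation to the presheaf `a ↦ D.Sub (H.con a) con`. -/
structure GCon where
  con : D.Con
  psh : Psh C
  env : ∀ {a : C.Con}, psh.obj a → D.Sub (H.con a) con
  env_res : ∀ {a b : C.Con} (γ : psh.obj b) (f : C.Sub a b),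
    env (psh.res γ f) = D.comp (env γ) (H.sub f)

variable {H}

/-- Glued substitutions: a substitution and a natural transformation which is compatible with
environments. -/
@[ext]
structure GSub (X Y : GCon H) where
  sub : D.Sub X.con Y.con
  psh : PSub X.psh Y.psh
  env_app : ∀ {a : C.Con} (γ : X.psh.obj a), Y.env (psh.app γ) = D.comp sub (X.env γ)

variable (H)

/-- The category of glued contexts. -/
abbrev gBase : Base.{1, 0} where
  Con := GCon H
  Sub := GSub
  id X := ⟨D.id X.con, PSub.id X.psh, fun _ => (D.id_comp _).symm⟩
  comp σ δ := ⟨D.comp σ.sub δ.sub, σ.psh.comp δ.psh, fun γ =>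
    (σ.env_app _).trans ((congrArg (D.comp σ.sub) (δ.env_app γ)).trans (D.assoc _ _ _).symm)⟩
  id_comp _ := GSub.ext (D.id_comp _) rfl
  comp_id _ := GSub.ext (D.comp_id _) rfl
  assoc _ _ _ := GSub.ext (D.assoc _ _ _) rfl
  emp := ⟨D.emp, (pshBase C).emp, fun _ => D.eps _, fun _ _ => (D.eps_uniq _).symm⟩
  eps X := ⟨D.eps X.con, (pshBase C).eps X.psh, fun _ => (D.eps_uniq _).symm⟩
  eps_uniq _ := GSub.ext (D.eps_uniq _) rfl

end GluedBase

/-! ### Glued object-level types and terms -/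

section GluedObject

variable {C : Base.{0, 0}} {D : Base.{1, 0}} {H : BaseHom C D} {F : Fam C} {G : Fam D}
  (f : FamHom H F G)

/-- Glued object-level types: a type `A` of `G` and a natural transformation to the types of `F`
which `f` maps to the instances of `A` at environments. -/
@[ext]
structure GOTy (j : ℕ) (X : GCon H) where
  ty : G.Ty j X.con
  psh : PSub X.psh (tyPsh F j)
  comm : ∀ {a : C.Con} (γ : X.psh.obj a), f.ty (psh.app γ) = G.tySub ty (X.env γ)

/-- Glued object-level terms: a term `t` of `G` and a natural transformation to the terms of `F`
which `f` maps to the instances of `t` at environments. -/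
@[ext]
structure GOTm (j : ℕ) (X : GCon H) where
  tm : G.Tm j X.con
  psh : PSub X.psh (tmPsh F j)
  comm : ∀ {a : C.Con} (γ : X.psh.obj a), f.tm (psh.app γ) = G.tmSub tm (X.env γ)

variable {f} {j k : ℕ} {X Y : GCon H}

theorem GOTy.tyOf_elt (A : GOTy f j X) {a : C.Con} (x : (oExt X.psh A.psh).obj a) :
    G.tyOf (f.tm x.1.2) = G.tySub A.ty (X.env x.1.1) := by
  rw [f.tyOf_tm, x.2, A.comm]

/-- Extension of a glued context by a glued object-level type. -/
abbrev goExt (X : GCon H) (A : GOTy f j X) : GCon H where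
  con := G.ext X.con A.ty
  psh := oExt X.psh A.psh
  env x := G.pair (X.env x.1.1) A.ty (f.tm x.1.2) (A.tyOf_elt x)
  env_res x g := by
    rw [G.pair_comp]
    exact G.pair_congr _ _ (X.env_res _ _) (f.tm_sub _ _)

variable (f)

/-- The family structure of glued object-level types and terms. -/
abbrev goCwF : CwF (gBase H) where
  Ty j X := GOTy f j X
  Tm j X := GOTm f j X
  tyOf t := ⟨G.tyOf t.tm, (objCwF F).tyOf t.psh, fun γ =>
    (f.tyOf_tm _).symm.trans ((congrArg G.tyOf (t.comm γ)).trans (G.tyOf_tmSub _ _))⟩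
  tySub A σ := ⟨G.tySub A.ty σ.sub, A.psh.comp σ.psh, fun γ =>
    (A.comm _).trans ((congrArg (G.tySub A.ty) (σ.env_app γ)).trans (G.tySub_comp _ _ _))⟩
  tmSub t σ := ⟨G.tmSub t.tm σ.sub, t.psh.comp σ.psh, fun γ =>
    (t.comm _).trans ((congrArg (G.tmSub t.tm) (σ.env_app γ)).trans (G.tmSub_comp _ _ _))⟩
  tyOf_tmSub _ _ := GOTy.ext (G.tyOf_tmSub _ _) rfl
  tySub_id _ := GOTy.ext (G.tySub_id _) rfl
  tySub_comp _ _ _ := GOTy.ext (G.tySub_comp _ _ _) rfl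
  tmSub_id _ := GOTm.ext (G.tmSub_id _) rfl
  tmSub_comp _ _ _ := GOTm.ext (G.tmSub_comp _ _ _) rfl
  ext X A := goExt X A
  p A := ⟨G.p A.ty, (objCwF F).p A.psh, fun _ => (G.p_pair _ _ _ _).symm⟩
  q A := ⟨G.q A.ty, (objCwF F).q A.psh, fun _ => (G.q_pair _ _ _ _).symm⟩
  tyOf_q A := GOTy.ext (G.tyOf_q _) ((objCwF F).tyOf_q A.psh)
  pair σ A t h := ⟨G.pair σ.sub A.ty t.tm (congrArg GOTy.ty h),
    (objCwF F).pair σ.psh A.psh t.psh (congrArg GOTy.psh h), fun γ => by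
      rw [G.pair_comp]
      exact G.pair_congr _ _ (σ.env_app γ) (t.comm γ)⟩
  p_pair _ _ _ _ := GSub.ext (G.p_pair _ _ _ _) rfl
  q_pair _ _ _ _ := GOTm.ext (G.q_pair _ _ _ _) rfl
  pair_eta _ _ := GSub.ext (G.pair_eta _ _) rfl

variable {f}

/-- The environment of the generic element of an extended glued context is a lifting under a
binder. -/
theorem env_new_heq (A : GOTy f j X) {a : C.Con} (γ : X.psh.obj a) :
    HEq ((goExt X A).env (new A.psh γ))
      (G.upTo (X.env γ) A.ty (f.ty (A.psh.app γ)) (A.comm γ)) := by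
  have e : (goExt X A).env (new A.psh γ) =
      G.pair (D.comp (X.env γ) (H.sub (F.p (A.psh.app γ)))) A.ty (f.tm (F.q (A.psh.app γ)))
        (by rw [f.tyOf_tm, F.tyOf_q, f.ty_sub, A.comm, G.tySub_comp]) :=
    G.pair_congr _ _ (X.env_res _ _) rfl
  rw [e]
  exact G.pair_heq_upTo _ _ _ _ (f.con_ext _) _ (f.sub_p _) _ (f.tm_q _) _

/-- The value at the generic element of a glued type over an extended context. -/
theorem GOTy.comm_new (A : GOTy f j X) (B : GOTy f k (goExt X A)) {a : C.Con}
    (γ : X.psh.obj a) : HEq (f.ty (B.psh.app (new A.psh γ)))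
      (G.tySub B.ty (G.upTo (X.env γ) A.ty (f.ty (A.psh.app γ)) (A.comm γ))) :=
  (heq_of_eq (B.comm _)).trans
    (G.tySub_heq_congr B.ty (f.con_ext _) (env_new_heq A γ))

/-- The value at the generic element of a glued term over an extended context. -/
theorem GOTm.comm_new (A : GOTy f j X) (t : GOTm f k (goExt X A)) {a : C.Con}
    (γ : X.psh.obj a) : HEq (f.tm (t.psh.app (new A.psh γ)))
      (G.tmSub t.tm (G.upTo (X.env γ) A.ty (f.ty (A.psh.app γ)) (A.comm γ))) :=
  (heq_of_eq (t.comm _)).trans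
    (G.tmSub_heq_congr t.tm (f.con_ext _) (env_new_heq A γ))

theorem GOTm.tm_ty {t : GOTm f j X} {A : GOTy f j X} (h : (goCwF f).tyOf t = A) :
    G.tyOf t.tm = A.ty := congrArg GOTy.ty h

theorem GOTm.psh_ty {t : GOTm f j X} {A : GOTy f j X} (h : (goCwF f).tyOf t = A) :
    (objCwF F).tyOf t.psh = A.psh := congrArg GOTy.psh h

theorem GOTm.tyOf_app {t : GOTm f j X} {A : GOTy f j X} (h : (goCwF f).tyOf t = A) {a : C.Con}
    (γ : X.psh.obj a) : F.tyOf (t.psh.app γ) = A.psh.app γ :=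
  tyOf_app_eq (GOTm.psh_ty h) γ

variable (f)

/-- Universes of glued object-level types. -/
abbrev goU : UStr (goCwF f) where
  U j X := ⟨G.univ.U j X.con, (objU F).U j X.psh, fun {a} _ =>
    (f.ty_U j a).trans (G.univ.U_sub _ _).symm⟩
  U_sub _ _ _ _ := GOTy.ext (G.univ.U_sub _ _) rfl
  El t h := ⟨G.univ.El t.tm (GOTm.tm_ty h), (objU F).El t.psh (GOTm.psh_ty h), fun {a} γ =>
    (eq_of_heq (f.El_heq _ (GOTm.tyOf_app h γ) rfl _ (by
        rw [f.tyOf_tm]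
        exact (congrArg f.ty (GOTm.tyOf_app h γ)).trans (f.ty_U _ _)) HEq.rfl)).trans
      (G.El_sub' _ _ (GOTm.tm_ty h) _ _ (t.comm γ))⟩
  code A := ⟨G.univ.code A.ty, (objU F).code A.psh, fun γ =>
    (f.tm_code _).trans ((congrArg G.univ.code (A.comm γ)).trans (G.univ.code_sub _ _).symm)⟩
  tyOf_code A := GOTy.ext (G.univ.tyOf_code _) ((objU F).tyOf_code _)
  El_code A := GOTy.ext (G.univ.El_code _) ((objU F).El_code _)
  code_El t h := GOTm.ext (G.univ.code_El _ (GOTm.tm_ty h)) ((objU F).code_El _ (GOTm.psh_ty h))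
  code_sub _ _ := GOTm.ext (G.univ.code_sub _ _) rfl

/-- Function types of glued object-level types. -/
abbrev goPi : PiStr (goCwF f) where
  Pi A B := ⟨G.pi.Pi A.ty B.ty, (objPi F).Pi A.psh B.psh, fun γ =>
    (f.ty_Pi _ _ _ (GOTy.comm_new A B γ)).trans (G.Pi_sub' _ _ _ (A.comm γ) _).symm⟩
  Pi_sub A B σ := GOTy.ext (G.pi.Pi_sub _ _ _) ((objPi F).Pi_sub _ _ _)
  lam A t := ⟨G.pi.lam A.ty t.tm, (objPi F).lam A.psh t.psh, fun γ =>
    (f.tm_lam _ _ _ (GOTm.comm_new A t γ)).trans (G.lam_sub' _ _ _ (A.comm γ) _).symm⟩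
  app {_ X} A B t h := ⟨G.pi.app A.ty B.ty t.tm (GOTm.tm_ty h),
    (objPi F).app A.psh B.psh t.psh (GOTm.psh_ty h), fun {a} x => by
      have ht : G.tyOf (f.tm (t.psh.app x.1.1)) = G.pi.Pi (f.ty (A.psh.app x.1.1))
          (G.tySub B.ty (G.upTo (X.env x.1.1) A.ty _ (A.comm x.1.1))) := by
        rw [f.tyOf_tm]
        exact (congrArg f.ty (GOTm.tyOf_app h x.1.1)).trans
          (f.ty_Pi _ _ _ (GOTy.comm_new A B x.1.1))
      have hu : G.tyOf (f.tm x.1.2) = f.ty (A.psh.app x.1.1) := by rw [f.tyOf_tm, x.2]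
      refine (eq_of_heq (f.tmSub_heq _ _ rfl (f.con_ext _) _ _
        (f.app_heq _ _ _ (GOTm.tyOf_app h x.1.1) rfl _ _ _ ht HEq.rfl (GOTy.comm_new A B x.1.1)
          HEq.rfl)
        (f.inst_heq _ _ x.2 rfl _ _ hu HEq.rfl HEq.rfl))).trans ?_
      rw [G.app_sub' (X.env x.1.1) A.ty _ (A.comm x.1.1) B.ty t.tm (GOTm.tm_ty h) _ rfl _ ht
        (t.comm _), ← G.tmSub_comp, G.upTo_comp_inst_eq_pair]⟩
  tyOf_lam A t := GOTy.ext (G.pi.tyOf_lam _ _) ((objPi F).tyOf_lam _ _)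
  tyOf_app A B t h := GOTy.ext (G.pi.tyOf_app _ _ _ (GOTm.tm_ty h))
    ((objPi F).tyOf_app _ _ _ (GOTm.psh_ty h))
  app_lam A t := GOTm.ext (G.pi.app_lam _ _) ((objPi F).app_lam _ _)
  lam_app A B t h := GOTm.ext (G.pi.lam_app _ _ _ (GOTm.tm_ty h))
    ((objPi F).lam_app _ _ _ (GOTm.psh_ty h))
  lam_sub A t σ := GOTm.ext (G.pi.lam_sub _ _ _) ((objPi F).lam_sub _ _ _)

/-- `Σ`-types of glued object-level types. -/
abbrev goSg : SgStr (goCwF f) where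
  Sg A B := ⟨G.sg.Sg A.ty B.ty, (objSg F).Sg A.psh B.psh, fun γ =>
    (f.ty_Sg _ _ _ (GOTy.comm_new A B γ)).trans (G.Sg_sub' _ _ _ (A.comm γ) _).symm⟩
  Sg_sub A B σ := GOTy.ext (G.sg.Sg_sub _ _ _) ((objSg F).Sg_sub _ _ _)
  tup {_ X} A B t w ht hw := ⟨G.sg.tup A.ty B.ty t.tm w.tm (GOTm.tm_ty ht) (GOTm.tm_ty hw),
    (objSg F).tup A.psh B.psh t.psh w.psh (GOTm.psh_ty ht) (GOTm.psh_ty hw), fun {a} γ => by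
      have ht' : G.tyOf (f.tm (t.psh.app γ)) = f.ty (A.psh.app γ) := by
        rw [f.tyOf_tm, GOTm.tyOf_app ht γ]
      have hw' : G.tyOf (f.tm (w.psh.app γ)) =
          G.tySub (G.tySub B.ty (G.upTo (X.env γ) A.ty (f.ty (A.psh.app γ)) (A.comm γ)))
            (G.inst (f.ty (A.psh.app γ)) (f.tm (t.psh.app γ)) ht') := by
        rw [w.comm, G.tyOf_tmSub, GOTm.tm_ty hw]
        exact G.tySub_inst _ _ _ (A.comm γ) _ _ (GOTm.tm_ty ht) _ _ (t.comm γ)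
      refine (f.tm_tup _ _ _ _ (GOTm.tyOf_app ht γ) _ _ ht' hw' (GOTy.comm_new A B γ)).trans ?_
      exact (G.tup_sub' _ _ _ (A.comm γ) _ _ _ (GOTm.tm_ty ht) (GOTm.tm_ty hw) _ rfl _ _ _ _
        (t.comm γ) (w.comm γ)).symm⟩
  fst {_ X} A B t h := ⟨G.sg.fst A.ty B.ty t.tm (GOTm.tm_ty h),
    (objSg F).fst A.psh B.psh t.psh (GOTm.psh_ty h), fun {a} γ => by
      have ht : G.tyOf (f.tm (t.psh.app γ)) = G.sg.Sg (f.ty (A.psh.app γ))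
          (G.tySub B.ty (G.upTo (X.env γ) A.ty _ (A.comm γ))) := by
        rw [f.tyOf_tm]
        exact (congrArg f.ty (GOTm.tyOf_app h γ)).trans
          (f.ty_Sg _ _ _ (GOTy.comm_new A B γ))
      exact (eq_of_heq (f.fst_heq _ _ _ (GOTm.tyOf_app h γ) rfl _ _ _ ht HEq.rfl
        (GOTy.comm_new A B γ) HEq.rfl)).trans
        (G.fst_sub' _ _ _ (A.comm γ) _ _ (GOTm.tm_ty h) _ rfl _ _ (t.comm γ))⟩
  snd {_ X} A B t h := ⟨G.sg.snd A.ty B.ty t.tm (GOTm.tm_ty h),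
    (objSg F).snd A.psh B.psh t.psh (GOTm.psh_ty h), fun {a} γ => by
      have ht : G.tyOf (f.tm (t.psh.app γ)) = G.sg.Sg (f.ty (A.psh.app γ))
          (G.tySub B.ty (G.upTo (X.env γ) A.ty _ (A.comm γ))) := by
        rw [f.tyOf_tm]
        exact (congrArg f.ty (GOTm.tyOf_app h γ)).trans
          (f.ty_Sg _ _ _ (GOTy.comm_new A B γ))
      exact (eq_of_heq (f.snd_heq _ _ _ (GOTm.tyOf_app h γ) rfl _ _ _ ht HEq.rfl
        (GOTy.comm_new A B γ) HEq.rfl)).trans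
        (G.snd_sub' _ _ _ (A.comm γ) _ _ (GOTm.tm_ty h) _ rfl _ _ (t.comm γ))⟩
  tyOf_tup A B t w ht hw := GOTy.ext
    (G.sg.tyOf_tup _ _ _ _ (GOTm.tm_ty ht) (GOTm.tm_ty hw))
    ((objSg F).tyOf_tup _ _ _ _ (GOTm.psh_ty ht) (GOTm.psh_ty hw))
  tyOf_fst A B t h := GOTy.ext (G.sg.tyOf_fst _ _ _ (GOTm.tm_ty h))
    ((objSg F).tyOf_fst _ _ _ (GOTm.psh_ty h))
  tyOf_snd A B t h := GOTy.ext (G.sg.tyOf_snd _ _ _ (GOTm.tm_ty h))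
    ((objSg F).tyOf_snd _ _ _ (GOTm.psh_ty h))
  fst_tup A B t w ht hw := GOTm.ext
    (G.sg.fst_tup _ _ _ _ (GOTm.tm_ty ht) (GOTm.tm_ty hw))
    ((objSg F).fst_tup _ _ _ _ (GOTm.psh_ty ht) (GOTm.psh_ty hw))
  snd_tup A B t w ht hw := GOTm.ext
    (G.sg.snd_tup _ _ _ _ (GOTm.tm_ty ht) (GOTm.tm_ty hw))
    ((objSg F).snd_tup _ _ _ _ (GOTm.psh_ty ht) (GOTm.psh_ty hw))
  tup_eta A B t h := GOTm.ext (G.sg.tup_eta _ _ _ (GOTm.tm_ty h))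
    ((objSg F).tup_eta _ _ _ (GOTm.psh_ty h))
  tup_sub A B t w ht hw σ := GOTm.ext (G.sg.tup_sub _ _ _ _ (GOTm.tm_ty ht) (GOTm.tm_ty hw) _)
    ((objSg F).tup_sub _ _ _ _ (GOTm.psh_ty ht) (GOTm.psh_ty hw) _)

/-- Formation and introduction rules of glued object-level natural numbers. -/
abbrev goNatIntro : NatIntro (goCwF f) where
  Nat j X := ⟨G.nat.Nat j X.con, (objNatIntro F).Nat j X.psh, fun {a} _ =>
    (f.ty_Nat j a).trans (G.nat.Nat_sub _ _).symm⟩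
  Nat_sub _ _ _ _ := GOTy.ext (G.nat.Nat_sub _ _) rfl
  zero j X := ⟨G.nat.zero j X.con, (objNatIntro F).zero j X.psh, fun {a} _ =>
    (f.tm_zero j a).trans (G.nat.zero_sub _ _).symm⟩
  tyOf_zero _ _ := GOTy.ext (G.nat.tyOf_zero _ _) ((objNatIntro F).tyOf_zero _ _)
  zero_sub _ _ _ _ := GOTm.ext (G.nat.zero_sub _ _) rfl
  suc t h := ⟨G.nat.suc t.tm (GOTm.tm_ty h), (objNatIntro F).suc t.psh (GOTm.psh_ty h), fun γ =>
    (f.tm_suc _ (GOTm.tyOf_app h γ)).trans (G.suc_sub' _ _ (GOTm.tm_ty h) _ _ (t.comm γ))⟩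
  tyOf_suc t h := GOTy.ext (G.nat.tyOf_suc _ (GOTm.tm_ty h))
    ((objNatIntro F).tyOf_suc _ (GOTm.psh_ty h))
  suc_sub _ h _ := GOTm.ext (G.nat.suc_sub _ (GOTm.tm_ty h) _) rfl

/-- The value at the generic element of a glued type over a context extended by `Nat`. -/
theorem comm_new_nat (P : GOTy f k (goExt X ((goNatIntro f).Nat j X))) {a : C.Con}
    (γ : X.psh.obj a) : HEq (f.ty (P.psh.app (new ((objNatIntro F).Nat j X.psh) γ)))
      (G.tySub P.ty (G.nat.upNat j (X.env γ))) := by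
  refine (GOTy.comm_new ((goNatIntro f).Nat j X) P γ).trans ?_
  have key : ∀ (N' : G.Ty j (H.con a)) (h' : N' = G.tySub (G.nat.Nat j X.con) (X.env γ)),
      HEq (G.tySub P.ty (G.upTo (X.env γ) (G.nat.Nat j X.con) N' h'))
        (G.tySub P.ty (G.nat.upNat j (X.env γ))) := by
    intro N' h'
    obtain rfl : N' = G.nat.Nat j (H.con a) := h'.trans (G.nat.Nat_sub j _)
    rfl
  exact key _ _

/-- The value at the generic element of a glued term over a context extended by `Nat` and a type
over it. -/
theorem comm_new_nat_new (P : GOTy f k (goExt X ((goNatIntro f).Nat j X)))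
    (s : GOTm f k (goExt (goExt X ((goNatIntro f).Nat j X)) P)) {a : C.Con} (γ : X.psh.obj a) :
    HEq (f.tm (s.psh.app (new P.psh (new ((objNatIntro F).Nat j X.psh) γ))))
      (G.tmSub s.tm (G.up (G.nat.upNat j (X.env γ)) P.ty)) := by
  refine (GOTm.comm_new P s (new ((objNatIntro F).Nat j X.psh) γ)).trans ?_
  have key : ∀ (Z Z' : D.Con) (e : Z = Z') (σ : D.Sub Z (G.ext X.con (G.nat.Nat j X.con)))
      (σ' : D.Sub Z' (G.ext X.con (G.nat.Nat j X.con))) (A : G.Ty k Z)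
      (h : A = G.tySub P.ty σ), HEq σ σ' →
      HEq (G.tmSub s.tm (G.upTo σ P.ty A h)) (G.tmSub s.tm (G.up σ' P.ty)) := by
    intro Z Z' e σ σ' A h hσ
    subst e h
    obtain rfl := eq_of_heq hσ
    rfl
  have e := (env_new_heq ((goNatIntro f).Nat j X) γ)
  have key' : ∀ (N' : G.Ty j (H.con a)) (h' : N' = G.tySub (G.nat.Nat j X.con) (X.env γ)),
      HEq (G.upTo (X.env γ) (G.nat.Nat j X.con) N' h') (G.nat.upNat j (X.env γ)) := by
    intro N' h'
    obtain rfl : N' = G.nat.Nat j (H.con a) := h'.trans (G.nat.Nat_sub j _)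
    rfl
  refine key _ _ ?_ _ _ _ _ (e.trans (key' _ _))
  refine (f.con_ext _).trans ?_
  exact congrArg (G.ext (H.con a)) (f.ty_Nat j a)

/-- Natural numbers of glued object-level types. -/
abbrev goNat : NatStr (goCwF f) where
  toNatIntro := goNatIntro f
  elim {j k X} P z s t hz hs ht :=
    { tm := G.nat.elim P.ty z.tm s.tm t.tm (GOTm.tm_ty hz) (GOTm.tm_ty hs) (GOTm.tm_ty ht)
      psh := (objNat F).elim P.psh z.psh s.psh t.psh (GOTm.psh_ty hz) (GOTm.psh_ty hs)
        (GOTm.psh_ty ht)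
      comm := fun {a} γ => by
        have e := G.nat.elim_sub P.ty z.tm s.tm t.tm (GOTm.tm_ty hz) (GOTm.tm_ty hs)
          (GOTm.tm_ty ht) (X.env γ)
        refine Eq.trans ?_ e.symm
        refine eq_of_heq (f.elim_heq _ _ _ _ _ _ _ rfl _ _ _ _ _ _ _ (comm_new_nat f P γ)
          (heq_of_eq (z.comm γ)) (comm_new_nat_new f P s γ) (heq_of_eq (t.comm γ))) }
  tyOf_elim P z s t hz hs ht := GOTy.ext
    (G.nat.tyOf_elim _ _ _ _ (GOTm.tm_ty hz) (GOTm.tm_ty hs) (GOTm.tm_ty ht))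
    ((objNat F).tyOf_elim _ _ _ _ (GOTm.psh_ty hz) (GOTm.psh_ty hs) (GOTm.psh_ty ht))
  elim_zero P z s hz hs := GOTm.ext
    (G.nat.elim_zero _ _ _ (GOTm.tm_ty hz) (GOTm.tm_ty hs))
    ((objNat F).elim_zero _ _ _ (GOTm.psh_ty hz) (GOTm.psh_ty hs))
  elim_suc P z s t hz hs ht := GOTm.ext
    (G.nat.elim_suc _ _ _ _ (GOTm.tm_ty hz) (GOTm.tm_ty hs) (GOTm.tm_ty ht))
    ((objNat F).elim_suc _ _ _ _ (GOTm.psh_ty hz) (GOTm.psh_ty hs) (GOTm.psh_ty ht))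
  elim_sub P z s t hz hs ht σ := GOTm.ext
    (G.nat.elim_sub _ _ _ _ (GOTm.tm_ty hz) (GOTm.tm_ty hs) (GOTm.tm_ty ht) _)
    ((objNat F).elim_sub _ _ _ _ (GOTm.psh_ty hz) (GOTm.psh_ty hs) (GOTm.psh_ty ht) _)

/-- The family structure of glued object-level types, closed under all type formers. -/
abbrev goFam : Fam (gBase H) where
  toCwF := goCwF f
  univ := goU f
  sg := goSg f
  pi := goPi f
  nat := goNat f

end GluedObject

/-! ### Glued meta-level types and terms -/

section GluedMeta

variable {C : Base.{0, 0}} {D : Base.{1, 0}} {H : BaseHom C D} {K : SetHierarchy} {G : Fam D}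

/-- Glued meta-level types: a type `A` of `G` and a displayed presheaf, each element of which
over an element `γ` has an underlying term of type `A[γ]`. As for restriction in displayed
presheaves, naturality is stated for any `γ'` equal to the restriction of `γ`. -/
structure GTy (K : SetHierarchy) (G : Fam D) (j : ℕ) (X : GCon H) where
  ty : G.Ty j X.con
  psh : DTy K j X.psh
  und : ∀ {a : C.Con} (γ : X.psh.obj a), K.El (psh.obj γ) → G.Tm j (H.con a)
  tyOf_und : ∀ {a : C.Con} (γ : X.psh.obj a) (α : K.El (psh.obj γ)),
    G.tyOf (und γ α) = G.tySub ty (X.env γ)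
  und_res : ∀ {a b : C.Con} (f : C.Sub a b) (γ : X.psh.obj b) (γ' : X.psh.obj a)
    (h : γ' = X.psh.res γ f) (α : K.El (psh.obj γ)),
    und γ' (psh.res f γ γ' h α) = G.tmSub (und γ α) (H.sub f)

variable {j k : ℕ} {X Y : GCon H}

theorem GTy.ext_heq {A B : GTy K G j X} (h : A.ty = B.ty) (h' : A.psh = B.psh)
    (h'' : ∀ (a : C.Con) (γ : X.psh.obj a) (α : K.El (A.psh.obj γ)) (β : K.El (B.psh.obj γ)),
      HEq α β → A.und γ α = B.und γ β) : A = B := by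
  cases A with | mk t p u _ _ =>
  cases B with | mk t' p' u' _ _ =>
  obtain rfl : t = t' := h
  obtain rfl : p = p' := h'
  obtain rfl : @u = @u' := by
    funext a γ α
    exact h'' a γ α α HEq.rfl
  rfl

theorem GTy.und_congr {A B : GTy K G j X} (h : A = B) {a : C.Con} {γ δ : X.psh.obj a}
    (e : γ = δ) {α : K.El (A.psh.obj γ)} {β : K.El (B.psh.obj δ)} (hα : HEq α β) :
    A.und γ α = B.und δ β := by
  subst h e
  obtain rfl := eq_of_heq hα
  rfl

/-- Glued meta-level terms: a term `t` of `G` and a section, the values of which have the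
instances of `t` at environments as their underlying terms. -/
@[ext]
structure GTm (K : SetHierarchy) (G : Fam D) (j : ℕ) (X : GCon H) where
  ty : GTy K G j X
  tm : G.Tm j X.con
  mtm : MTm K j X.psh
  tyOf_tm : G.tyOf tm = ty.ty
  mtm_fst : mtm.1 = ty.psh
  comm : ∀ {a : C.Con} (γ : X.psh.obj a),
    ty.und γ ((mtm.sec mtm_fst).app γ) = G.tmSub tm (X.env γ)

theorem GTm.tm_ty {t : GTm K G j X} {A : GTy K G j X} (h : t.ty = A) : G.tyOf t.tm = A.ty :=
  h ▸ t.tyOf_tm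

theorem GTm.mtm_ty {t : GTm K G j X} {A : GTy K G j X} (h : t.ty = A) : t.mtm.1 = A.psh :=
  h ▸ t.mtm_fst

/-- The compatibility of a glued term with its section, at a type which is merely equal to the type
of the term. -/
theorem GTm.und_sec {t : GTm K G j X} {A : GTy K G j X} (h : t.ty = A) {a : C.Con}
    (γ : X.psh.obj a) :
    A.und γ ((t.mtm.sec (GTm.mtm_ty h)).app γ) = G.tmSub t.tm (X.env γ) := by
  subst h
  exact t.comm γ

/-- Substitution of glued meta-level types. -/
abbrev GTy.sub (A : GTy K G j Y) (σ : GSub X Y) : GTy K G j X where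
  ty := G.tySub A.ty σ.sub
  psh := A.psh.sub σ.psh
  und γ α := A.und (σ.psh.app γ) α
  tyOf_und γ α := by rw [A.tyOf_und, σ.env_app, G.tySub_comp]
  und_res f γ γ' h α := A.und_res f _ _ _ α

theorem GTy.sub_id (A : GTy K G j X) : A.sub ((gBase H).id X) = A :=
  GTy.ext_heq (G.tySub_id _) rfl fun _ _ _ _ h => by rw [eq_of_heq h]; rfl

theorem GTy.sub_comp {Z : GCon H} (A : GTy K G j Z) (σ : GSub Y Z) (δ : GSub X Y) :
    A.sub ((gBase H).comp σ δ) = (A.sub σ).sub δ :=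
  GTy.ext_heq (G.tySub_comp _ _ _) rfl fun _ _ _ _ h => by rw [eq_of_heq h]; rfl

/-- Extension of a glued context by a glued meta-level type. -/
abbrev gmExt (X : GCon H) (A : GTy K G j X) : GCon H where
  con := G.ext X.con A.ty
  psh := mExt X.psh A.psh
  env x := G.pair (X.env x.1) A.ty (A.und x.1 x.2) (A.tyOf_und _ _)
  env_res x f := by
    rw [G.pair_comp]
    exact G.pair_congr _ _ (X.env_res _ _) (A.und_res _ _ _ _ _)

/-- Weakening of glued contexts. -/
abbrev gmP (A : GTy K G j X) : GSub (gmExt X A) X :=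
  ⟨G.p A.ty, (mtaCwF K C).p A.psh, fun _ => (G.p_pair _ _ _ _).symm⟩

/-- Extension of a substitution of glued contexts by a glued term. -/
abbrev gmPair (σ : GSub X Y) (A : GTy K G j Y) (t : GTm K G j X) (h : t.ty = A.sub σ) :
    GSub X (gmExt Y A) :=
  ⟨G.pair σ.sub A.ty t.tm (GTm.tm_ty h),
    (mtaCwF K C).pair σ.psh A.psh t.mtm (GTm.mtm_ty h), fun γ => by
      rw [G.pair_comp]
      exact G.pair_congr _ _ (σ.env_app γ) (GTm.und_sec h γ)⟩

theorem gmP_pair (σ : GSub X Y) (A : GTy K G j Y) (t : GTm K G j X) (h : t.ty = A.sub σ) :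
    (gBase H).comp (gmP A) (gmPair σ A t h) = σ :=
  GSub.ext (G.p_pair _ _ _ _) rfl

variable (H K G)

/-- The family structure of glued meta-level types and terms. -/
abbrev gmCwF : CwF (gBase H) where
  Ty j X := GTy K G j X
  Tm j X := GTm K G j X
  tyOf t := t.ty
  tySub A σ := A.sub σ
  tmSub t σ :=
    { ty := t.ty.sub σ
      tm := G.tmSub t.tm σ.sub
      mtm := (mtaCwF K C).tmSub t.mtm σ.psh
      tyOf_tm := by rw [G.tyOf_tmSub, t.tyOf_tm]
      mtm_fst := congrArg (fun A => DTy.sub A σ.psh) t.mtm_fst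
      comm := fun γ => by
        rw [MTm.sec_sub _ t.mtm_fst]
        exact (t.comm _).trans ((congrArg (G.tmSub t.tm) (σ.env_app γ)).trans
          (G.tmSub_comp _ _ _)) }
  tyOf_tmSub _ _ := rfl
  tySub_id A := A.sub_id
  tySub_comp A σ δ := A.sub_comp σ δ
  tmSub_id t := GTm.ext t.ty.sub_id (G.tmSub_id _) rfl
  tmSub_comp t σ δ := GTm.ext (t.ty.sub_comp σ δ) (G.tmSub_comp _ _ _) rfl
  ext X A := gmExt X A
  p A := gmP A
  q A :=
    { ty := A.sub (gmP A)
      tm := G.q A.ty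
      mtm := (mtaCwF K C).q A.psh
      tyOf_tm := G.tyOf_q _
      mtm_fst := rfl
      comm := fun _ => (G.q_pair _ _ _ _).symm }
  tyOf_q _ := rfl
  pair σ A t h := gmPair σ A t h
  p_pair σ A t h := gmP_pair σ A t h
  q_pair σ A t h := GTm.ext
    ((A.sub_comp (gmP A) (gmPair σ A t h)).symm.trans
      ((congrArg A.sub (gmP_pair σ A t h)).trans h.symm)) (G.q_pair _ _ _ _)
    ((mtaCwF K C).q_pair σ.psh A.psh t.mtm (GTm.mtm_ty h))
  pair_eta _ _ := GSub.ext (G.pair_eta _ _) rfl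

variable {H K G}

/-! ### Sigma types in the glued meta level -/

/-- The underlying term of an element of a semantic `Σ`-type. -/
abbrev undTup (A : GTy K G j X) (B : GTy K G j (gmExt X A)) {a : C.Con} (γ : X.psh.obj a)
    (y : SgSet A.psh B.psh γ) : G.Tm j (H.con a) :=
  G.sg.tup (G.tySub A.ty (X.env γ)) (G.tySub B.ty (G.up (X.env γ) A.ty)) (A.und γ y.1)
    (B.und ⟨γ, y.1⟩ y.2) (A.tyOf_und _ _) (by
      rw [B.tyOf_und, ← G.tySub_comp]
      exact congrArg (G.tySub B.ty) (G.upTo_comp_inst_eq_pair _ _ _ _ _ _).symm)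

theorem undTup_res (A : GTy K G j X) (B : GTy K G j (gmExt X A)) {a b : C.Con} (f : C.Sub a b)
    (γ : X.psh.obj b) (γ' : X.psh.obj a) (h : γ' = X.psh.res γ f) (y : SgSet A.psh B.psh γ) :
    undTup A B γ' (sgRes f γ γ' h y) = G.tmSub (undTup A B γ y) (H.sub f) := by
  have e : X.env γ' = D.comp (X.env γ) (H.sub f) := by rw [h, X.env_res]
  have e' : G.tySub A.ty (X.env γ') = G.tySub (G.tySub A.ty (X.env γ)) (H.sub f) := by
    rw [e, G.tySub_comp]
  symm
  apply G.tup_sub' _ _ _ e'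
  · rw [← G.tySub_comp]
    refine congrArg (G.tySub B.ty) ?_
    unfold CwF.up
    rw [G.upTo_comp _ _ _ _ _ _ e' (by rw [G.tySub_comp]; exact e')]
    unfold CwF.upTo
    exact G.pair_congr _ _ (by rw [e]) rfl
  · exact A.und_res _ _ _ _ _
  · exact B.und_res _ _ _ _ _

/-- Glued `Σ`-types. -/
noncomputable abbrev gSg (A : GTy K G j X) (B : GTy K G j (gmExt X A)) : GTy K G j X where
  ty := G.sg.Sg A.ty B.ty
  psh := mSg A.psh B.psh
  und γ x := undTup A B γ (K.decode (mk_SgSet_lt A.psh B.psh γ) x)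
  tyOf_und γ x := (G.sg.tyOf_tup _ _ _ _ _ _).trans (G.sg.Sg_sub _ _ _).symm
  und_res f γ γ' h x := by
    rw [← undTup_res A B f γ γ' h]
    exact congrArg (undTup A B γ') (Equiv.apply_symm_apply _ _)

/-- A term of a glued `Σ`-type is, at each environment, the tuple underlying its section. -/
theorem undTup_sec {A : GTy K G j X} {B : GTy K G j (gmExt X A)} {t : GTm K G j X}
    (h : t.ty = gSg A B) {a : C.Con} (γ : X.psh.obj a) :
    undTup A B γ (K.decode (mk_SgSet_lt A.psh B.psh γ) ((t.mtm.sec (GTm.mtm_ty h)).app γ)) =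
      G.tmSub t.tm (X.env γ) :=
  GTm.und_sec h γ

/-- The first projection of a glued term. -/
noncomputable abbrev gFst (A : GTy K G j X) (B : GTy K G j (gmExt X A)) (t : GTm K G j X)
    (h : t.ty = gSg A B) : GTm K G j X where
  ty := A
  tm := G.sg.fst A.ty B.ty t.tm (GTm.tm_ty h)
  mtm := (mtaSg K C).fst A.psh B.psh t.mtm (GTm.mtm_ty h)
  tyOf_tm := G.sg.tyOf_fst _ _ _ _
  mtm_fst := rfl
  comm γ := by
    rw [← G.fst_sub' (X.env γ) _ _ rfl _ _ (GTm.tm_ty h) _ rfl _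
      (by rw [G.tyOf_tmSub, GTm.tm_ty h, G.sg.Sg_sub]; rfl) rfl]
    exact (G.fst_eq _ _ _ _ _ _ _ _ (undTup_sec h γ).symm).symm

/-- Tuples over a type substituted twice agree with tuples over the type substituted once. -/
theorem tup_congr_env {Γ Δ Θ : D.Con} (σ : D.Sub Δ Θ) (δ : D.Sub Γ Δ) (ν : D.Sub Γ Θ)
    (e : ν = D.comp σ δ) (A : G.Ty j Θ) (B : G.Ty j (G.ext Θ A)) (t w : G.Tm j Γ) (ht hw ht' hw') :
    G.sg.tup (G.tySub (G.tySub A σ) δ) (G.tySub (G.tySub B (G.up σ A)) (G.up δ (G.tySub A σ)))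
      t w ht hw = G.sg.tup (G.tySub A ν) (G.tySub B (G.up ν A)) t w ht' hw' := by
  subst e
  have key : ∀ (A' : G.Ty j Γ) (h : A' = G.tySub (G.tySub A σ) δ)
      (h' : A' = G.tySub A (D.comp σ δ)) (B₁ B₂ : G.Ty j (G.ext Γ A')) (_ : B₁ = B₂)
      (h₁ h₂ h₃ h₄), G.sg.tup A' B₁ t w h₁ h₂ = G.sg.tup A' B₂ t w h₃ h₄ := by
    intro A' h h' B₁ B₂ e h₁ h₂ h₃ h₄
    subst e
    rfl
  have key' : ∀ (A' : G.Ty j Γ) (h : A' = G.tySub A (D.comp σ δ))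
      (h' : G.tySub (G.tySub A σ) δ = A') (h₃ h₄),
      G.sg.tup (G.tySub (G.tySub A σ) δ)
        (G.tySub (G.tySub B (G.up σ A)) (G.up δ (G.tySub A σ))) t w ht hw =
      G.sg.tup A' (G.tySub B (G.upTo (D.comp σ δ) A A' h)) t w h₃ h₄ := by
    intro A' h h' h₃ h₄
    subst h'
    refine key _ rfl h _ _ ?_ _ _ _ _
    exact (G.tySub_comp _ _ _).symm.trans
      (congrArg (G.tySub B) (G.upTo_comp σ δ A _ _ rfl rfl h))
  exact key' _ rfl (G.tySub_comp _ _ _).symm _ _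

variable (H K G)

/-- `Σ`-types of glued meta-level types. -/
noncomputable abbrev gmSg : SgStr (gmCwF H K G) where
  Sg A B := gSg A B
  Sg_sub A B σ := GTy.ext_heq (G.sg.Sg_sub _ _ _) rfl fun a γ α β h => by
    obtain rfl := eq_of_heq h
    exact (tup_congr_env σ.sub _ _ (σ.env_app γ) _ _ _ _ _ _ _ _).symm
  tup {j X} A B t w ht hw :=
    { ty := gSg A B
      tm := G.sg.tup A.ty B.ty t.tm w.tm (GTm.tm_ty ht) (GTm.tm_ty hw)
      mtm := (mtaSg K C).tup A.psh B.psh t.mtm w.mtm (GTm.mtm_ty ht) (GTm.mtm_ty hw)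
      tyOf_tm := G.sg.tyOf_tup _ _ _ _ _ _
      mtm_fst := rfl
      comm := fun γ => by
        refine (congrArg (undTup A B γ) (Equiv.apply_symm_apply _ _)).trans ?_
        exact (G.tup_sub' _ _ _ rfl _ _ _ (GTm.tm_ty ht) (GTm.tm_ty hw) _ rfl _ _ _ _
          (GTm.und_sec ht γ) (GTm.und_sec hw γ)).symm }
  fst {j X} A B t h := gFst A B t h
  snd {j X} A B t h :=
    { ty := B.sub ((gmCwF H K G).inst A (gFst A B t h) rfl)
      tm := G.sg.snd A.ty B.ty t.tm (GTm.tm_ty h)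
      mtm := (mtaSg K C).snd A.psh B.psh t.mtm (GTm.mtm_ty h)
      tyOf_tm := G.sg.tyOf_snd _ _ _ _
      mtm_fst := rfl
      comm := fun γ => by
        rw [← G.snd_sub' (X.env γ) _ _ rfl _ _ (GTm.tm_ty h) _ rfl _
          (by rw [G.tyOf_tmSub, GTm.tm_ty h, G.sg.Sg_sub]; rfl) rfl]
        exact (G.snd_eq _ _ _ _ _ _ _ _ (undTup_sec h γ).symm).symm }
  tyOf_tup _ _ _ _ _ _ := rfl
  tyOf_fst _ _ _ _ := rfl
  tyOf_snd _ _ _ _ := rfl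
  fst_tup A B t w ht hw := GTm.ext ht.symm
    (G.sg.fst_tup _ _ _ _ (GTm.tm_ty ht) (GTm.tm_ty hw))
    ((mtaSg K C).fst_tup _ _ _ _ (GTm.mtm_ty ht) (GTm.mtm_ty hw))
  snd_tup A B t w ht hw := GTm.ext (by
      refine Eq.trans (congrArg B.sub ?_) hw.symm
      apply CwF.pair_congr
      · rfl
      · exact GTm.ext ht.symm
          (G.sg.fst_tup _ _ _ _ (GTm.tm_ty ht) (GTm.tm_ty hw))
          ((mtaSg K C).fst_tup _ _ _ _ (GTm.mtm_ty ht) (GTm.mtm_ty hw)))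
    (G.sg.snd_tup _ _ _ _ (GTm.tm_ty ht) (GTm.tm_ty hw))
    ((mtaSg K C).snd_tup _ _ _ _ (GTm.mtm_ty ht) (GTm.mtm_ty hw))
  tup_eta A B t h := GTm.ext h.symm (G.sg.tup_eta _ _ _ (GTm.tm_ty h))
    ((mtaSg K C).tup_eta _ _ _ (GTm.mtm_ty h))
  tup_sub A B t w ht hw σ := GTm.ext
    (GTy.ext_heq (G.sg.Sg_sub _ _ _) rfl fun a γ α β h => by
      obtain rfl := eq_of_heq h
      exact (tup_congr_env σ.sub _ _ (σ.env_app γ) _ _ _ _ _ _ _ _).symm)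
    (G.sg.tup_sub _ _ _ _ (GTm.tm_ty ht) (GTm.tm_ty hw) _)
    ((mtaSg K C).tup_sub _ _ _ _ (GTm.mtm_ty ht) (GTm.mtm_ty hw) _)

end GluedMeta

section GluedNat

variable {C : Base.{0, 0}} {D : Base.{1, 0}} {H : BaseHom C D} {K : SetHierarchy} {G : Fam D}
  {j k : ℕ} {X Y : GCon H}

/-! ### Natural numbers in the glued meta level -/

/-- The numeral `n` as a term of type `Nat`. -/
def numTm (G : Fam D) (j : ℕ) (Γ : D.Con) : ℕ → { t : G.Tm j Γ // G.tyOf t = G.nat.Nat j Γ }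
  | 0 => ⟨G.nat.zero j Γ, G.nat.tyOf_zero j Γ⟩
  | n + 1 => ⟨G.nat.suc (numTm G j Γ n).1 (numTm G j Γ n).2, G.nat.tyOf_suc _ _⟩

theorem numTm_sub {Γ Δ : D.Con} (σ : D.Sub Γ Δ) (n : ℕ) :
    G.tmSub (numTm G j Δ n).1 σ = (numTm G j Γ n).1 := by
  induction n with
  | zero => exact G.nat.zero_sub j σ
  | succ n ih => exact (G.suc_sub' σ _ (numTm G j Δ n).2 _ (numTm G j Γ n).2 ih.symm).symm

/-- The glued type of natural numbers; the underlying terms are the numerals. -/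
noncomputable abbrev gNat (K : SetHierarchy) (G : Fam D) (j : ℕ) (X : GCon H) : GTy K G j X where
  ty := G.nat.Nat j X.con
  psh := mNat K j X.psh
  und _ x := (numTm G j _ (unnum x)).1
  tyOf_und _ x := (numTm G j _ (unnum x)).2.trans (G.nat.Nat_sub j _).symm
  und_res _ _ _ _ _ := (numTm_sub _ _).symm

theorem gNat_sub (j : ℕ) (σ : GSub X Y) : (gNat K G j Y).sub σ = gNat K G j X :=
  GTy.ext_heq (G.nat.Nat_sub j _) rfl fun _ _ _ _ h => by rw [eq_of_heq h]

/-- Zero. -/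
noncomputable abbrev gZero (K : SetHierarchy) (G : Fam D) (j : ℕ) (X : GCon H) : GTm K G j X where
  ty := gNat K G j X
  tm := G.nat.zero j X.con
  mtm := (mtaNatIntro K C).zero j X.psh
  tyOf_tm := G.nat.tyOf_zero _ _
  mtm_fst := rfl
  comm _ := by
    refine Eq.trans ?_ (G.nat.zero_sub j _).symm
    exact congrArg (fun n => (numTm G j _ n).1) (unnum_num j 0)

/-- Successor. -/
noncomputable abbrev gSuc (t : GTm K G j X) (h : t.ty = gNat K G j X) : GTm K G j X where
  ty := gNat K G j X
  tm := G.nat.suc t.tm (GTm.tm_ty h)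
  mtm := (mtaNatIntro K C).suc t.mtm (GTm.mtm_ty h)
  tyOf_tm := G.nat.tyOf_suc _ _
  mtm_fst := rfl
  comm γ := by
    refine (congrArg (fun n => (numTm G j _ n).1) (unnum_num j _)).trans ?_
    exact G.suc_sub' _ _ (GTm.tm_ty h) _ _ (GTm.und_sec h γ)

variable (H K G)

/-- Formation and introduction rules of glued meta-level natural numbers. -/
noncomputable abbrev gmNatIntro : NatIntro (gmCwF H K G) where
  Nat j X := gNat K G j X
  Nat_sub j _ _ σ := gNat_sub j σ
  zero j X := gZero K G j X
  tyOf_zero _ _ := rfl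
  zero_sub j _ _ σ := GTm.ext (gNat_sub j σ) (G.nat.zero_sub j _) rfl
  suc t h := gSuc t h
  tyOf_suc _ _ := rfl
  suc_sub _ h σ := GTm.ext (gNat_sub _ σ) (G.nat.suc_sub _ (GTm.tm_ty h) _)
    ((mtaNatIntro K C).suc_sub _ (GTm.mtm_ty h) _)

variable {H K G}

theorem und_tr (P : GTy K G k X) {a : C.Con} {γ γ' : X.psh.obj a} (e : γ = γ')
    (α : K.El (P.psh.obj γ)) : P.und γ' (P.psh.tr e α) = P.und γ α := by
  subst e
  rfl

/-- The values of a function defined by recursion have iterated eliminators as underlying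
terms. -/
theorem und_mRec (P : GTy K G k (gmExt X (gNat K G j X))) (z : GTm K G k X)
    (s : GTm K G k (gmExt (gmExt X (gNat K G j X)) P))
    (hz : z.ty = P.sub ((gmCwF H K G).inst (gNat K G j X) (gZero K G j X) rfl))
    (hs : s.ty = P.sub ((gmNatIntro H K G).sucSub P)) {a : C.Con} (γ : X.psh.obj a) (n : ℕ)
    (h₁ h₂) :
    P.und (⟨γ, num K j n⟩ : (mExt X.psh (mNat K j X.psh)).obj a)
      (mRec P.psh (z.mtm.sec (GTm.mtm_ty hz)) (s.mtm.sec (GTm.mtm_ty hs)) γ n) =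
    G.nat.elim (G.tySub P.ty (G.nat.upNat j (X.env γ))) (G.tmSub z.tm (X.env γ))
      (G.tmSub s.tm (G.up (G.nat.upNat j (X.env γ)) P.ty)) (numTm G j (H.con a) n).1 h₁ h₂
      (numTm G j (H.con a) n).2 := by
  induction n with
  | zero => exact (GTm.und_sec hz γ).trans (G.nat.elim_zero _ _ _ _ _).symm
  | succ n ih =>
    refine (und_tr P _ _).trans ?_
    refine (GTm.und_sec hs (⟨⟨γ, num K j n⟩, mRec P.psh (z.mtm.sec (GTm.mtm_ty hz))
      (s.mtm.sec (GTm.mtm_ty hs)) γ n⟩ : (mExt (mExt X.psh (mNat K j X.psh)) P.psh).obj a)).trans ?_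
    refine Eq.trans ?_ (G.nat.elim_suc _ _ _ _ _ _ _).symm
    rw [← G.tmSub_comp]
    refine congrArg (G.tmSub s.tm) ?_
    have e : (numTm G j (H.con a) (unnum (num K j n))).1 = (numTm G j (H.con a) n).1 := by
      rw [unnum_num]
    unfold CwF.up CwF.upTo
    rw [G.pair_comp]
    refine G.pair_congr _ _ ?_ ?_
    · rw [D.assoc, G.p_pair]
      unfold NatIntro.upNat
      rw [G.upTo_comp_inst_eq_pair]
      exact G.pair_congr _ _ rfl e
    · rw [G.q_pair]
      exact ih

/-- Elimination. -/
noncomputable abbrev gElim (P : GTy K G k (gmExt X (gNat K G j X))) (z : GTm K G k X)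
    (s : GTm K G k (gmExt (gmExt X (gNat K G j X)) P)) (t : GTm K G j X)
    (hz : z.ty = P.sub ((gmCwF H K G).inst (gNat K G j X) (gZero K G j X) rfl))
    (hs : s.ty = P.sub ((gmNatIntro H K G).sucSub P)) (ht : t.ty = gNat K G j X) :
    GTm K G k X where
  ty := P.sub ((gmCwF H K G).inst (gNat K G j X) t ht)
  tm := G.nat.elim P.ty z.tm s.tm t.tm (GTm.tm_ty hz) (GTm.tm_ty hs) (GTm.tm_ty ht)
  mtm := (mtaNat K C).elim P.psh z.mtm s.mtm t.mtm (GTm.mtm_ty hz) (GTm.mtm_ty hs)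
    (GTm.mtm_ty ht)
  tyOf_tm := G.nat.tyOf_elim _ _ _ _ _ _ _
  mtm_fst := rfl
  comm {a} γ := by
    have hx := GTm.und_sec ht γ
    refine Eq.trans ?_ (G.nat.elim_sub _ _ _ _ (GTm.tm_ty hz) (GTm.tm_ty hs) (GTm.tm_ty ht)
      (X.env γ)).symm
    have key : ∀ (x : K.El (K.code j ℕ (mk_nat_lt K j))) (u : G.Tm j (H.con a)) (h₁ h₂ h₃),
        (numTm G j (H.con a) (unnum x)).1 = u →
        P.und (⟨γ, x⟩ : (mExt X.psh (mNat K j X.psh)).obj a)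
          (mElimAt P.psh (z.mtm.sec (GTm.mtm_ty hz)) (s.mtm.sec (GTm.mtm_ty hs)) γ x) =
        G.nat.elim (G.tySub P.ty (G.nat.upNat j (X.env γ))) (G.tmSub z.tm (X.env γ))
          (G.tmSub s.tm (G.up (G.nat.upNat j (X.env γ)) P.ty)) u h₁ h₂ h₃ := by
      intro x u h₁ h₂ h₃ e
      subst e
      exact (und_tr P _ _).trans (und_mRec P z s hz hs γ (unnum x) h₁ h₂)
    exact key _ _ _ _ _ hx

variable (H K G)

/-- Natural numbers of glued meta-level types. -/
noncomputable abbrev gmNat : NatStr (gmCwF H K G) where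
  toNatIntro := gmNatIntro H K G
  elim P z s t hz hs ht := gElim P z s t hz hs ht
  tyOf_elim _ _ _ _ _ _ _ := rfl
  elim_zero P z s hz hs := GTm.ext hz.symm
    (G.nat.elim_zero _ _ _ (GTm.tm_ty hz) (GTm.tm_ty hs))
    ((mtaNat K C).elim_zero _ _ _ (GTm.mtm_ty hz) (GTm.mtm_ty hs))
  elim_suc P z s t hz hs ht := by
    refine GTm.ext ?_
      (G.nat.elim_suc _ _ _ _ (GTm.tm_ty hz) (GTm.tm_ty hs) (GTm.tm_ty ht))
      ((mtaNat K C).elim_suc _ _ _ _ (GTm.mtm_ty hz) (GTm.mtm_ty hs) (GTm.mtm_ty ht))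
    refine ((congrArg P.sub ((gmNatIntro H K G).sucSub_comp_pair P t ht
      (gElim P z s t hz hs ht) rfl)).symm.trans (P.sub_comp _ _)).trans ?_
    exact congrArg (fun T : GTy K G _ _ => T.sub (gmPair ((gmCwF H K G).inst (gNat K G _ _) t ht) P
      (gElim P z s t hz hs ht) rfl)) hs.symm
  elim_sub P z s t hz hs ht σ := GTm.ext
    ((gmCwF H K G).tySub_inst σ _ _ (gNat_sub _ σ).symm P t ht _ _ rfl)
    (G.nat.elim_sub _ _ _ _ (GTm.tm_ty hz) (GTm.tm_ty hs) (GTm.tm_ty ht) _)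
    ((mtaNat K C).elim_sub _ _ _ _ (GTm.mtm_ty hz) (GTm.mtm_ty hs) (GTm.mtm_ty ht) _)

end GluedNat

/-! ### Lifting between the glued stages -/

section GluedLifting

variable {C : Base.{0, 0}} {D : Base.{1, 0}} {H : BaseHom C D} {K : SetHierarchy} {F : Fam C}
  {G G₁ : Fam D} [∀ j a, Countable (F.Tm j a)] (f : FamHom H F G)
  (L : Lifting G.toCwF G₁.toCwF) {j : ℕ} {X Y : GCon H}

/-- Quotation is injective on terms of the same type. The types have to be compared, since lifting
need not be injective on types. -/
theorem Lifting.quote_injective {D : Base.{u, v}} {F G : CwF D} (L : Lifting F G) {j : ℕ}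
    {Γ : D.Con} {t w : F.Tm j Γ} (h : F.tyOf t = F.tyOf w) (e : L.quote t = L.quote w) :
    t = w := by
  have key : ∀ (A : F.Ty j Γ) (x : G.Tm j Γ) (h₁ : F.tyOf t = A) (h₂ : L.quote t = x) (h₃),
      L.splice A x h₃ = t := by
    intro A x h₁ h₂ h₃
    subst h₁ h₂
    exact L.splice_quote t
  exact (key _ _ h e (L.tyOf_quote w)).symm.trans (L.splice_quote w)

/-- The lifting of a glued object-level type; the underlying terms are quotations. -/
noncomputable abbrev gLift (K : SetHierarchy) (A : GOTy f j X) : GTy K G₁ j X where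
  ty := L.lift A.ty
  psh := mLift K A.psh
  und γ x := L.quote (f.tm (K.decode (mk_Fib_lt K (A.psh.app γ)) x).1)
  tyOf_und γ x := by
    rw [L.tyOf_quote, f.tyOf_tm, (K.decode (mk_Fib_lt K (A.psh.app γ)) x).2, A.comm, L.lift_sub]
  und_res g γ γ' h x := by
    rw [L.quote_sub, ← f.tm_sub]
    exact congrArg (fun y : Fib F (A.psh.app γ') => L.quote (f.tm y.1))
      (Equiv.apply_symm_apply _ _)

theorem gLift_sub (A : GOTy f j Y) (σ : GSub X Y) :
    (gLift f L K A).sub σ = gLift f L K ((goCwF f).tySub A σ) :=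
  GTy.ext_heq (L.lift_sub _ _) rfl fun _ _ _ _ h => by
    obtain rfl := eq_of_heq h
    rfl

/-- Quotation. -/
noncomputable abbrev gQuote (K : SetHierarchy) (t : GOTm f j X) : GTm K G₁ j X where
  ty := gLift f L K ((goCwF f).tyOf t)
  tm := L.quote t.tm
  mtm := (pshLifting K F).quote t.psh
  tyOf_tm := L.tyOf_quote _
  mtm_fst := rfl
  comm γ := by
    rw [L.quote_sub, ← t.comm]
    exact congrArg (fun y : Fib F (F.tyOf (t.psh.app γ)) => L.quote (f.tm y.1))
      (Equiv.apply_symm_apply _ _)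

/-- Splicing. -/
noncomputable abbrev gSplice (A : GOTy f j X) (t : GTm K G₁ j X) (h : t.ty = gLift f L K A) :
    GOTm f j X where
  tm := L.splice A.ty t.tm (GTm.tm_ty h)
  psh := (pshLifting K F).splice A.psh t.mtm (GTm.mtm_ty h)
  comm γ := by
    -- both sides have the underlying term of `t` at `γ` as their quotation
    apply L.quote_injective
    · rw [f.tyOf_tm, G.tyOf_tmSub, L.tyOf_splice, ← A.comm]
      exact congrArg f.ty (K.decode (mk_Fib_lt K (A.psh.app γ)) _).2
    · rw [← L.quote_sub, L.quote_splice]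
      exact GTm.und_sec h γ

theorem tyOf_gSplice (A : GOTy f j X) (t : GTm K G₁ j X) (h : t.ty = gLift f L K A) :
    (goCwF f).tyOf (gSplice f L A t h) = A :=
  GOTy.ext (L.tyOf_splice _ _ (GTm.tm_ty h)) ((pshLifting K F).tyOf_splice _ _ (GTm.mtm_ty h))

/-- Lifting from glued object-level types to glued meta-level types. -/
noncomputable abbrev gLifting (K : SetHierarchy) : Lifting (goCwF f) (gmCwF H K G₁) where
  lift A := gLift f L K A
  lift_sub A σ := gLift_sub f L A σ
  quote t := gQuote f L K t
  tyOf_quote _ := rfl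
  splice A t h := gSplice f L A t h
  tyOf_splice A t h := tyOf_gSplice f L A t h
  splice_quote t := GOTm.ext (L.splice_quote _) ((pshLifting K F).splice_quote _)
  quote_splice A t h := GTm.ext ((congrArg (gLift f L K) (tyOf_gSplice f L A t h)).trans h.symm)
    (L.quote_splice _ _ (GTm.tm_ty h)) ((pshLifting K F).quote_splice _ _ (GTm.mtm_ty h))
  quote_sub t σ := GTm.ext ((gLift_sub f L ((goCwF f).tyOf t) σ).trans
    (congrArg (gLift f L K) ((goCwF f).tyOf_tmSub t σ).symm)) (L.quote_sub _ _) rfl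

end GluedLifting

section FamilyOfDTy

variable {K : SetHierarchy} {C : Base.{0, 0}} {j : ℕ} {X : Psh C}

/-! ### Universes in the glued meta level -/

/-- The displayed presheaf over `X` glued together from a natural family of displayed presheaves
over representable presheaves. -/
abbrev famEl (T : ∀ {a : C.Con}, X.obj a → DTy K j (yo a))
    (hT : ∀ {a b : C.Con} (f : C.Sub a b) (γ : X.obj b) (γ' : X.obj a), γ' = X.res γ f →
      T γ' = (T γ).sub (yoMap f)) : DTy K j X where
  obj {a} γ := (T γ).obj (C.id a)
  res f γ γ' h := uRes f (T γ) (T γ') (hT f γ γ' h)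
  res_id {a} γ h α := by
    refine eq_of_heq ((uRes_heq _ _ _ _ _ rfl (C.id a) (C.id a) rfl (C.comp_id _).symm α α
      HEq.rfl).trans ?_)
    exact DTy.res_id_heq _ _ _ _ _
  res_comp {a b c} f g γ γ' γ'' h h' h'' α := by
    have e : f = (yo c).res (C.id c) f := (C.id_comp f).symm
    have e' : C.comp f g = (yo c).res (C.id c) (C.comp f g) := (C.id_comp _).symm
    refine eq_of_heq ((uRes_heq g (T γ') (T γ'') _ _ (hT f γ γ' h) (C.id b) g rfl
      (C.id_comp g).symm _ ((T γ).res f (C.id c) (C.comp f (C.id b))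
        (by rw [C.comp_id]; exact e) α) ?_).trans ?_)
    · exact uRes_heq f _ _ _ _ rfl _ _ rfl _ _ _ HEq.rfl
    · refine HEq.trans (heq_of_eq ((T γ).res_comp f g (C.id c) (C.comp f (C.id b))
        (C.comp f g) _ ?_ e' α)) (uRes_heq _ _ _ _ _ rfl _ _ rfl _ _ _ HEq.rfl).symm
      change _ = C.comp _ _
      rw [C.comp_id]

/-- A displayed presheaf is glued together from its restrictions along elements. -/
theorem famEl_name (A : DTy K j X) (T : ∀ {a : C.Con}, X.obj a → DTy K j (yo a)) (hT)
    (h : ∀ {a : C.Con} (γ : X.obj a), T γ = A.sub (name γ)) : famEl T hT = A := by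
  refine DTy.ext_heq (fun a γ => ?_) fun a b f γ γ' e α β hα => ?_
  · change (T γ).obj (C.id a) = _
    rw [h]
    exact congrArg A.obj (X.res_id γ)
  · refine (uRes_heq f _ _ (hT f γ γ' e) _ (h γ) (C.id b) f rfl (C.id_comp f).symm α
      (A.tr (X.res_id γ).symm β) (hα.trans (DTy.tr_heq _ _ _).symm)).trans ?_
    exact DTy.res_heq (A := A) rfl f _ e (X.res_id γ) e.symm (DTy.tr_heq _ _ _)

/-- The restrictions along elements of the displayed presheaf glued together from `T` are the
values of `T`. -/
theorem famEl_sub_name (T : ∀ {a : C.Con}, X.obj a → DTy K j (yo a)) (hT) {a : C.Con}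
    (γ : X.obj a) : (famEl T hT).sub (name γ) = T γ := by
  have key : ∀ {b : C.Con} (g : C.Sub b a),
      T (X.res γ g) = (T γ).sub (yoMap g) := fun g => hT g γ _ rfl
  refine DTy.ext_heq (fun b g => ?_) fun b c f g g' e α β hα => ?_
  · change (T (X.res γ g)).obj (C.id b) = _
    rw [key g]
    exact congrArg (T γ).obj (C.comp_id g)
  · refine (uRes_heq f _ _ (hT f _ _ ((name γ).nat g f ▸ congrArg _ e)) _ (key g) (C.id c) f rfl
      (C.id_comp f).symm α ((T γ).tr (C.comp_id g).symm β)
      (hα.trans (DTy.tr_heq _ _ _).symm)).trans ?_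
    exact DTy.res_heq (A := T γ) rfl f _ e (C.comp_id g) e.symm (DTy.tr_heq _ _ _)

end FamilyOfDTy

section GluedUniverse

variable {C : Base.{0, 0}} {D : Base.{1, 0}} (H : BaseHom C D) {K : SetHierarchy} {G : Fam D}
  {j k : ℕ} {X Y : GCon H}

/-- The glued context represented by `a`: the image of `a`, with the representable presheaf. -/
abbrev gYo (a : C.Con) : GCon H where
  con := H.con a
  psh := yo a
  env g := H.sub g
  env_res _ _ := H.sub_comp _ _

/-- The action of a morphism on represented glued contexts. -/
abbrev gYoMap {a b : C.Con} (f : C.Sub a b) : GSub (gYo H a) (gYo H b) :=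
  ⟨H.sub f, yoMap f, fun _ => H.sub_comp _ _⟩

theorem gYoMap_id (a : C.Con) : gYoMap H (C.id a) = (gBase H).id (gYo H a) :=
  GSub.ext (H.sub_id a) (yoMap_id a)

theorem gYoMap_comp {a b c : C.Con} (f : C.Sub b c) (g : C.Sub a b) :
    gYoMap H (C.comp f g) = (gBase H).comp (gYoMap H f) (gYoMap H g) :=
  GSub.ext (H.sub_comp f g) (yoMap_comp f g)

variable {H}

/-- The glued substitution from a represented glued context which corresponds to an element. -/
abbrev gName {a : C.Con} (γ : X.psh.obj a) : GSub (gYo H a) X :=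
  ⟨X.env γ, name γ, fun f => X.env_res γ f⟩

theorem gName_res {a b : C.Con} (f : C.Sub a b) (γ : X.psh.obj b) (γ' : X.psh.obj a)
    (h : γ' = X.psh.res γ f) : gName γ' = (gBase H).comp (gName γ) (gYoMap H f) :=
  GSub.ext (by rw [h]; exact X.env_res γ f) (name_res f γ γ' h)

theorem gName_app (σ : GSub X Y) {a : C.Con} (γ : X.psh.obj a) :
    gName (σ.psh.app γ) = (gBase H).comp σ (gName γ) :=
  GSub.ext (σ.env_app γ) (name_app σ.psh γ)

/-- Restriction of an element at the identity has the expected underlying term. -/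
theorem und_uRes {a b : C.Con} (f : C.Sub a b) (T : GTy K G j (gYo H b))
    (T' : GTy K G j (gYo H a)) (h : T' = T.sub (gYoMap H f)) (h') (α : K.El (T.psh.obj (C.id b))) :
    T'.und (C.id a) (uRes f T.psh T'.psh h' α) = G.tmSub (T.und (C.id b) α) (H.sub f) := by
  subst h
  exact T.und_res f (C.id b) _ _ α

variable [Countable C.Con] [∀ a b, Countable (C.Sub a b)] [∀ j Γ, Countable (G.Ty j Γ)]
  [∀ j Γ, Countable (G.Tm j Γ)]

/-- The glued types over a represented glued context form a set in the next universe: there are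
countably many underlying types, and the remaining data are families indexed by small sets. -/
theorem mk_GTy_lt (j : ℕ) (a : C.Con) : Cardinal.mk (GTy K G j (gYo H a)) < K.κ (j + 1) := by
  have h : Cardinal.mk (Σ (_ : G.Ty j (H.con a)) (P : DTy K j (yo a)),
      ∀ x : (Σ (b : C.Con) (g : C.Sub b a), K.El (P.obj g)), G.Tm j (H.con x.1)) < K.κ (j + 1) := by
    refine K.sigma_lt (K.lt_of_countable _ _) fun _ => K.sigma_lt (mk_DTy_lt j a) fun P => ?_
    refine K.pi_lt (K.sigma_lt (K.lt_of_countable _ _) fun b => K.sigma_lt (K.lt_of_countable _ _)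
      fun g => K.lt_succ (K.mk_El_lt _)) fun x => K.lt_of_countable _ _
  refine K.lt_of_injective h (fun A => ⟨A.ty, A.psh, fun x => A.und x.2.1 x.2.2⟩) ?_
  intro A B e
  obtain ⟨e₁, e₂⟩ := Sigma.mk.inj e
  obtain ⟨e₃, e₄⟩ := Sigma.mk.inj (eq_of_heq e₂)
  cases A with | mk t p u _ _ =>
  cases B with | mk t' p' u' _ _ =>
  obtain rfl : t = t' := e₁
  obtain rfl : p = p' := e₃
  have e₅ := eq_of_heq e₄
  obtain rfl : @u = @u' := by
    funext b g α
    exact congrFun e₅ ⟨b, g, α⟩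
  rfl

/-- The glued universe: at a context `a`, the set of glued types over the glued context represented
by `a`. The underlying term of such a glued type is the code of its underlying type. -/
noncomputable abbrev gU (K : SetHierarchy) (G : Fam D) [∀ j Γ, Countable (G.Ty j Γ)]
    [∀ j Γ, Countable (G.Tm j Γ)] (j : ℕ) (X : GCon H) : GTy K G (j + 1) X where
  ty := G.univ.U j X.con
  psh :=
    { obj := fun {a} _ => K.code (j + 1) (GTy K G j (gYo H a)) (mk_GTy_lt j a)
      res := fun {a b} f _ _ _ T => (K.decode (mk_GTy_lt j a)).symm
        ((K.decode (mk_GTy_lt j b) T).sub (gYoMap H f))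
      res_id := fun {a} γ h T => by
        rw [Equiv.symm_apply_eq, gYoMap_id]
        exact GTy.sub_id _
      res_comp := fun {a b c} f g γ γ' γ'' h h' h'' T => by
        rw [Equiv.apply_symm_apply, gYoMap_comp]
        exact congrArg (K.decode (mk_GTy_lt j a)).symm (GTy.sub_comp _ _ _).symm }
  und {a} _ T := G.univ.code (K.decode (mk_GTy_lt j a) T).ty
  tyOf_und _ _ := (G.univ.tyOf_code _).trans (G.univ.U_sub _ _).symm
  und_res {a b} f γ γ' h T := by
    refine Eq.trans ?_ (G.univ.code_sub _ _).symm
    exact congrArg (fun A : GTy K G j (gYo H a) => G.univ.code A.ty) (Equiv.apply_symm_apply _ _)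

theorem gU_sub (j : ℕ) (σ : GSub X Y) : (gU K G j Y).sub σ = gU K G j X :=
  GTy.ext_heq (G.univ.U_sub j _) rfl fun _ _ _ _ h => by rw [eq_of_heq h]

/-- The glued type over a represented glued context given by an element of the universe. -/
noncomputable abbrev unGU (s : Sec (gU K G j X).psh) {a : C.Con} (γ : X.psh.obj a) :
    GTy K G j (gYo H a) :=
  K.decode (mk_GTy_lt j a) (s.app γ)

theorem unGU_nat (s : Sec (gU K G j X).psh) {a b : C.Con} (f : C.Sub a b) (γ : X.psh.obj b)
    (γ' : X.psh.obj a) (h : γ' = X.psh.res γ f) :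
    unGU s γ' = (unGU s γ).sub (gYoMap H f) := by
  unfold unGU
  rw [← s.nat f γ γ' h]
  exact Equiv.apply_symm_apply (K.decode (mk_GTy_lt j a)) _

theorem unGU_psh_nat (s : Sec (gU K G j X).psh) {a b : C.Con} (f : C.Sub a b) (γ : X.psh.obj b)
    (γ' : X.psh.obj a) (h : γ' = X.psh.res γ f) :
    (unGU s γ').psh = (unGU s γ).psh.sub (yoMap f) :=
  congrArg GTy.psh (unGU_nat s f γ γ' h)

theorem code_unGU {t : GTm K G (j + 1) X} (h : t.ty = gU K G j X) {a : C.Con} (γ : X.psh.obj a) :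
    G.univ.code (unGU (t.mtm.sec (GTm.mtm_ty h)) γ).ty = G.tmSub t.tm (X.env γ) :=
  GTm.und_sec h γ

theorem unGU_ty {t : GTm K G (j + 1) X} (h : t.ty = gU K G j X) {a : C.Con} (γ : X.psh.obj a) :
    (unGU (t.mtm.sec (GTm.mtm_ty h)) γ).ty =
      G.tySub (G.univ.El t.tm (GTm.tm_ty h)) (X.env γ) :=
  (G.univ.El_code _).symm.trans (G.El_sub' _ _ (GTm.tm_ty h) _ _ (code_unGU h γ))

/-- Decoding. -/
noncomputable abbrev gEl (t : GTm K G (j + 1) X) (h : t.ty = gU K G j X) : GTy K G j X where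
  ty := G.univ.El t.tm (GTm.tm_ty h)
  psh := famEl (fun γ => (unGU (t.mtm.sec (GTm.mtm_ty h)) γ).psh)
    (unGU_psh_nat (t.mtm.sec (GTm.mtm_ty h)))
  und {a} γ α := (unGU (t.mtm.sec (GTm.mtm_ty h)) γ).und (C.id a) α
  tyOf_und {a} γ α := by
    rw [GTy.tyOf_und, ← unGU_ty h]
    exact (congrArg (G.tySub _) (H.sub_id a)).trans (G.tySub_id _)
  und_res f γ γ' e α := und_uRes f _ _ (unGU_nat _ f γ γ' e) (unGU_psh_nat _ f γ γ' e) α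

/-- Coding. -/
noncomputable abbrev gCode (A : GTy K G j X) : GTm K G (j + 1) X where
  ty := gU K G j X
  tm := G.univ.code A.ty
  mtm := ⟨(gU K G j X).psh, fun {a} γ => (K.decode (mk_GTy_lt j a)).symm (A.sub (gName γ)),
    fun {a b} f γ γ' h => by
      refine congrArg (K.decode (mk_GTy_lt j a)).symm ?_
      rw [Equiv.apply_symm_apply, gName_res f γ γ' h]
      exact (GTy.sub_comp _ _ _).symm⟩
  tyOf_tm := G.univ.tyOf_code _
  mtm_fst := rfl
  comm {a} γ := by
    refine Eq.trans ?_ (G.univ.code_sub _ _).symm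
    exact congrArg (fun A : GTy K G j (gYo H a) => G.univ.code A.ty) (Equiv.apply_symm_apply _ _)

theorem unGU_gCode (A : GTy K G j X) {a : C.Con} (γ : X.psh.obj a) :
    unGU (gCode A).mtm.2 γ = A.sub (gName γ) :=
  Equiv.apply_symm_apply (K.decode (mk_GTy_lt j a)) _

theorem gEl_gCode (A : GTy K G j X) : gEl (gCode A) rfl = A := by
  refine GTy.ext_heq (G.univ.El_code _) (famEl_name _ _ _ fun γ =>
    congrArg GTy.psh (unGU_gCode A γ)) fun a γ α β h => ?_
  exact (GTy.und_congr (unGU_gCode A γ) rfl (α := α)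
      (β := A.psh.tr (X.psh.res_id γ).symm β) (h.trans (DTy.tr_heq _ _ _).symm)).trans
    (und_tr A _ _)

theorem gEl_sub_name {t : GTm K G (j + 1) X} (h : t.ty = gU K G j X) {a : C.Con}
    (γ : X.psh.obj a) :
    (gEl t h).sub (gName γ) = unGU (t.mtm.sec (GTm.mtm_ty h)) γ := by
  refine GTy.ext_heq (unGU_ty h γ).symm (famEl_sub_name _ _ γ) fun b g α β e => ?_
  refine (GTy.und_congr (unGU_nat _ g γ _ rfl) rfl (β := (unGU (t.mtm.sec (GTm.mtm_ty h)) γ).psh.tr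
    (C.comp_id g).symm β) (e.trans (DTy.tr_heq _ _ _).symm)).trans ?_
  exact und_tr _ _ _

variable (H K G)

/-- Universes of glued meta-level types. -/
noncomputable abbrev gmU : UStr (gmCwF H K G) where
  U j X := gU K G j X
  U_sub j _ _ σ := gU_sub j σ
  El t h := gEl t h
  code A := gCode A
  tyOf_code _ := rfl
  El_code A := gEl_gCode A
  code_El t h := GTm.ext h.symm (G.univ.code_El _ (GTm.tm_ty h)) (by
    refine Eq.trans ?_ (MTm.eq_mk t.mtm (GTm.mtm_ty h)).symm
    refine congrArg (Sigma.mk _) (Sec.ext_app fun a γ => ?_)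
    change (K.decode (mk_GTy_lt _ a)).symm ((gEl t h).sub (gName γ)) = _
    rw [Equiv.symm_apply_eq]
    exact gEl_sub_name h γ)
  code_sub A σ := GTm.ext (gU_sub _ σ) (G.univ.code_sub _ _) (by
    refine congrArg (Sigma.mk _) (Sec.ext_app fun a γ => ?_)
    refine congrArg (K.decode (mk_GTy_lt _ a)).symm ?_
    rw [gName_app]
    exact GTy.sub_comp _ _ _)

end GluedUniverse

/-! ### Bodies of functions in a category with families -/

namespace CwF

variable {C : Base.{u, v}} (F : CwF C) {j : ℕ} {Γ Δ Θ : C.Con}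

theorem tmSub_upTo_heq (σ : C.Sub Γ Δ) (A : F.Ty j Δ) (A' : F.Ty j Γ) (h : A' = F.tySub A σ)
    (t : F.Tm j (F.ext Δ A)) : HEq (F.tmSub t (F.upTo σ A A' h)) (F.tmSub t (F.up σ A)) := by
  subst h
  rfl

theorem tySub_upTo_heq (σ : C.Sub Γ Δ) (A : F.Ty j Δ) (A' : F.Ty j Γ) (h : A' = F.tySub A σ)
    (B : F.Ty j (F.ext Δ A)) : HEq (F.tySub B (F.upTo σ A A' h)) (F.tySub B (F.up σ A)) := by
  subst h
  rfl

theorem upTo_id (A : F.Ty j Γ) (h : A = F.tySub A (C.id Γ)) :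
    F.upTo (C.id Γ) A A h = C.id _ := by
  rw [← F.pair_eta A (C.id _)]
  exact F.pair_congr _ _ ((C.id_comp _).trans (C.comp_id _).symm) (F.tmSub_id _).symm

theorem tmSub_up_id_heq (A : F.Ty j Γ) (t : F.Tm j (F.ext Γ A)) :
    HEq (F.tmSub t (F.up (C.id Γ) A)) t := by
  refine (F.tmSub_upTo_heq _ A A (F.tySub_id A).symm t).symm.trans (heq_of_eq ?_)
  rw [F.upTo_id, F.tmSub_id]

theorem tmSub_up_comp_heq (σ : C.Sub Δ Θ) (δ : C.Sub Γ Δ) (A : F.Ty j Θ)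
    (t : F.Tm j (F.ext Θ A)) :
    HEq (F.tmSub (F.tmSub t (F.up σ A)) (F.up δ (F.tySub A σ)))
      (F.tmSub t (F.up (C.comp σ δ) A)) := by
  refine HEq.trans (heq_of_eq ?_) (F.tmSub_upTo_heq _ A _ (F.tySub_comp A σ δ).symm t)
  rw [← F.tmSub_comp]
  exact congrArg (F.tmSub t) (F.upTo_comp _ _ _ _ _ _ _ _)

theorem tySub_up_comp_heq (σ : C.Sub Δ Θ) (δ : C.Sub Γ Δ) (A : F.Ty j Θ)
    (B : F.Ty j (F.ext Θ A)) :
    HEq (F.tySub (F.tySub B (F.up σ A)) (F.up δ (F.tySub A σ)))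
      (F.tySub B (F.up (C.comp σ δ) A)) := by
  refine HEq.trans (heq_of_eq ?_) (F.tySub_upTo_heq _ A _ (F.tySub_comp A σ δ).symm B)
  exact (F.tySub_comp _ _ _).symm.trans (congrArg (F.tySub B) (F.upTo_comp _ _ _ _ _ _ _ _))

theorem tmSub_up_congr {σ σ' : C.Sub Γ Δ} (h : σ = σ') (A : F.Ty j Δ) (t : F.Tm j (F.ext Δ A)) :
    HEq (F.tmSub t (F.up σ A)) (F.tmSub t (F.up σ' A)) := by
  subst h
  rfl

/-- A type together with a type over the extended context: the data of a function type. -/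
abbrev Bind (j : ℕ) (Γ : C.Con) : Type v := Σ A : F.Ty j Γ, F.Ty j (F.ext Γ A)

variable {F}

/-- Substitution in the data of a function type. -/
abbrev Bind.sub (p : F.Bind j Δ) (σ : C.Sub Γ Δ) : F.Bind j Γ :=
  ⟨F.tySub p.1 σ, F.tySub p.2 (F.up σ p.1)⟩

theorem Bind.sub_comp (p : F.Bind j Θ) (σ : C.Sub Δ Θ) (δ : C.Sub Γ Δ) :
    p.sub (C.comp σ δ) = (p.sub σ).sub δ :=
  Sigma.ext (F.tySub_comp _ _ _) (F.tySub_up_comp_heq _ _ _ _).symm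

/-- The bodies of functions: the terms of the codomain over the context extended by the domain. -/
abbrev Bind.Body (p : F.Bind j Γ) : Type v := { t : F.Tm j (F.ext Γ p.1) // F.tyOf t = p.2 }

/-- Substitution in bodies of functions. -/
def Bind.Body.res {p : F.Bind j Δ} {p' : F.Bind j Γ} (σ : C.Sub Γ Δ) (h : p' = p.sub σ)
    (t : p.Body) : p'.Body :=
  h ▸ ⟨F.tmSub t.1 (F.up σ p.1), by rw [F.tyOf_tmSub, t.2]⟩

theorem Bind.Body.res_heq {p : F.Bind j Δ} {p' : F.Bind j Γ} (σ : C.Sub Γ Δ) (h : p' = p.sub σ)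
    (t : p.Body) : HEq (t.res σ h).1 (F.tmSub t.1 (F.up σ p.1)) := by
  subst h
  rfl

theorem Bind.Body.res_id {p : F.Bind j Γ} (σ : C.Sub Γ Γ) (hσ : σ = C.id Γ) (h : p = p.sub σ)
    (t : p.Body) : t.res σ h = t := by
  subst hσ
  exact Subtype.ext (eq_of_heq ((t.res_heq _ h).trans (F.tmSub_up_id_heq _ _)))

theorem Bind.Body.res_comp {p : F.Bind j Θ} {p' : F.Bind j Δ} {p'' : F.Bind j Γ} (σ : C.Sub Δ Θ)
    (δ : C.Sub Γ Δ) (h : p' = p.sub σ) (h' : p'' = p'.sub δ) (ν : C.Sub Γ Θ)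
    (hν : ν = C.comp σ δ) (h'' : p'' = p.sub ν) (t : p.Body) :
    (t.res σ h).res δ h' = t.res ν h'' := by
  subst hν h
  refine Subtype.ext (eq_of_heq ((Bind.Body.res_heq _ h' _).trans (HEq.trans ?_
    (t.res_heq _ h'').symm)))
  exact F.tmSub_up_comp_heq _ _ _ _

end CwF

theorem PiStr.lam_heq {C : Base.{u, v}} {F : CwF C} (P : PiStr F) {j : ℕ} {Γ : C.Con}
    {A A' : F.Ty j Γ} (h : A = A') {t : F.Tm j (F.ext Γ A)} {t' : F.Tm j (F.ext Γ A')}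
    (e : HEq t t') : P.lam A t = P.lam A' t' := by
  subst h
  rw [eq_of_heq e]

theorem PiStr.app_lam_of_eq {C : Base.{u, v}} {F : CwF C} (P : PiStr F) {j : ℕ} {Γ : C.Con}
    {A : F.Ty j Γ} {B : F.Ty j (F.ext Γ A)} {t : F.Tm j (F.ext Γ A)} (h : F.tyOf t = B) (h') :
    P.app A B (P.lam A t) h' = t := by
  subst h
  exact P.app_lam A t

theorem PiStr.lam_injective {C : Base.{u, v}} {F : CwF C} (P : PiStr F) {j : ℕ} {Γ : C.Con}
    {A : F.Ty j Γ} {t t' : F.Tm j (F.ext Γ A)} (h : F.tyOf t = F.tyOf t')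
    (e : P.lam A t = P.lam A t') : t = t' := by
  have key : ∀ (w : F.Tm j Γ) (_ : P.lam A t = w) (h'), P.app A (F.tyOf t') w h' = t := by
    intro w h₂ h'
    subst h₂
    exact P.app_lam_of_eq h h'
  exact (key _ e (P.tyOf_lam A t')).symm.trans (P.app_lam A t')

section GluedPi

variable {C : Base.{0, 0}} {D : Base.{1, 0}} {H : BaseHom C D} {K : SetHierarchy} {G : Fam D}
  {j : ℕ} {X Y : GCon H}

/-! ### Function types in the glued meta level -/

/-- The data of a function type at an element of a glued context. -/
abbrev bindAt (p : (gmCwF H K G).Bind j X) {a : C.Con} (γ : X.psh.obj a) :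
    (gmCwF H K G).Bind j (gYo H a) :=
  p.sub (gName γ)

theorem bindAt_res (p : (gmCwF H K G).Bind j X) {a b : C.Con} (f : C.Sub a b) (γ : X.psh.obj b)
    (γ' : X.psh.obj a) (h : γ' = X.psh.res γ f) : bindAt p γ' = (bindAt p γ).sub (gYoMap H f) := by
  unfold bindAt
  rw [gName_res f γ γ' h, CwF.Bind.sub_comp]

theorem bindAt_sub (p : (gmCwF H K G).Bind j Y) (σ : GSub X Y) {a : C.Con} (γ : X.psh.obj a) :
    bindAt p (σ.psh.app γ) = bindAt (p.sub σ) γ := by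
  unfold bindAt
  rw [gName_app, CwF.Bind.sub_comp]

theorem body_tm_heq {a : C.Con} {p p' : (gmCwF H K G).Bind j (gYo H a)} (h : p = p') {t : p.Body}
    {t' : p'.Body} (e : HEq t.1 t'.1) : HEq t.1.tm t'.1.tm := by
  subst h
  rw [eq_of_heq e]

theorem MTm.sec_congr {X : Psh C} {A : DTy K j X} {t t' : MTm K j X} (e : t = t') (h : t.1 = A)
    (h' : t'.1 = A) : t.sec h = t'.sec h' := by
  subst e
  rfl

/-- The function of the presheaf model which underlies a glued function body. -/
abbrev bodyFn {p : (gmCwF H K G).Bind j X} {a : C.Con} {ρ : GSub (gYo H a) X}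
    (t : (p.sub ρ).Body) : PiSet p.1.psh p.2.psh ρ.psh :=
  t.1.mtm.sec (GTm.mtm_ty t.2)

theorem bodyFn_res {p : (gmCwF H K G).Bind j X} {a b : C.Con} (f : C.Sub a b)
    {ρ : GSub (gYo H b) X} {ρ' : GSub (gYo H a) X} (h : ρ' = (gBase H).comp ρ (gYoMap H f))
    (h' : p.sub ρ' = (p.sub ρ).sub (gYoMap H f)) (t : (p.sub ρ).Body) :
    bodyFn (t.res (gYoMap H f) h') = PiSet.res f (congrArg GSub.psh h) (bodyFn t) := by
  subst h
  have key : ∀ (A A' : GTy K G j (gYo H a)) (_ : A = A') (w : GTm K G j (gmExt (gYo H a) A))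
      (w' : GTm K G j (gmExt (gYo H a) A')), HEq w w' → HEq w.mtm w'.mtm := by
    intro A A' e w w' hw
    subst e
    rw [eq_of_heq hw]
  have e := eq_of_heq (key _ _ (congrArg Sigma.fst h') _ _ (t.res_heq (gYoMap H f) h'))
  refine (MTm.sec_congr e _ ?_).trans (MTm.sec_sub t.1.mtm (GTm.mtm_ty t.2) _ ?_)
  · exact congrArg (fun A => DTy.sub A ((gmCwF H K G).up (gYoMap H f) (p.sub ρ).fst).psh)
      (GTm.mtm_ty t.2)
  · exact congrArg (fun A => DTy.sub A ((gmCwF H K G).up (gYoMap H f) (p.sub ρ).fst).psh)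
      (GTm.mtm_ty t.2)

/-- The value of a glued function body at an argument has as its underlying term the instance of
the underlying term of the body. -/
theorem und_ev {p : (gmCwF H K G).Bind j X} {a : C.Con} {γ : X.psh.obj a} (t : (bindAt p γ).Body)
    {b : C.Con} (g : C.Sub b a) (δ : X.psh.obj b) (e : δ = X.psh.res γ g)
    (α : K.El (p.1.psh.obj δ)) (h) :
    p.2.und (⟨δ, α⟩ : (mExt X.psh p.1.psh).obj b) ((bodyFn t).ev g δ e α) =
      G.tmSub t.1.tm (G.pair (H.sub g) (G.tySub p.1.ty (X.env γ)) (p.1.und δ α) h) := by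
  subst e
  exact GTm.und_sec t.2 (⟨g, α⟩ : (mExt (yo a) (p.1.psh.sub (name γ))).obj b)

variable [Countable C.Con] [∀ a b, Countable (C.Sub a b)] [∀ j Γ, Countable (G.Tm j Γ)]

theorem mk_Body_lt {a : C.Con} (p : (gmCwF H K G).Bind j (gYo H a)) :
    Cardinal.mk p.Body < K.κ j := by
  have h : Cardinal.mk (Σ _ : G.Tm j (G.ext (H.con a) p.1.ty),
      PiSet p.1.psh p.2.psh (PSub.id (yo a))) < K.κ j :=
    K.sigma_lt (K.lt_of_countable _ _) fun _ => mk_PiSet_lt _ _ _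
  refine K.lt_of_injective h (fun t => ⟨t.1.tm, t.1.mtm.sec (GTm.mtm_ty t.2)⟩) ?_
  intro t t' e
  obtain ⟨e₁, e₂⟩ := Sigma.mk.inj e
  refine Subtype.ext (GTm.ext (t.2.trans t'.2.symm) e₁ ?_)
  rw [MTm.eq_mk t.1.mtm (GTm.mtm_ty t.2), MTm.eq_mk t'.1.mtm (GTm.mtm_ty t'.2)]
  exact congrArg (Sigma.mk p.2.psh) (eq_of_heq e₂)

/-- Glued function types: at an element `γ` over `a`, the set of glued terms of the codomain over
the represented glued context extended by the domain. The underlying term is the abstraction of the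
underlying term of the body. -/
noncomputable abbrev gPi (p : (gmCwF H K G).Bind j X) : GTy K G j X where
  ty := G.pi.Pi p.1.ty p.2.ty
  psh :=
    { obj := fun γ => K.code j (bindAt p γ).Body (mk_Body_lt _)
      res := fun f γ γ' h φ => (K.decode (mk_Body_lt _)).symm
        ((K.decode (mk_Body_lt _) φ).res (gYoMap H f) (bindAt_res p f γ γ' h))
      res_id := fun γ h φ => by
        rw [Equiv.symm_apply_eq]
        exact CwF.Bind.Body.res_id _ (gYoMap_id H _) _ _
      res_comp := fun f g γ γ' γ'' h h' h'' φ => by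
        rw [Equiv.apply_symm_apply]
        exact congrArg (K.decode (mk_Body_lt _)).symm (CwF.Bind.Body.res_comp _ _ _ _ _
          (gYoMap_comp H f g) _ _) }
  und γ φ := G.pi.lam (G.tySub p.1.ty (X.env γ)) (K.decode (mk_Body_lt (bindAt p γ)) φ).1.tm
  tyOf_und γ φ := by
    rw [G.pi.tyOf_lam, G.pi.Pi_sub]
    exact congrArg (G.pi.Pi _) (GTm.tm_ty (K.decode (mk_Body_lt (bindAt p γ)) φ).2)
  und_res {a b} f γ γ' h φ := by
    refine Eq.trans ?_ (G.pi.lam_sub _ _ _).symm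
    refine G.pi.lam_heq (by rw [h, X.env_res, G.tySub_comp]) ?_
    rw [Equiv.apply_symm_apply]
    exact body_tm_heq (bindAt_res p f γ γ' h) (t' := ⟨(gmCwF H K G).tmSub
      (K.decode (mk_Body_lt (bindAt p γ)) φ).1 ((gmCwF H K G).up (gYoMap H f) (bindAt p γ).1),
      congrArg (fun T => GTy.sub T ((gmCwF H K G).up (gYoMap H f) (bindAt p γ).1))
        (K.decode (mk_Body_lt (bindAt p γ)) φ).2⟩) (CwF.Bind.Body.res_heq _ _ _)

theorem encode_heq {a : C.Con} {p p' : (gmCwF H K G).Bind j (gYo H a)} (h : p = p') {t : p.Body}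
    {t' : p'.Body} (e : HEq t.1 t'.1) :
    HEq ((K.decode (mk_Body_lt p)).symm t) ((K.decode (mk_Body_lt p')).symm t') := by
  subst h
  rw [Subtype.ext (eq_of_heq e)]

theorem decode_heq {a : C.Con} {p p' : (gmCwF H K G).Bind j (gYo H a)} (h : p = p')
    {φ : K.El (K.code j p.Body (mk_Body_lt p))} {φ' : K.El (K.code j p'.Body (mk_Body_lt p'))}
    (e : HEq φ φ') :
    HEq (K.decode (mk_Body_lt p) φ).1 (K.decode (mk_Body_lt p') φ').1 := by
  subst h
  rw [eq_of_heq e]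

theorem gPi_sub (p : (gmCwF H K G).Bind j Y) (σ : GSub X Y) : (gPi p).sub σ = gPi (p.sub σ) := by
  refine GTy.ext_heq (G.pi.Pi_sub _ _ _) (DTy.ext_heq (fun a γ => ?_)
    fun a b f γ γ' e φ ψ h => ?_) fun a γ φ ψ h => ?_
  · change K.code j (bindAt p (σ.psh.app γ)).Body (mk_Body_lt _) = _
    rw [bindAt_sub]
  · refine encode_heq (bindAt_sub p σ γ') ((CwF.Bind.Body.res_heq _ _ _).trans (HEq.trans ?_
      (CwF.Bind.Body.res_heq _ _ _).symm))
    have key : ∀ (p p' : (gmCwF H K G).Bind j (gYo H b)) (_ : p = p')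
        (t : GTm K G j (gmExt (gYo H b) p.1)) (t' : GTm K G j (gmExt (gYo H b) p'.1)),
        HEq t t' →
        HEq ((gmCwF H K G).tmSub t ((gmCwF H K G).up (gYoMap H f) p.1))
          ((gmCwF H K G).tmSub t' ((gmCwF H K G).up (gYoMap H f) p'.1)) := by
      intro p p' e t t' h
      subst e
      rw [eq_of_heq h]
    exact key _ _ (bindAt_sub p σ γ) _ _ (decode_heq (bindAt_sub p σ γ) h)
  · refine G.pi.lam_heq (by rw [σ.env_app, G.tySub_comp]) ?_
    exact body_tm_heq (bindAt_sub p σ γ) (decode_heq (bindAt_sub p σ γ) h)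

/-- Abstraction. -/
noncomputable abbrev gLam (A : GTy K G j X) (t : GTm K G j (gmExt X A)) : GTm K G j X where
  ty := gPi ⟨A, t.ty⟩
  tm := G.pi.lam A.ty t.tm
  mtm := ⟨(gPi ⟨A, t.ty⟩).psh, fun γ => (K.decode (mk_Body_lt (bindAt ⟨A, t.ty⟩ γ))).symm
      ⟨(gmCwF H K G).tmSub t ((gmCwF H K G).up (gName γ) A), rfl⟩,
    fun f γ γ' h => by
      refine congrArg (K.decode (mk_Body_lt _)).symm (Subtype.ext (eq_of_heq ?_))
      refine (CwF.Bind.Body.res_heq _ _ _).trans ?_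
      rw [Equiv.apply_symm_apply]
      exact ((gmCwF H K G).tmSub_up_comp_heq _ _ _ _).trans
        ((gmCwF H K G).tmSub_up_congr (gName_res f γ γ' h).symm _ _)⟩
  tyOf_tm := (G.pi.tyOf_lam _ _).trans (congrArg (G.pi.Pi _) t.tyOf_tm)
  mtm_fst := rfl
  comm γ := by
    refine Eq.trans ?_ (G.pi.lam_sub _ _ _).symm
    exact congrArg (fun w : (bindAt ⟨A, t.ty⟩ γ).Body => G.pi.lam _ w.1.tm)
      (Equiv.apply_symm_apply _ _)

/-- The section of a function type of the presheaf model which underlies a section of a glued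
function type. -/
noncomputable abbrev piFn {p : (gmCwF H K G).Bind j X} (s : Sec (gPi p).psh) :
    Sec (mPi p.1.psh p.2.psh) where
  app γ := (K.decode (mk_PiSet_lt _ _ _)).symm
    (bodyFn (K.decode (mk_Body_lt (bindAt p γ)) (s.app γ)))
  nat {a b} f γ γ' h := by
    refine congrArg (K.decode (mk_PiSet_lt _ _ _)).symm ?_
    rw [Equiv.apply_symm_apply, ← s.nat f γ γ' h]
    refine (bodyFn_res f (gName_res f γ γ' h) (bindAt_res p f γ γ' h) _).symm.trans ?_
    exact congrArg bodyFn (Equiv.apply_symm_apply (K.decode (mk_Body_lt (bindAt p γ'))) _).symm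

/-- The body of a glued function is underlain by its application to the generic argument. -/
theorem body_tm {p : (gmCwF H K G).Bind j X} {t : GTm K G j X} (h : t.ty = gPi p) {a : C.Con}
    (γ : X.psh.obj a) :
    (K.decode (mk_Body_lt (bindAt p γ)) ((t.mtm.sec (GTm.mtm_ty h)).app γ)).1.tm =
      G.tmSub (G.pi.app p.1.ty p.2.ty t.tm (GTm.tm_ty h)) (G.up (X.env γ) p.1.ty) := by
  apply G.pi.lam_injective
  · rw [G.tyOf_tmSub, G.pi.tyOf_app]
    exact GTm.tm_ty (K.decode (mk_Body_lt (bindAt p γ)) ((t.mtm.sec (GTm.mtm_ty h)).app γ)).2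
  · rw [← G.pi.lam_sub, G.pi.lam_app]
    exact GTm.und_sec h γ

/-- Application. -/
noncomputable abbrev gApp (p : (gmCwF H K G).Bind j X) (t : GTm K G j X) (h : t.ty = gPi p) :
    GTm K G j (gmExt X p.1) where
  ty := p.2
  tm := G.pi.app p.1.ty p.2.ty t.tm (GTm.tm_ty h)
  mtm := ⟨p.2.psh, mApp (piFn (t.mtm.sec (GTm.mtm_ty h)))⟩
  tyOf_tm := G.pi.tyOf_app _ _ _ _
  mtm_fst := rfl
  comm {a} x := by
    refine (congrArg (fun φ : PiSet p.1.psh p.2.psh (name x.1) => p.2.und x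
      (φ.ev (C.id a) x.1 (X.psh.res_id x.1).symm x.2)) (Equiv.apply_symm_apply _ _)).trans ?_
    refine (und_ev _ (C.id a) x.1 _ x.2 ?_).trans ?_
    · rw [GTy.tyOf_und, H.sub_id, G.tySub_id]
    · rw [body_tm h, ← G.tmSub_comp]
      refine congrArg (G.tmSub _) ?_
      unfold CwF.up CwF.upTo
      rw [G.pair_comp]
      refine G.pair_congr _ _ ?_ (G.q_pair _ _ _ _)
      rw [D.assoc, G.p_pair, H.sub_id, D.comp_id]

variable (H K G)

/-- Function types of glued meta-level types. -/
noncomputable abbrev gmPi : PiStr (gmCwF H K G) where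
  Pi A B := gPi ⟨A, B⟩
  Pi_sub A B σ := gPi_sub ⟨A, B⟩ σ
  lam A t := gLam A t
  app A B t h := gApp ⟨A, B⟩ t h
  tyOf_lam _ _ := rfl
  tyOf_app _ _ _ _ := rfl
  app_lam A t := GTm.ext rfl (G.pi.app_lam_of_eq t.tyOf_tm _) (by
    refine Eq.trans ?_ (MTm.eq_mk t.mtm t.mtm_fst).symm
    refine congrArg (Sigma.mk t.ty.psh) (Sec.ext_app fun a x => ?_)
    change PiSet.ev (K.decode (mk_PiSet_lt A.psh t.ty.psh (name x.1)) ((K.decode _).symm (bodyFn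
      (K.decode (mk_Body_lt (bindAt ⟨A, t.ty⟩ x.1)) ((K.decode _).symm _))))) (C.id a) x.1
      (Psh.res_id _ x.1).symm x.2 = _
    rw [Equiv.apply_symm_apply, Equiv.apply_symm_apply]
    refine (congrArg (fun φ : PiSet A.psh t.ty.psh (name x.1) => φ.ev (C.id a) x.1
      (Psh.res_id _ x.1).symm x.2) (MTm.sec_sub t.mtm t.mtm_fst (mUp (name x.1) A.psh)
        (congrArg (fun B => DTy.sub B (mUp (name x.1) A.psh)) t.mtm_fst))).trans ?_
    exact PiSet.sub_ev _ _ _ _ _ _)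
  lam_app A B t h := GTm.ext h.symm (G.pi.lam_app _ _ _ (GTm.tm_ty h)) (by
    refine Eq.trans ?_ (MTm.eq_mk t.mtm (GTm.mtm_ty h)).symm
    refine congrArg (Sigma.mk _) (Sec.ext_app fun a γ => ?_)
    change (K.decode (mk_Body_lt (bindAt ⟨A, B⟩ γ))).symm ⟨(gmCwF H K G).tmSub (gApp ⟨A, B⟩ t h)
      ((gmCwF H K G).up (gName γ) A), _⟩ = _
    rw [Equiv.symm_apply_eq]
    refine Subtype.ext (GTm.ext ?_ (body_tm h γ).symm ?_)
    · exact (K.decode (mk_Body_lt (bindAt ⟨A, B⟩ γ)) ((t.mtm.sec (GTm.mtm_ty h)).app γ)).2.symm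
    · refine Eq.trans ?_ (MTm.eq_mk _ (GTm.mtm_ty (K.decode (mk_Body_lt (bindAt ⟨A, B⟩ γ))
        ((t.mtm.sec (GTm.mtm_ty h)).app γ)).2)).symm
      refine congrArg (Sigma.mk _) (PiSet.ext_ev (A := A.psh) (B := B.psh) (ρ := name γ)
        fun b g δ e α => ?_)
      refine (PiSet.sub_ev (mApp (piFn (t.mtm.sec (GTm.mtm_ty h)))) (name γ) g δ e α).trans ?_
      change PiSet.ev (K.decode (mk_PiSet_lt A.psh B.psh _)
        ((piFn (t.mtm.sec (GTm.mtm_ty h))).app δ)) (C.id b) δ (Psh.res_id _ δ).symm α = _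
      rw [mPi_ev_res _ g γ δ e, PiSet.ev_congr _ (C.comp_id g)]
      exact congrArg (fun φ : PiSet A.psh B.psh (name γ) => φ.ev g δ e α)
        (Equiv.apply_symm_apply _ _))
  lam_sub A t σ := GTm.ext (gPi_sub ⟨A, t.ty⟩ σ) (G.pi.lam_sub _ _ _)
    (MTm.ext_heq (congrArg GTy.psh (gPi_sub ⟨A, t.ty⟩ σ)) fun a γ => by
      refine encode_heq (bindAt_sub ⟨A, t.ty⟩ σ γ) ?_
      exact ((gmCwF H K G).tmSub_up_congr (gName_app σ γ) _ _).trans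
        ((gmCwF H K G).tmSub_up_comp_heq _ _ _ _).symm)

end GluedPi

/-! ### The glued model -/

section GluedModel

variable {C : Base.{0, 0}} [Countable C.Con] [∀ a b, Countable (C.Sub a b)] {F : Fam C}
  [∀ j a, Countable (F.Tm j a)]

/-- The family structure of glued meta-level types and terms, closed under all type formers. -/
noncomputable abbrev gmFam {D : Base.{1, 0}} (H : BaseHom C D) (K : SetHierarchy) (G : Fam D)
    [∀ j Γ, Countable (G.Ty j Γ)] [∀ j Γ, Countable (G.Tm j Γ)] : Fam (gBase H) where
  toCwF := gmCwF H K G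
  univ := gmU H K G
  sg := gmSg H K G
  pi := gmPi H K G
  nat := gmNat H K G

variable {N : TwoModel.{1, 0}} {H : BaseHom C N.base} (f : FamHom H F (N.fam .obj))
  (K : SetHierarchy) [∀ j Γ, Countable ((N.fam .mta).Ty j Γ)]
  [∀ j Γ, Countable ((N.fam .mta).Tm j Γ)]

/-- The two family structures of the glued model. -/
noncomputable def gFam : Level → Fam (gBase H)
  | .obj => goFam f
  | .mta => gmFam H K (N.fam .mta)

/-- The glued model: the objects of `N`, displayed over the presheaf model along `f`. -/
noncomputable def gModel : TwoModel.{1, 0} where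
  base := gBase H
  fam := gFam f K
  lifting _ := gLifting f (N.lifting ()) K

/-- The projection of object-level types and terms. -/
noncomputable abbrev gProjObj : FamHom (C := gBase H)
    { con := GCon.con, sub := GSub.sub, sub_id := fun _ => rfl, sub_comp := fun _ _ => rfl,
      con_emp := rfl } (goFam f) (N.fam .obj) where
  ty A := A.ty
  tm t := t.tm
  tyOf_tm _ := rfl
  ty_sub _ _ := rfl
  tm_sub _ _ := rfl
  con_ext _ := rfl
  sub_p _ := HEq.rfl
  tm_q _ := HEq.rfl
  ty_U _ _ := rfl
  tm_code _ := rfl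
  ty_Sg A B B' e := by
    obtain rfl := eq_of_heq e
    rfl
  tm_tup A B t w ht hw B' ht' hw' e := by
    obtain rfl := eq_of_heq e
    rfl
  ty_Pi A B B' e := by
    obtain rfl := eq_of_heq e
    rfl
  tm_lam A t t' e := by
    obtain rfl := eq_of_heq e
    rfl
  ty_Nat _ _ := rfl
  tm_zero _ _ := rfl
  tm_suc _ _ := rfl
  tm_elim P z s t hz hs ht P' s' hz' hs' ht' eP es := by
    obtain rfl := eq_of_heq eP
    obtain rfl := eq_of_heq es
    rfl

/-- The projection of meta-level types and terms. -/
noncomputable abbrev gProjMta (H : BaseHom C N.base) : FamHom (C := gBase H)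
    { con := GCon.con, sub := GSub.sub, sub_id := fun _ => rfl, sub_comp := fun _ _ => rfl,
      con_emp := rfl } (gmFam H K (N.fam .mta)) (N.fam .mta) where
  ty A := A.ty
  tm t := t.tm
  tyOf_tm t := t.tyOf_tm
  ty_sub _ _ := rfl
  tm_sub _ _ := rfl
  con_ext _ := rfl
  sub_p _ := HEq.rfl
  tm_q _ := HEq.rfl
  ty_U _ _ := rfl
  tm_code _ := rfl
  ty_Sg A B B' e := by
    obtain rfl := eq_of_heq e
    rfl
  tm_tup A B t w ht hw B' ht' hw' e := by
    obtain rfl := eq_of_heq e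
    rfl
  ty_Pi A B B' e := by
    obtain rfl := eq_of_heq e
    rfl
  tm_lam A t t' e := by
    obtain rfl := eq_of_heq e
    rfl
  ty_Nat _ _ := rfl
  tm_zero _ _ := rfl
  tm_suc _ _ := rfl
  tm_elim P z s t hz hs ht P' s' hz' hs' ht' eP es := by
    obtain rfl := eq_of_heq eP
    obtain rfl := eq_of_heq es
    rfl

/-- The projection of the glued model to `N`. -/
noncomputable def gProj : Hom (gModel f K) N where
  base :=
    { con := GCon.con, sub := GSub.sub, sub_id := fun _ => rfl, sub_comp := fun _ _ => rfl,
      con_emp := rfl }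
  fam := fun i => match i with
    | .obj => gProjObj f
    | .mta => gProjMta K H
  ty_lift _ _ _ _ := rfl
  tm_quote _ _ _ _ := rfl

end GluedModel

/-! ### Generic elements -/

section GenericElement

variable {C : Base.{0, 0}} {D : Base.{1, 0}} {H : BaseHom C D} {F : Fam C} {G : Fam D}
  {f : FamHom H F G} {j : ℕ}

/-- A glued context `X` has a generic element over `a` if its underlying context is the image of
`a` and some element over `a` has the identity as its environment. -/
def HasGeneric (X : GCon H) (a : C.Con) : Prop :=
  X.con = H.con a ∧ ∃ γ : X.psh.obj a, HEq (X.env γ) (D.id (H.con a))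

theorem HasGeneric.emp : HasGeneric (gBase H).emp C.emp := by
  refine ⟨H.con_emp.symm, (), ?_⟩
  have key : ∀ (Δ : D.Con) (_ : Δ = D.emp) , HEq (D.eps Δ) (D.id Δ) := by
    intro Δ e
    subst e
    exact heq_of_eq (D.eps_uniq _).symm
  exact key _ H.con_emp

/-- A glued type whose underlying type is the image of `A` takes a value with image `A`. -/
theorem HasGeneric.exists_ty {X : GCon H} {a : C.Con} (h : HasGeneric X a) (A : GOTy f j X)
    (B : G.Ty j (H.con a)) (hA : HEq A.ty B) : ∃ γ : X.psh.obj a, HEq (X.env γ) (D.id (H.con a)) ∧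
      f.ty (A.psh.app γ) = B := by
  obtain ⟨e, γ, hγ⟩ := h
  refine ⟨γ, hγ, (A.comm γ).trans (eq_of_heq ?_)⟩
  have key : ∀ (Δ : D.Con) (_ : Δ = H.con a) (T : G.Ty j Δ) (_ : HEq T B)
      (σ : D.Sub (H.con a) Δ) (_ : HEq σ (D.id (H.con a))), HEq (G.tySub T σ) B := by
    intro Δ e T hT σ hσ
    subst e
    obtain rfl := eq_of_heq hT
    obtain rfl := eq_of_heq hσ
    exact heq_of_eq (G.tySub_id _)
  exact key _ e _ hA _ hγ

/-- The image of the value of a glued term at a generic element is the underlying term. -/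
theorem HasGeneric.exists_tm {X : GCon H} {a : C.Con} (h : HasGeneric X a) (t : GOTm f j X)
    (u : G.Tm j (H.con a)) (ht : HEq t.tm u) : ∃ w : F.Tm j a, f.tm w = u := by
  obtain ⟨e, γ, hγ⟩ := h
  refine ⟨t.psh.app γ, (t.comm γ).trans (eq_of_heq ?_)⟩
  have key : ∀ (Δ : D.Con) (_ : Δ = H.con a) (s : G.Tm j Δ) (_ : HEq s u)
      (σ : D.Sub (H.con a) Δ) (_ : HEq σ (D.id (H.con a))), HEq (G.tmSub s σ) u := by
    intro Δ e s hs σ hσ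
    subst e
    obtain rfl := eq_of_heq hs
    obtain rfl := eq_of_heq hσ
    exact heq_of_eq (G.tmSub_id _)
  exact key _ e _ ht _ hγ

/-- If `f` is injective on types, an extended context has a generic element. -/
theorem HasGeneric.ext {X : GCon H} {a : C.Con} (h : HasGeneric X a) (A : GOTy f j X)
    (B : F.Ty j a) (hA : HEq A.ty (f.ty B))
    (hf : Function.Injective (f.ty : F.Ty j a → G.Ty j (H.con a))) :
    HasGeneric (goExt X A) (F.ext a B) := by
  obtain ⟨γ, hγ, e⟩ := h.exists_ty A _ hA
  -- the generic element of the extended context lives over the extension by the value of `A`,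
  -- which has the same image as `B`
  obtain rfl : A.psh.app γ = B := hf e
  have key : ∀ (Δ Δ' : D.Con) (_ : Δ = H.con a) (T : G.Ty j Δ) (T' : G.Ty j (H.con a))
      (_ : HEq T T') (σ : D.Sub (H.con a) Δ) (_ : HEq σ (D.id (H.con a))) (h'),
      Δ' = G.ext (H.con a) T' →
      G.ext Δ T = Δ' ∧ HEq (G.upTo σ T T' h') (D.id Δ') := by
    intro Δ Δ' e T T' hT σ hσ h' e'
    subst e e'
    obtain rfl := eq_of_heq hT
    obtain rfl := eq_of_heq hσ
    exact ⟨rfl, heq_of_eq (G.upTo_id _ _)⟩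
  obtain ⟨e₁, e₂⟩ := key _ _ h.1 _ _ hA _ hγ (A.comm γ) (f.con_ext _)
  exact ⟨e₁, new A.psh γ, (env_new_heq A γ).trans e₂⟩

end GenericElement

/-! ### The embedding is full -/

section Fullness

variable (K : SetHierarchy)

/-- The embedding is injective on types, because evaluation at the generic environment is a left
inverse. -/
theorem embTy_injective (K : SetHierarchy) {j : ℕ} {Γ : SynO.base.Con} :
    Function.Injective (embTy : TyO j Γ → Ty0 j (embCon Γ)) := by
  intro A B h
  rw [← ETy_genEnv K A, h, ETy_genEnv K B]

/-- The model obtained by gluing the syntax of two-level type theory along the embedding. -/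
noncomputable abbrev gSyn : TwoModel.{1, 0} :=
  gModel (N := liftCon Syn2) (H := emb.base) (emb.fam ()) K

/-- The projection of the object-level part of the glued model. Its codomain is the codomain of
`emb`, which agrees with the object-level part of `liftCon Syn2` only up to the choice of the
(empty) family of liftings. -/
noncomputable abbrev gSynProj : Hom (gSyn K).reduct (liftCon Syn2.reduct) where
  base := (gProj (N := liftCon Syn2) (H := emb.base) (emb.fam ()) K).base
  fam _ := (gProj (N := liftCon Syn2) (H := emb.base) (emb.fam ()) K).fam .obj
  ty_lift l := l.elim
  tm_quote l := l.elim

/-- The value in the glued model of a context of the object theory has a generic element. -/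
theorem hasGeneric_reduct (Γ : SynO.base.Con) :
    HasGeneric (H := emb.base) (evCon (gSyn K).reduct Γ) Γ := by
  induction Γ using SCon.ind with
  | emp => exact HasGeneric.emp
  | ext i j Γ A ih =>
    exact ih.ext (f := emb.fam ()) (evTy (gSyn K).reduct A) A (evTy_nat (gSynProj K) A)
      (embTy_injective K)

theorem hasGeneric_emb (Γ : SynO.base.Con) :
    HasGeneric (H := emb.base) (evCon (gSyn K) (embCon Γ)) Γ := by
  have e : evCon (gSyn K) (embCon Γ) = evCon (gSyn K).reduct Γ :=
    evCon_nat (M := liftCon Syn2.reduct) (eval (gSyn K)).reduct.ofLift Γ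
  rw [e]
  exact hasGeneric_reduct K Γ

/-- The embedding is full on types: the value in the glued model of an object-level type, at the
generic element, is a preimage. -/
theorem embTy_surjective (K : SetHierarchy) {j : ℕ} {Γ : SynO.base.Con} (A : Ty0 j (embCon Γ)) :
    ∃ B : TyO j Γ, embTy B = A := by
  obtain ⟨γ, -, h⟩ := (hasGeneric_emb K Γ).exists_ty (f := emb.fam ()) (evTy (gSyn K) A) A
    ((evTy_nat (gProj (N := liftCon Syn2) (H := emb.base) (emb.fam ()) K) A).trans (evSyn_ty A))
  exact ⟨_, h⟩

/-- The embedding is full on terms. -/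
theorem embTm_surjective (K : SetHierarchy) {j : ℕ} {Γ : SynO.base.Con} (t : Tm0 j (embCon Γ)) :
    ∃ w : TmO j Γ, embTm w = t :=
  (hasGeneric_emb K Γ).exists_tm (f := emb.fam ()) (evTm (gSyn K) t) t
    ((evTm_nat (gProj (N := liftCon Syn2) (H := emb.base) (emb.fam ()) K) t).trans (evSyn_tm t))

/-- Evaluating an embedded term at the generic environment gives back the term. -/
theorem ETm_genEnv {j : ℕ} {Γ : SynO.base.Con} (t : TmO j Γ) :
    (ETm K (embTm t)).app (genEnv K Γ) = t := by
  have h : HEq ((evTm (ptModel SynO) t).app (evCon (ptModel SynO) Γ).elt) t :=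
    (evTm_nat (ptToSyn SynO) t).trans (evSyn_tm t)
  have h' : HEq (evTm (ptModel SynO) t) (ETm K (embTm t)) :=
    (evTm_nat (ptToPsh K SynO) t).trans
      (evTm_nat (M := liftCon Syn2.reduct) (E K).reduct.ofLift t).symm
  have key : ∀ (x : PtCon SynO.base) (u : PSub x.psh (tmPsh SynO.objFam j)),
      x = ⟨EEmb K Γ, Γ, genEnv K Γ⟩ → HEq u (ETm K (embTm t)) → HEq (u.app x.elt) t →
      (ETm K (embTm t)).app (genEnv K Γ) = t := by
    intro x u e e' e''
    subst e
    obtain rfl := eq_of_heq e'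
    exact eq_of_heq e''
  refine key _ _ ((evPt_eq K Γ).trans ?_) h' h
  have e := mk_genEnv K Γ
  generalize preEnv K Γ.1 Γ.2 = y at e
  subst e
  rfl

end Fullness

end TwoLevel

theorem mainTheorem2 (K : TwoLevel.SetHierarchy) :
    (∀ (j : ℕ) (Γ : TwoLevel.SynO.base.Con) (A : TwoLevel.Ty0 j (TwoLevel.embCon Γ)),
      TwoLevel.embTy (TwoLevel.stageTy K A) = A) ∧
    (∀ (j : ℕ) (Γ : TwoLevel.SynO.base.Con) (A : TwoLevel.Ty0 j (TwoLevel.embCon Γ))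
      (t : TwoLevel.Tm0 j (TwoLevel.embCon Γ)), (TwoLevel.Syn2.fam .obj).tyOf t = A →
        TwoLevel.SynO.objFam.tyOf (TwoLevel.stageTm K t) = TwoLevel.stageTy K A ∧
        TwoLevel.embTm (TwoLevel.stageTm K t) = t) := by
  refine ⟨fun j Γ A => ?_, fun j Γ A t h => ⟨?_, ?_⟩⟩
  · obtain ⟨B, rfl⟩ := TwoLevel.embTy_surjective K A
    exact congrArg TwoLevel.embTy (TwoLevel.ETy_genEnv K B)
  · subst h
    exact congrArg (fun T => T.app (TwoLevel.genEnv K Γ)) (((TwoLevel.E K).fam .obj).tyOf_tm t)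
  · obtain ⟨w, rfl⟩ := TwoLevel.embTm_surjective K t
    exact congrArg TwoLevel.embTm (TwoLevel.ETm_genEnv K w)
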